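/- For $\operatorname{Re}(a)>0$ and points $\sigma_0,z$ of the Riemann surface of the logarithm, the first hyperterminant is $$F^{(1)}(z;a;\sigma_0)=\int_0^{[\pi-\arg\sigma_0]}\frac{e^{\sigma_0\tau}\tau^{a-1}}{z-\tau}\,d\tau,\qquad |\arg(\sigma_0 z)|<\pi,$$ the integral being along the ray $\arg\tau=\pi-\arg\sigma_0$ from $0$ to $\infty$, and it is extended to all other $z$ on the Riemann surface of the logarithm by analytic continuation. For $\operatorname{Re}(N_0)>0$ (with $|\arg N_0|<\pi/2$ and principal square roots) put $$i a_0(z)=1+\frac{\sigma_0 z}{N_0},\qquad \tfrac12\alpha_0^2(z)=1+\frac{\sigma_0 z}{N_0}+\ln\Big(e^{-\pi i}\frac{\sigma_0 z}{N_0}\Big),\qquad g_0(z)=\frac1{a_0(z)}-\frac1{\alpha_0(z)},$$ where $\alpha_0$ is the branch, analytic in the sector $|\arg(e^{-\pi i}\sigma_0zN_0^{-1})|<2\pi$, with $a_0\sim\alpha_0-\tfrac13 i\alpha_0^2$ as $\alpha_0\to0$, and $g_0$ takes its limiting value $i/3$ at the point where $a_0=\alpha_0=0$. Theorem. Assume that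 $\sigma_0$ and its reciprocal are bounded, and let $\delta>0$. Then $$\frac{e^{-\sigma_0 z}}{z^{N_0}}F^{(1)}(z;N_0+1;\sigma_0)=\pi i\,\operatorname{erfc}\Big(\alpha_0(z)\sqrt{\tfrac12N_0}\Big)+i\sqrt{\frac{2\pi}{N_0}}\,g_0(z)\,e^{-\frac12\alpha_0^2(z)N_0}+\mathcal O\Big(e^{-\frac12\alpha_0^2(z)N_0}N_0^{-3/2}\Big)$$ as $\operatorname{Re}(N_0)\to+\infty$ with $N_0\in\mathbb C$, uniformly with respect to $|\arg(e^{-\pi i}\sigma_0zN_0^{-1})|\le 2\pi-\delta$. That is, for all $K$ and $\delta>0$ there are $C$ and $R>0$ such that, whenever $|\sigma_0|\le K$, $|\sigma_0^{-1}|\le K$, $\operatorname{Re}(N_0)\ge R$ and $|\arg(e^{-\pi i}\sigma_0zN_0^{-1})|\le 2\pi-\delta$, the difference of the left-hand side and the two explicit terms on the right is at most $C\,\big|e^{-\frac12\alpha_0^2(z)N_0}\big|\,|N_0|^{-3/2}$ in absolute value. -/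

import Mathlib

/-!
Points of the Riemann surface of the logarithm are represented by their logarithms: the complex
number `s` stands for the point `σ₀` with `log |σ₀| = Re s` and `arg σ₀ = Im s`, and `ζ` stands
for the point `z` with `log |z| = Re ζ` and `arg z = Im ζ`. The underlying complex numbers are
`exp s` and `exp ζ`, and `z ^ N` is `exp (N * ζ)`.
-/

namespace Hyperterminant
open Complex Set Filter Topology MeasureTheory Asymptotics

/-! ### The complementary error function -/

/-- `erfc x = (2 / √π) ∫_x^∞ e^{-τ²} dτ`, for complex `x`, along the horizontal ray
`τ = x + t`, `t > 0`. -/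
noncomputable def erfc (x : ℂ) : ℂ :=
  2 / (Real.sqrt Real.pi : ℂ) * ∫ t in Ioi (0 : ℝ), exp (-(x + t) ^ 2)

/-! ### The first hyperterminant -/

/-- The integral `∫_0^{[π - arg σ₀]} e^{σ₀ τ} τ^{a-1} / (z - τ) dτ` along the ray
`arg τ = π - arg σ₀` from `0` to `∞`, that is `τ = r e^{i(π - arg σ₀)}`, `r > 0`, with
`log τ = log r + i(π - arg σ₀)`. Here `s = log σ₀` and `ζ = log z`. -/
noncomputable def rayIntegral (ζ a s : ℂ) : ℂ :=
  ∫ r in Ioi (0 : ℝ),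
    exp (exp s * (r * exp ((Real.pi - s.im) * I))) *
      exp ((a - 1) * (Real.log r + (Real.pi - s.im) * I)) /
      (exp ζ - r * exp ((Real.pi - s.im) * I)) * exp ((Real.pi - s.im) * I)


theorem measurable_kernel (p : ℂ) (g : ℝ → ℂ) (hg : Measurable g) :
    AEStronglyMeasurable (fun r : ℝ => exp (p * Real.log r) * g r) (volume.restrict (Ioi 0)) := by
  apply Measurable.aestronglyMeasurable
  fun_prop

theorem integrable_kernel {p : ℂ} (hp : -1 < p.re) {ρ : ℝ} (hρ : 0 < ρ) :
    IntegrableOn (fun r : ℝ => Real.exp (-ρ * r) * Real.exp (p.re * Real.log r)) (Ioi 0) := by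
  have := integrableOn_rpow_mul_exp_neg_mul_rpow (s := p.re) (p := 1) hp one_pos hρ
  refine this.congr_fun ?_ measurableSet_Ioi
  intro r hr
  have hr : 0 < r := hr
  simp only [Real.rpow_one]
  rw [Real.rpow_def_of_pos hr]
  rw [mul_comm, mul_comm (Real.log r)]

theorem norm_kernel (p : ℂ) (r : ℝ) :
    ‖exp (p * Real.log r)‖ = Real.exp (p.re * Real.log r) := by
  rw [norm_exp]; simp

/-- Auxiliary to the existence proof below. -/
noncomputable def M (p : ℂ) (ρ : ℝ) (w : ℂ) : ℂ :=
  ∫ r in Ioi (0 : ℝ), exp (p * Real.log r) * (exp (-(ρ * r : ℝ)) / (w + ρ * r))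

theorem differentiableAt_M {p : ℂ} (hp : -1 < p.re) {ρ : ℝ} (hρ : 0 < ρ) {w : ℂ}
    (hw : w ∈ slitPlane) : DifferentiableAt ℂ (M p ρ) w := by
  obtain ⟨c, hc, hcw⟩ := Metric.isOpen_iff.mp isOpen_slitPlane w hw
  have hfar : ∀ v ∈ Metric.ball w (c / 2), ∀ r ∈ Ioi (0 : ℝ), c / 2 ≤ ‖v + ρ * r‖ := by
    intro v hv r hr
    by_contra h
    push Not at h
    have h1 : (-(ρ * r : ℝ) : ℂ) ∈ Metric.ball w c := by
      rw [Metric.mem_ball, dist_eq_norm] at *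
      have : (-(ρ * r : ℝ) : ℂ) - w = (v - w) - (v + ρ * r) := by push_cast; ring
      rw [this]
      calc _ ≤ ‖v - w‖ + ‖v + ρ * r‖ := norm_sub_le _ _
        _ < c := by linarith
    have h2 := hcw h1
    rw [← ofReal_neg, ofReal_mem_slitPlane] at h2
    have : 0 < ρ * r := mul_pos hρ hr
    linarith
  have key := hasDerivAt_integral_of_dominated_loc_of_deriv_le (μ := volume.restrict (Ioi (0 : ℝ)))
    (F := fun (v : ℂ) (r : ℝ) => exp (p * Real.log r) * (exp (-(ρ * r : ℝ)) / (v + ρ * r)))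
    (F' := fun (v : ℂ) (r : ℝ) => exp (p * Real.log r) * (-exp (-(ρ * r : ℝ)) / (v + ρ * r) ^ 2))
    (x₀ := w) (s := Metric.ball w (c / 2))
    (bound := fun r => (Real.exp (-ρ * r) * Real.exp (p.re * Real.log r)) * (4 / c ^ 2))
    (Metric.ball_mem_nhds _ (by positivity)) ?_ ?_ ?_ ?_ ?_ ?_
  · exact key.2.differentiableAt
  · exact Eventually.of_forall fun v => measurable_kernel _ _ (by fun_prop)
  · refine Integrable.mono' ((integrable_kernel hp hρ).mul_const (2 / c))
      (measurable_kernel _ _ (by fun_prop)) ?_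
    filter_upwards [ae_restrict_mem measurableSet_Ioi] with r hr
    have h1 := hfar w (Metric.mem_ball_self (by positivity)) r hr
    rw [norm_mul, norm_kernel, norm_div, norm_exp]
    have e1 : (-((ρ * r : ℝ) : ℂ)).re = -ρ * r := by simp
    rw [e1, mul_comm (Real.exp (-ρ * r)), mul_assoc]
    gcongr
    rw [div_eq_mul_inv]
    gcongr
    rw [show 2 / c = (c / 2)⁻¹ by field_simp]
    gcongr
  · exact measurable_kernel _ _ (by fun_prop)
  · filter_upwards [ae_restrict_mem measurableSet_Ioi] with r hr v hv
    have h1 := hfar v hv r hr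
    rw [norm_mul, norm_kernel, norm_div, norm_neg, norm_exp, norm_pow]
    have e1 : (-((ρ * r : ℝ) : ℂ)).re = -ρ * r := by simp
    rw [e1, mul_comm (Real.exp (-ρ * r)), mul_assoc]
    gcongr
    rw [div_eq_mul_inv]
    gcongr
    rw [show 4 / c ^ 2 = ((c / 2) ^ 2)⁻¹ by field_simp; norm_num]
    gcongr
  · exact (integrable_kernel hp hρ).mul_const _
  · filter_upwards [ae_restrict_mem measurableSet_Ioi] with r hr v hv
    have h1 := hfar v hv r hr
    have h2 : v + ρ * r ≠ 0 := by
      intro h; rw [h, norm_zero] at h1; linarith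
    have h3 := ((hasDerivAt_const v (exp (-(ρ * r : ℝ)))).div
      ((hasDerivAt_id v).add_const ((ρ : ℂ) * r)) h2).const_mul (exp (p * Real.log r))
    refine h3.congr_deriv ?_
    simp

/-- The derivative of `w ↦ ∫ q ^ p e ^ (- w (1 + q)) / (1 + q)`. -/
theorem hasDerivAt_K {p : ℂ} (hp : -1 < p.re) {w : ℝ} (hw : 0 < w) :
    HasDerivAt (fun w : ℝ => ∫ q in Ioi (0 : ℝ),
      exp (p * Real.log q) * (exp (-(w * (1 + q) : ℝ)) / (1 + q)))
      (-exp (-w) * (exp (-(p + 1) * Real.log w) * Gamma (p + 1))) w := by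
  have key := hasDerivAt_integral_of_dominated_loc_of_deriv_le (μ := volume.restrict (Ioi (0 : ℝ)))
    (F := fun (v : ℝ) (q : ℝ) => exp (p * Real.log q) * (exp (-(v * (1 + q) : ℝ)) / (1 + q)))
    (F' := fun (v : ℝ) (q : ℝ) => exp (p * Real.log q) * (-exp (-(v * (1 + q) : ℝ))))
    (x₀ := w) (s := Ioi (w / 2))
    (bound := fun q => (Real.exp (-(w / 2) * q) * Real.exp (p.re * Real.log q)))
    (Ioi_mem_nhds (by linarith)) ?_ ?_ ?_ ?_ ?_ ?_
  · refine key.2.congr_deriv ?_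
    have hG := integral_cpow_mul_exp_neg_mul_Ioi (a := p + 1) (r := w)
      (by simp; linarith) hw
    have e1 : (1 / (w : ℂ)) ^ (p + 1) = exp (-(p + 1) * Real.log w) := by
      have : (1 / (w : ℂ)) = ((w⁻¹ : ℝ) : ℂ) := by push_cast; simp
      rw [this, cpow_def_of_ne_zero (by exact_mod_cast (inv_pos.mpr hw).ne'), ← ofReal_log
        (inv_pos.mpr hw).le, Real.log_inv]
      push_cast; ring_nf
    rw [← e1, ← hG, ← integral_const_mul]
    refine setIntegral_congr_fun measurableSet_Ioi fun q hq => ?_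
    have hq : 0 < q := hq
    simp only [add_sub_cancel_right]
    rw [cpow_def_of_ne_zero (by exact_mod_cast hq.ne'), ← ofReal_log hq.le]
    rw [show (-((w * (1 + q) : ℝ) : ℂ)) = -w + -(w * q) by push_cast; ring, exp_add, mul_comm p]
    ring
  · exact Eventually.of_forall fun v => measurable_kernel _ _ (by fun_prop)
  · refine Integrable.mono' (integrable_kernel hp hw)
      (measurable_kernel _ _ (by fun_prop)) ?_
    filter_upwards [ae_restrict_mem measurableSet_Ioi] with r hr
    have hr : 0 < r := hr
    rw [norm_mul, norm_kernel, norm_div, norm_exp, mul_comm]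
    gcongr
    have h1 : ‖(1 + r : ℂ)‖ = 1 + r := by
      rw [show (1 + r : ℂ) = ((1 + r : ℝ) : ℂ) by push_cast; ring, norm_real,
        Real.norm_of_nonneg (by linarith)]
    rw [h1]
    refine (div_le_self (Real.exp_pos _).le (by linarith)).trans ?_
    apply Real.exp_le_exp.mpr
    simp only [neg_re, ofReal_re]
    nlinarith
  · exact measurable_kernel _ _ (by fun_prop)
  · filter_upwards [ae_restrict_mem measurableSet_Ioi] with r hr v hv
    have hr : 0 < r := hr
    have hv : w / 2 < v := hv
    rw [norm_mul, norm_kernel, norm_neg, norm_exp, mul_comm]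
    gcongr
    simp only [neg_re, ofReal_re]
    nlinarith [mul_pos hr (sub_pos.mpr hv)]
  · exact integrable_kernel hp (by linarith)
  · filter_upwards [ae_restrict_mem measurableSet_Ioi] with r hr v hv
    have hr : 0 < r := hr
    have h2 : (1 + r : ℂ) ≠ 0 := by
      rw [show (1 + r : ℂ) = ((1 + r : ℝ) : ℂ) by push_cast; ring]
      exact_mod_cast (by linarith : (1 + r) ≠ 0)
    have h3 : HasDerivAt (fun v : ℝ => (-(v * (1 + r) : ℝ) : ℂ)) (-(1 + r)) v := by
      have := ((hasDerivAt_id v).mul_const (1 + r)).ofReal_comp.neg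
      refine this.congr_deriv ?_
      simp
    have h4 := (h3.cexp.div_const (1 + r : ℂ)).const_mul (exp (p * Real.log r))
    refine h4.congr_deriv ?_
    field_simp

theorem M_eq_K (p : ℂ) {ρ : ℝ} (hρ : 0 < ρ) {w : ℝ} (hw : 0 < w) :
    M p ρ w = exp (-p * Real.log ρ) / ρ * (exp w * exp (p * Real.log w) * ∫ q in Ioi (0 : ℝ),
      exp (p * Real.log q) * (exp (-(w * (1 + q) : ℝ)) / (1 + q))) := by
  have hwρ : 0 < w / ρ := by positivity
  have h := integral_comp_mul_left_Ioi
    (fun r : ℝ => exp (p * Real.log r) * (exp (-(ρ * r : ℝ)) / (w + ρ * r))) 0 hwρ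
  rw [mul_zero] at h
  have hM : M p ρ w = (w / ρ : ℝ) • ∫ q in Ioi (0 : ℝ),
      exp (p * Real.log (w / ρ * q)) * (exp (-(ρ * (w / ρ * q) : ℝ)) / (w + ρ * ((w / ρ * q : ℝ) : ℂ))) := by
    rw [h, smul_smul, mul_inv_cancel₀ hwρ.ne', one_smul]
    rfl
  rw [hM, ← integral_smul, ← integral_const_mul, ← integral_const_mul]
  refine setIntegral_congr_fun measurableSet_Ioi fun q hq => ?_
  have hq : 0 < q := hq
  have h1 : ρ * (w / ρ * q) = w * q := by field_simp
  have h2 : Real.log (w / ρ * q) = Real.log w - Real.log ρ + Real.log q := by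
    rw [Real.log_mul hwρ.ne' hq.ne', Real.log_div hw.ne' hρ.ne']
  have h3 : (w : ℂ) + ρ * ((w / ρ * q : ℝ) : ℂ) = w * (1 + q) := by
    rw [← ofReal_mul, h1]; push_cast; ring
  have h4 : (1 + q : ℂ) ≠ 0 := by
    rw [show (1 + q : ℂ) = ((1 + q : ℝ) : ℂ) by push_cast; ring]
    exact_mod_cast (by linarith : (1 + q) ≠ 0)
  have hwc : (w : ℂ) ≠ 0 := by exact_mod_cast hw.ne'
  have hρc : (ρ : ℂ) ≠ 0 := by exact_mod_cast hρ.ne'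
  simp only [h1, h2, h3, real_smul]
  rw [show -((w * (1 + q) : ℝ) : ℂ) = -(w : ℂ) + -((w * q : ℝ) : ℂ) by push_cast; ring,
    exp_add (-(w : ℂ)), exp_neg (w : ℂ),
    show p * ((Real.log w - Real.log ρ + Real.log q : ℝ) : ℂ) =
      -p * Real.log ρ + (p * Real.log w + p * Real.log q) by push_cast; ring,
    exp_add, exp_add]
  have := exp_ne_zero (w : ℂ)
  push_cast
  field_simp

theorem rayIntegral_eq (a s ζ : ℂ) :
    rayIntegral ζ a s = exp ((a - 1) * ((Real.pi - s.im) * I)) * exp ((Real.pi - s.im) * I) * exp s *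
      M (a - 1) (Real.exp s.re) (exp (s + ζ)) := by
  rw [rayIntegral, M, ← integral_const_mul]
  refine setIntegral_congr_fun measurableSet_Ioi fun r _ => ?_
  have h1 : exp s * exp ((Real.pi - s.im) * I) = -(Real.exp s.re : ℂ) := by
    rw [← exp_add, ofReal_exp]
    have : s + (Real.pi - s.im) * I = (s.re : ℂ) + Real.pi * I := by
      conv_lhs => rw [← re_add_im s]
      simp only [add_im, ofReal_im, mul_im, ofReal_re, I_im, I_re, mul_one, mul_zero, add_zero,
        zero_add]
      ring
    rw [this, exp_add, exp_pi_mul_I]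
    ring
  set E := exp ((Real.pi - s.im) * I) with hE
  have h2 : exp s * (r * E) = -((Real.exp s.re * r : ℝ) : ℂ) := by
    push_cast at h1 ⊢; linear_combination (r : ℂ) * h1
  have h3 : exp ζ - r * E = (exp (s + ζ) + (Real.exp s.re : ℝ) * r) / exp s := by
    have := exp_ne_zero s
    rw [exp_add]
    field_simp
    linear_combination (-r : ℂ) * h1
  have h4 : exp ((a - 1) * (Real.log r + (Real.pi - s.im) * I)) =
      exp ((a - 1) * Real.log r) * exp ((a - 1) * ((Real.pi - s.im) * I)) := by
    rw [← exp_add]; ring_nf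
  simp only [h2, h3, h4]
  rw [div_div_eq_mul_div]
  ring

/-- The integral, defined for `|arg (σ₀ z)| < π`, has an analytic continuation in `z` to the whole
Riemann surface of the logarithm, i.e. to an entire function of `ζ = log z`. -/
theorem exists_hyperterminant (a s : ℂ) (ha : 0 < a.re) : ∃ F : ℂ → ℂ, Differentiable ℂ F ∧
    ∀ ζ : ℂ, |(s + ζ).im| < Real.pi → F ζ = rayIntegral ζ a s := by
  set p := a - 1 with hp_def
  have hp : -1 < p.re := by simp [hp_def]; linarith
  obtain ⟨ρ, hρ_def⟩ : ∃ ρ, ρ = Real.exp s.re := ⟨_, rfl⟩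
  have hρ : 0 < ρ := hρ_def ▸ Real.exp_pos _
  let K : ℝ → ℂ := fun w => ∫ q in Ioi (0 : ℝ),
      exp (p * Real.log q) * (exp (-(w * (1 + q) : ℝ)) / (1 + q))
  let f : ℂ → ℂ := fun u => -exp (-exp u) * (exp (-p * u) * Gamma (p + 1))
  have hf : Differentiable ℂ f := by fun_prop
  obtain ⟨g, hg0, hg⟩ := hf.isExactOn_univ.with_val_at 0 (K 1)
  have hgd : Differentiable ℂ g := fun z => (hg z (mem_univ z)).differentiableAt
  have hreal : ∀ u : ℝ, K (Real.exp u) = g u := by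
    have hd : ∀ u : ℝ, HasDerivAt (fun u : ℝ => K (Real.exp u) - g u) 0 u := by
      intro u
      have h1 := (hasDerivAt_K hp (Real.exp_pos u)).scomp u (Real.hasDerivAt_exp u)
      have h2 := (hg u (mem_univ _)).comp_ofReal
      refine (h1.sub h2).congr_deriv ?_
      rw [Real.log_exp, real_smul, ofReal_exp]
      simp only [f]
      rw [show -(p + 1) * (u : ℂ) = -p * u + -u by ring, exp_add, exp_neg (u : ℂ)]
      have := exp_ne_zero (u : ℂ)
      field_simp
      ring
    intro u
    have := is_const_of_deriv_eq_zero (fun u => (hd u).differentiableAt) (fun u => (hd u).deriv) u 0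
    simp only [Real.exp_zero, ofReal_zero, hg0] at this
    rw [sub_self] at this
    exact sub_eq_zero.mp this
  let G : ℂ → ℂ := fun u => exp (-p * Real.log ρ) / ρ * (exp (exp u) * exp (p * u) * g u)
  have hG : Differentiable ℂ G := by fun_prop
  have hMG : ∀ u : ℝ, M p ρ (exp u) = G u := by
    intro u
    rw [← ofReal_exp, M_eq_K p hρ (Real.exp_pos u), Real.log_exp]
    simp only [G]
    rw [← hreal u, ofReal_exp]
  let U : Set ℂ := {u | |u.im| < Real.pi}
  have hU : IsOpen U := isOpen_lt (continuous_abs.comp continuous_im) continuous_const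
  have hUc : IsPreconnected U := by
    have : U = imLm ⁻¹' (Ioo (-Real.pi) Real.pi) := by
      ext ω; simp [U, abs_lt]
    rw [this]
    exact ((convex_Ioo _ _).linear_preimage _).isPreconnected
  have hMd : DifferentiableOn ℂ (fun u => M p ρ (exp u)) U := by
    intro u hu
    have hs : exp u ∈ slitPlane := by
      rw [mem_slitPlane_iff_arg]
      obtain ⟨h1, h2⟩ := abs_lt.mp (show |u.im| < Real.pi from hu)
      refine ⟨?_, exp_ne_zero u⟩
      rw [← log_im, log_exp h1 h2.le]
      exact h2.ne
    exact ((differentiableAt_M hp hρ hs).comp u differentiableAt_exp).differentiableWithinAt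
  have hEq : EqOn (fun u => M p ρ (exp u)) G U := by
    refine (hMd.analyticOnNhd hU).eqOn_of_preconnected_of_frequently_eq
      (hG.differentiableOn.analyticOnNhd hU) hUc (z₀ := 0) (by simp [U, Real.pi_pos]) ?_
    have ht : Tendsto (fun x : ℝ => (x : ℂ)) (𝓝[≠] 0) (𝓝[≠] 0) := by
      refine tendsto_nhdsWithin_iff.mpr ⟨?_, ?_⟩
      · have := continuous_ofReal.tendsto (0 : ℝ)
        rw [ofReal_zero] at this
        exact this.mono_left nhdsWithin_le_nhds
      · filter_upwards [self_mem_nhdsWithin] with x hx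
        simpa using hx
    exact ht.frequently (Eventually.of_forall fun x => hMG x).frequently
  refine ⟨fun ζ => exp (p * ((Real.pi - s.im) * I)) * exp ((Real.pi - s.im) * I) * exp s *
    G (s + ζ), by fun_prop, fun ζ hζ => ?_⟩
  rw [rayIntegral_eq, ← hp_def, ← hρ_def]
  have := hEq (show s + ζ ∈ U from hζ)
  simp only at this
  rw [this]

/-- The first hyperterminant `F⁽¹⁾(z; a; σ₀)` for `Re a > 0`, as a function of `ζ = log z`, `a` and
`s = log σ₀`: the (unique) analytic continuation in `z`, over the Riemann surface of the logarithm,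
of the integral `rayIntegral` on `|arg (σ₀ z)| < π`. -/
noncomputable def firstHyperterminant (ζ a s : ℂ) : ℂ :=
  if ha : 0 < a.re then Classical.choose (exists_hyperterminant a s ha) ζ else 0

theorem differentiable_firstHyperterminant {a : ℂ} (ha : 0 < a.re) (s : ℂ) :
    Differentiable ℂ fun ζ => firstHyperterminant ζ a s := by
  simpa only [firstHyperterminant, dif_pos ha] using
    (Classical.choose_spec (exists_hyperterminant a s ha)).1

theorem firstHyperterminant_eq {a : ℂ} (ha : 0 < a.re) {s ζ : ℂ} (h : |(s + ζ).im| < Real.pi) :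
    firstHyperterminant ζ a s = rayIntegral ζ a s := by
  simpa only [firstHyperterminant, dif_pos ha] using
    (Classical.choose_spec (exists_hyperterminant a s ha)).2 ζ h

/-! ### The functions `a₀`, `α₀` and `g₀`

They depend on `z` through `ω = log (e^{-πi} σ₀ z / N₀)` only. -/

/-- `ω = log (e^{-πi} σ₀ z / N₀)` for `s = log σ₀`, `ζ = log z`, and `arg N₀` principal; its imaginary part
is `arg (e^{-πi} σ₀ z N₀⁻¹)`. -/
noncomputable def stokesVariable (N s ζ : ℂ) : ℂ := s + ζ - log N - Real.pi * I

/-- `a₀` as a function of `ω`: `i a₀ = 1 - e^ω`. -/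
noncomputable def aFun (ω : ℂ) : ℂ := -I * (1 - exp ω)

/-- `i a₀ = 1 + σ₀ z / N₀`. -/
theorem I_mul_aFun_stokesVariable {N : ℂ} (hN : N ≠ 0) (s ζ : ℂ) :
    I * aFun (stokesVariable N s ζ) = 1 + exp s * exp ζ / N := by
  have h : exp (stokesVariable N s ζ) = -(exp s * exp ζ / N) := by
    rw [stokesVariable, exp_sub, exp_sub, exp_add, exp_log hN, exp_pi_mul_I]
    ring
  rw [aFun, h]
  linear_combination (-1 - exp s * exp ζ / N) * I_sq


/-- The open strip `|Im ω| < 2π`: in terms of `ω = log w`, the sector `|arg w| < 2π`. -/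
def strip : Set ℂ := {ω | |ω.im| < 2 * Real.pi}

theorem isOpen_strip : IsOpen strip :=
  isOpen_lt (continuous_abs.comp continuous_im) continuous_const

theorem convex_strip : Convex ℝ strip := by
  have : strip = imLm ⁻¹' (Ioo (-(2 * Real.pi)) (2 * Real.pi)) := by
    ext ω; simp [strip, abs_lt]
  rw [this]
  exact (convex_Ioo _ _).linear_preimage _

theorem zero_mem_strip : (0 : ℂ) ∈ strip := by
  simp [strip, Real.pi_pos]

theorem exp_ne_aux {ω : ℂ} (h0 : 0 < ω.im) (h1 : ω.im < 2 * Real.pi) : exp ω ≠ 1 + ω := by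
  intro h
  have hre := congrArg re h
  have him := congrArg im h
  rw [exp_re] at hre
  rw [exp_im] at him
  simp only [add_re, one_re, add_im, one_im, zero_add] at hre him
  set u := ω.re
  set v := ω.im
  have hE := Real.exp_pos u
  have hs : 0 < Real.sin v := by
    by_contra hc
    nlinarith [mul_nonneg hE.le (neg_nonneg.mpr (not_lt.mp hc))]
  have hv : v < Real.pi := by
    by_contra hc
    have h2 : 0 ≤ Real.sin (v - Real.pi) :=
      Real.sin_nonneg_of_nonneg_of_le_pi (by linarith) (by linarith)
    rw [Real.sin_sub_pi] at h2
    linarith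
  have hsv : Real.sin v < v := Real.sin_lt h0
  have hE1 : 1 < Real.exp u := by
    by_contra hc
    nlinarith [mul_le_mul_of_nonneg_right (not_lt.mp hc) hs.le]
  have hu : 0 < u := Real.one_lt_exp_iff.mp hE1
  have hc : 0 < Real.cos v := by
    by_contra hc
    nlinarith [mul_nonneg hE.le (neg_nonneg.mpr (not_lt.mp hc))]
  have hv2 : v < Real.pi / 2 := by
    by_contra hh
    have := Real.cos_nonpos_of_pi_div_two_le_of_le (not_lt.mp hh) (by linarith)
    linarith
  have ht := Real.lt_tan h0 hv2
  rw [Real.tan_eq_sin_div_cos, lt_div_iff₀ hc] at ht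
  have : (1 + u) * Real.sin v = v * Real.cos v := by
    linear_combination (-Real.sin v) * hre + Real.cos v * him
  nlinarith [mul_pos hu hs]

theorem exp_ne {ω : ℂ} (hω : ω ∈ strip) (h0 : ω ≠ 0) : exp ω ≠ 1 + ω := by
  obtain ⟨h1, h2⟩ := abs_lt.mp (show |ω.im| < 2 * Real.pi from hω)
  rcases lt_trichotomy ω.im 0 with h | h | h
  · intro he
    have : exp (starRingEnd ℂ ω) = 1 + starRingEnd ℂ ω := by
      rw [exp_conj, he]; simp
    exact exp_ne_aux (by simpa using h) (by simp; linarith) this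
  · intro he
    have hω' : ω = (ω.re : ℂ) := Complex.ext rfl (by simpa using h)
    rw [hω'] at he
    have he' : Real.exp ω.re = 1 + ω.re := by exact_mod_cast he
    have hr : ω.re ≠ 0 := fun hr => h0 (by rw [hω', hr]; simp)
    linarith [Real.add_one_lt_exp hr]
  · exact exp_ne_aux h h2

theorem tendsto_exp_third :
    Tendsto (fun ω : ℂ => (exp ω - 1 - ω - ω ^ 2 / 2) / ω ^ 3) (𝓝[≠] 0) (𝓝 (1 / 6)) := by
  rw [tendsto_iff_norm_sub_tendsto_zero]
  have hlim : Tendsto (fun ω : ℂ => ‖ω‖) (𝓝[≠] 0) (𝓝 0) := by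
    have : Tendsto (fun ω : ℂ => ‖ω‖) (𝓝 0) (𝓝 0) := by simpa using (continuous_norm (E := ℂ)).tendsto 0
    exact this.mono_left nhdsWithin_le_nhds
  have hball : ∀ᶠ ω : ℂ in 𝓝[≠] 0, ‖ω‖ ≤ 1 := by
    filter_upwards [hlim.eventually (gt_mem_nhds one_pos)] with ω h using h.le
  refine squeeze_zero' (Eventually.of_forall fun _ => norm_nonneg _) ?_ hlim
  filter_upwards [hball, self_mem_nhdsWithin] with ω h1 h0
  have h0' : ω ≠ 0 := h0
  have hb := exp_bound h1 (n := 4) (by norm_num)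
  have e1 : (exp ω - 1 - ω - ω ^ 2 / 2) / ω ^ 3 - 1 / 6
      = (exp ω - ∑ m ∈ Finset.range 4, ω ^ m / m.factorial) / ω ^ 3 := by
    simp [Finset.sum_range_succ, Nat.factorial]
    field_simp
    ring
  rw [e1, norm_div, norm_pow, div_le_iff₀ (by positivity)]
  refine hb.trans ?_
  have : ((Nat.succ 4 : ℕ) : ℝ) * ((Nat.factorial 4 : ℝ) * ((4 : ℕ) : ℝ))⁻¹ ≤ 1 := by
    norm_num [Nat.factorial]
  calc _ ≤ ‖ω‖ ^ 4 * 1 := by gcongr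
    _ = _ := by ring

theorem exists_branch_aux : ∃ α : ℂ → ℂ, DifferentiableOn ℂ α strip ∧
    (∀ ω ∈ strip, α ω ^ 2 / 2 = 1 + ω - exp ω) ∧ HasDerivAt α I 0 := by
  let f : ℂ → ℂ := fun ω => exp ω - 1 - ω
  have hf : Differentiable ℂ f := by fun_prop
  have hf0 : deriv f 0 = 0 := by
    have : HasDerivAt f (exp 0 - 1) 0 := by
      exact (((Complex.hasDerivAt_exp 0).sub_const 1).sub (hasDerivAt_id (0 : ℂ)))
    simpa using this.deriv
  let f1 := dslope f 0
  have hf1 : Differentiable ℂ f1 := by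
    rw [← differentiableOn_univ] at hf ⊢
    exact (differentiableOn_dslope univ_mem).mpr hf
  let φ := dslope f1 0
  have hφ : Differentiable ℂ φ := by
    rw [← differentiableOn_univ] at hf1 ⊢
    exact (differentiableOn_dslope univ_mem).mpr hf1
  have hfφ : ∀ ω, f ω = ω ^ 2 * φ ω := by
    intro ω
    have h1 := sub_smul_dslope f 0 ω
    have h2 := sub_smul_dslope f1 0 ω
    have h3 : f1 0 = 0 := by simp [f1, hf0]
    have h4 : f 0 = 0 := by simp [f]
    rw [h3] at h2
    rw [h4] at h1
    simp only [sub_zero, smul_eq_mul] at h1 h2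
    rw [← h1, show dslope f 0 ω = f1 ω from rfl, ← h2]
    ring
  have hφ0 : 2 * φ 0 = 1 := by
    have t1 : Tendsto φ (𝓝[≠] 0) (𝓝 (φ 0)) :=
      hφ.continuous.continuousAt.tendsto.mono_left nhdsWithin_le_nhds
    have t2 : Tendsto (fun ω : ℂ => 1 / 2 + ω * ((exp ω - 1 - ω - ω ^ 2 / 2) / ω ^ 3)) (𝓝[≠] 0)
        (𝓝 (1 / 2 + 0 * (1 / 6))) :=
      tendsto_const_nhds.add
        ((tendsto_id.mono_left nhdsWithin_le_nhds).mul tendsto_exp_third)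
    have t3 : Tendsto φ (𝓝[≠] 0) (𝓝 (1 / 2 + 0 * (1 / 6))) := by
      refine t2.congr' ?_
      filter_upwards [self_mem_nhdsWithin] with ω h0
      have h0' : ω ≠ 0 := h0
      have := hfφ ω
      have h5 : φ ω = f ω / ω ^ 2 := by rw [this]; field_simp
      rw [h5]
      simp only [f]
      field_simp
      ring
    rw [tendsto_nhds_unique t1 t3]
    norm_num
  have hne : ∀ ω ∈ strip, 2 * φ ω ≠ 0 := by
    intro ω hω h
    by_cases h0 : ω = 0
    · rw [h0, hφ0] at h; exact one_ne_zero h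
    · have h1 : φ ω = 0 := by simpa using h
      have h2 := hfφ ω
      rw [h1, mul_zero] at h2
      exact exp_ne hω h0 (by linear_combination h2)
  have hsc : IsSimplyConnected strip := by
    have : ContractibleSpace strip := convex_strip.contractibleSpace ⟨0, zero_mem_strip⟩
    show SimplyConnectedSpace strip
    infer_instance
  obtain ⟨b, hbc, hb⟩ := exists_continuousOn_pow_eq hsc isOpen_strip
    (g := fun ω => 2 * φ ω) (hφ.continuous.const_mul 2).continuousOn (by rintro ⟨ω, hω, h⟩; exact hne ω hω h) two_ne_zero
  have hbne : ∀ ω ∈ strip, b ω ≠ 0 := fun ω hω h => hne ω hω (by rw [← hb, h]; simp)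
  have hbd : DifferentiableOn ℂ b strip := by
    intro z hz
    have hcz : ContinuousAt b z := hbc.continuousAt (isOpen_strip.mem_nhds hz)
    have hd : HasDerivAt (fun ω => 2 * φ ω) (2 * deriv φ z) z :=
      (hφ z).hasDerivAt.const_mul 2
    have hsum : Tendsto (fun w => b w + b z) (𝓝[≠] z) (𝓝 (b z + b z)) :=
      (hcz.tendsto.mono_left nhdsWithin_le_nhds).add_const _
    have hbz : b z + b z ≠ 0 := by
      rw [← two_mul]; exact mul_ne_zero two_ne_zero (hbne z hz)
    have : HasDerivAt b (2 * deriv φ z / (b z + b z)) z := by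
      rw [hasDerivAt_iff_tendsto_slope] at hd ⊢
      refine (hd.div hsum hbz).congr' ?_
      filter_upwards [hsum.eventually_ne hbz, self_mem_nhdsWithin] with w hw hwz
      have hwz' : w - z ≠ 0 := sub_ne_zero.mpr hwz
      simp only [slope_def_field, Pi.div_apply]
      rw [← hb w, ← hb z]
      field_simp
      ring
    exact this.differentiableAt.differentiableWithinAt
  have hb0 : b 0 ^ 2 = 1 := by rw [hb, hφ0]
  refine ⟨fun ω => I * ω * (b 0 * b ω), by fun_prop, ?_, ?_⟩
  · intro ω hω
    have h1 := hfφ ω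
    have h2 := hb ω
    simp only [f] at h1
    have : (I * ω * (b 0 * b ω)) ^ 2 = I ^ 2 * ω ^ 2 * (b 0 ^ 2 * b ω ^ 2) := by ring
    rw [this, hb0, h2, I_sq]
    linear_combination h1
  · have hb' : HasDerivAt b (deriv b 0) 0 :=
      (hbd.differentiableAt (isOpen_strip.mem_nhds zero_mem_strip)).hasDerivAt
    have := ((hasDerivAt_id (0 : ℂ)).const_mul I).mul (hb'.const_mul (b 0))
    refine (this.congr_deriv ?_)
    simp [← sq, hb0]



theorem tendsto_branch_aux {α : ℂ → ℂ} (hα : ∀ ω ∈ strip, α ω ^ 2 / 2 = 1 + ω - exp ω)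
    (hα' : HasDerivAt α I 0) :
    Tendsto (fun ω => α ω / ω) (𝓝[≠] 0) (𝓝 I) ∧ Tendsto (fun ω => aFun ω / ω) (𝓝[≠] 0) (𝓝 I) ∧
      Tendsto (fun ω => (aFun ω - α ω) / ω ^ 2) (𝓝[≠] 0) (𝓝 (I / 3)) := by
  have hα0 : α 0 = 0 := by
    have := hα 0 zero_mem_strip
    simpa using this
  have t1 : Tendsto (fun ω => α ω / ω) (𝓝[≠] 0) (𝓝 I) := by
    refine (hasDerivAt_iff_tendsto_slope.mp hα').congr fun ω => ?_
    simp [slope_def_field, hα0]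
  have ha : HasDerivAt aFun I 0 := by
    have := ((Complex.hasDerivAt_exp 0).const_sub 1).const_mul (-I)
    exact this.congr_deriv (by simp)
  have t2 : Tendsto (fun ω => aFun ω / ω) (𝓝[≠] 0) (𝓝 I) := by
    refine (hasDerivAt_iff_tendsto_slope.mp ha).congr fun ω => ?_
    simp [slope_def_field, aFun]
  refine ⟨t1, t2, ?_⟩
  have tT := tendsto_exp_third
  have t2x : Tendsto (fun ω : ℂ => 2 * ω) (𝓝[≠] 0) (𝓝[≠] 0) := by
    refine tendsto_nhdsWithin_iff.mpr ⟨?_, ?_⟩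
    · have : Tendsto (fun ω : ℂ => 2 * ω) (𝓝 0) (𝓝 (2 * 0)) :=
        (continuous_id.const_mul (2 : ℂ)).tendsto 0
      rw [mul_zero] at this
      exact this.mono_left nhdsWithin_le_nhds
    · filter_upwards [self_mem_nhdsWithin] with ω h
      exact mul_ne_zero two_ne_zero h
  have tT2 := tT.comp t2x
  have hsum : Tendsto (fun ω => aFun ω / ω + α ω / ω) (𝓝[≠] 0) (𝓝 (I + I)) := t2.add t1
  have hI : I + I ≠ 0 := by rw [← two_mul]; exact mul_ne_zero two_ne_zero I_ne_zero
  have hnum := ((tT2.const_mul (-8)).add (tT.const_mul 4)).div hsum hI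
  have hval : (-8 * (1 / 6) + 4 * (1 / 6)) / (I + I) = I / 3 := by
    have := I_sq
    have := I_ne_zero
    field_simp
    linear_combination (-12) * I_sq
  rw [hval] at hnum
  refine hnum.congr' ?_
  filter_upwards [hsum.eventually_ne hI, self_mem_nhdsWithin,
    nhdsWithin_le_nhds (isOpen_strip.mem_nhds zero_mem_strip)] with ω h1 h0 hs
  have h0' : ω ≠ 0 := h0
  have e := hα ω hs
  have h2 : aFun ω + α ω ≠ 0 := by
    intro h; apply h1; rw [← add_div, h, zero_div]
  have ea : aFun ω ^ 2 = - (1 - exp ω) ^ 2 := by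
    simp only [aFun]; rw [mul_pow, neg_sq, I_sq]; ring
  have e2 : exp (2 * ω) = exp ω ^ 2 := by rw [← exp_nat_mul]; norm_num
  simp only [Pi.div_apply, Function.comp_apply]
  rw [← add_div, div_div_eq_mul_div, div_eq_div_iff h2 (by positivity)]
  rw [e2]
  field_simp
  linear_combination (-8) * ea + 16 * e

/-- The branch `α₀` on `|arg (e^{-πi} σ₀ z / N₀)| < 2π` exists: it is analytic there,
`α₀² / 2 = i a₀ + log (1 - i a₀)`, and `a₀ = α₀ - (i/3) α₀² + o(α₀²)` where it vanishes, at `ω = 0`. -/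
theorem exists_alpha : ∃ α : ℂ → ℂ, DifferentiableOn ℂ α strip ∧
    (∀ ω ∈ strip, α ω ^ 2 / 2 = I * aFun ω + ω) ∧
    (fun ω => aFun ω - (α ω - I / 3 * α ω ^ 2)) =o[𝓝 0] fun ω => α ω ^ 2 := by
  obtain ⟨α, h1, h2, h3⟩ := exists_branch_aux
  have hI : ∀ ω, I * aFun ω = 1 - exp ω := fun ω => by
    rw [aFun]; linear_combination (-(1 - exp ω)) * I_sq
  refine ⟨α, h1, fun ω hω => by rw [h2 ω hω, hI]; ring, ?_⟩
  obtain ⟨t1, -, t3⟩ := tendsto_branch_aux h2 h3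
  have hα0 : α 0 = 0 := by
    have := h2 0 zero_mem_strip
    simpa using this
  have t4 := (t3.add ((t1.pow 2).const_mul (I / 3))).div (t1.pow 2) (by simp)
  rw [I_sq, show (I / 3 + I / 3 * -1) / (-1 : ℂ) = 0 by ring] at t4
  have hne : ∀ᶠ ω in 𝓝[≠] 0, α ω ^ 2 ≠ 0 := by
    filter_upwards [t1.eventually_ne I_ne_zero] with ω h
    exact pow_ne_zero 2 fun h0 => h (by rw [h0, zero_div])
  have t5 : (fun ω => aFun ω - (α ω - I / 3 * α ω ^ 2)) =o[𝓝[≠] 0] fun ω => α ω ^ 2 := by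
    refine (isLittleO_iff_tendsto' (hne.mono fun ω h h' => absurd h' h)).mpr (t4.congr' ?_)
    filter_upwards [self_mem_nhdsWithin, hne] with ω h0 h4
    have h0' : ω ≠ 0 := h0
    simp only [Pi.div_apply]
    field_simp
    ring
  rw [← nhdsNE_sup_pure]
  refine t5.sup ?_
  rw [isLittleO_pure]
  simp [hα0, aFun]

/-- `α₀` as a function of `ω`. -/
noncomputable def alpha : ℂ → ℂ := Classical.choose exists_alpha

theorem differentiableOn_alpha : DifferentiableOn ℂ alpha strip :=
  (Classical.choose_spec exists_alpha).1

theorem alpha_sq {ω : ℂ} (hω : ω ∈ strip) : alpha ω ^ 2 / 2 = I * aFun ω + ω :=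
  (Classical.choose_spec exists_alpha).2.1 ω hω

theorem alpha_branch :
    (fun ω => aFun ω - (alpha ω - I / 3 * alpha ω ^ 2)) =o[𝓝 0] fun ω => alpha ω ^ 2 :=
  (Classical.choose_spec exists_alpha).2.2

/-- `g₀ = 1 / a₀ - 1 / α₀` as a function of `ω`, with the removable singularity at `ω = 0`
(where `a₀ = α₀ = 0`) filled in by the limit `i / 3`. -/
noncomputable def gFun (ω : ℂ) : ℂ :=
  if ω = 0 then I / 3 else 1 / aFun ω - 1 / alpha ω

end Hyperterminant

namespace Hyperterminant
open Complex Set Filter Topology MeasureTheory Asymptotics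

/-! ### Paths of descent for `exp (-N (1 + ω - exp ω))` -/

/-! In the variable ω both sides have elementary derivatives. With u = log(σ₀z) = ω + log N + πi,
the normalized hyperterminant is e^{πiN} Γ(N+1) V(u), where V is the primitive of exp(-e^u - Nu)
vanishing at +∞, an incomplete gamma function (`exp_mul_firstHyperterminant`). Put P(ω) = exp(-N(1 +
ω - e^ω)) = exp(-α₀²N/2) and let S be Γ(N+1) divided by its Stirling approximation. The left-hand
side then has derivative N √(2π/N) S P (`hasDerivAt_hyperFun`). The identity -iα₀' + a₀g₀ = 1 gives
the two explicit terms the derivative √(2π/N) P (N + i g₀') (`hasDerivAt_approxFun`).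

With c = N(S - 1), the difference has derivative √(2π/N) P (c - i g₀'). A direct estimate of this is
too weak by a factor 1/N. However c = 1/12 + O(1/N) by Stirling's formula, and i g₀'(0) = 1/12
(`deriv_gFun_zero`), so to leading order the factor vanishes at the saddle point ω = 0. Hence 1/12 -
i g₀' = (1 - e^ω) q with q analytic in the strip. Since P' = -N(1 - e^ω)P, one integration by parts
removes this part at the cost of a term of the size of the claimed error. What remains,
`hasDerivAt_diffFun`, carries the factor √(2π/N)/N and is bounded by an integrable function of Re ω
times |P| (`exists_deriv_diffFun_bound`).

It remains to integrate. Along Re ω → +∞ there are two valleys where P → 0. In one of them both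
sides tend to 0, in the other to 2πi: for the hyperterminant this is Hankel's formula
(`connection_eq`), for erfc it is the sign of Re(α₀√(N/2)) (`re_alpha_mul_rootHalf`). Every point of
the closed substrip is joined to a valley by a path on which |P| never exceeds its value at that
point (`exists_descent`). Integration along this path gives the bound with the factor |P(ω)|,
uniformly in arg N. -/

/-- The real part of `e^{iθ} (1 + ω - e^ω)` at `ω = x + i y`. -/
noncomputable def height (θ x y : ℝ) : ℝ :=
  Real.cos θ * (1 + x) - Real.sin θ * y - Real.exp x * Real.cos (θ + y)

theorem height_neg (θ x y : ℝ) : height (-θ) x (-y) = height θ x y := by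
  rw [height, height, show -θ + -y = -(θ + y) by ring, Real.cos_neg, Real.cos_neg, Real.sin_neg]
  ring

/-- The x-derivative of `height` is cos θ - e^x cos(θ + y), and both terms have a favourable sign.
In the next two lemmas the sign follows instead by comparing e^x with 1. -/
theorem height_mono_right {θ x x' y : ℝ} (hθ : 0 ≤ Real.cos θ) (hy : Real.cos (θ + y) ≤ 0)
    (hx : x ≤ x') : height θ x y ≤ height θ x' y := by
  have h := Real.exp_le_exp.mpr hx
  simp only [height]
  nlinarith [mul_nonneg hθ (sub_nonneg.mpr hx), mul_nonneg (neg_nonneg.mpr hy) (sub_nonneg.mpr h)]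

theorem height_mono_right_of_nonpos {θ x x' y : ℝ} (hy : 0 ≤ Real.cos (θ + y))
    (hθ : Real.cos (θ + y) ≤ Real.cos θ) (hx : x ≤ x') (hx' : x' ≤ 0) :
    height θ x y ≤ height θ x' y := by
  have h1 : Real.exp x' - Real.exp x ≤ x' - x := by
    have h2 := Real.add_one_le_exp (x - x')
    have h3 : Real.exp x = Real.exp x' * Real.exp (x - x') := by rw [← Real.exp_add]; ring_nf
    have h4 : Real.exp x' ≤ 1 := Real.exp_le_one_iff.mpr hx'
    nlinarith [mul_nonneg (Real.exp_pos x').le (sub_nonneg.mpr h2),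
      mul_nonneg (sub_nonneg.mpr h4) (sub_nonneg.mpr hx)]
  simp only [height]
  nlinarith [mul_nonneg hy (sub_nonneg.mpr h1),
    mul_nonneg (sub_nonneg.mpr hθ) (sub_nonneg.mpr hx)]

theorem height_mono_left_of_nonneg {θ x x' y : ℝ} (hy : 0 ≤ Real.cos (θ + y))
    (hθ : Real.cos θ ≤ Real.cos (θ + y)) (hx : x' ≤ x) (hx' : 0 ≤ x') :
    height θ x y ≤ height θ x' y := by
  have h1 : x - x' ≤ Real.exp x - Real.exp x' := by
    have h2 := Real.add_one_le_exp (x - x')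
    have h3 : Real.exp x = Real.exp x' * Real.exp (x - x') := by rw [← Real.exp_add]; ring_nf
    have h4 : 1 ≤ Real.exp x' := Real.one_le_exp hx'
    nlinarith [mul_nonneg (Real.exp_pos x').le (sub_nonneg.mpr h2),
      mul_nonneg (sub_nonneg.mpr h4) (sub_nonneg.mpr hx)]
  simp only [height]
  nlinarith [mul_nonneg hy (sub_nonneg.mpr h1),
    mul_nonneg (sub_nonneg.mpr hθ) (sub_nonneg.mpr hx)]

theorem cos_sub_cos_le {a b m : ℝ} (hab : a ≤ b) (h : ∀ c ∈ Icc a b, Real.sin c ≤ m) :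
    Real.cos a - Real.cos b ≤ m * (b - a) := by
  have := Convex.image_sub_le_mul_sub_of_deriv_le (convex_Icc a b) (f := fun x => -Real.cos x)
    (by fun_prop) (by fun_prop) (C := m) (fun x hx => by
      have := h x (interior_subset hx)
      simpa using this) a (left_mem_Icc.mpr hab) b (right_mem_Icc.mpr hab) hab
  linarith

/-- The y-derivative of `height` is e^x sin(θ + y) - sin θ, and the hypothesis says that it is
nonpositive on the whole segment. -/
theorem height_mono_down {θ x y y' : ℝ} (hy : y' ≤ y)
    (h : ∀ c ∈ Icc (θ + y') (θ + y), Real.exp x * Real.sin c ≤ Real.sin θ) :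
    height θ x y ≤ height θ x y' := by
  have hE := Real.exp_pos x
  have := cos_sub_cos_le (a := θ + y') (b := θ + y) (m := Real.sin θ / Real.exp x) (by linarith)
    (fun c hc => by rw [le_div_iff₀ hE, mul_comm]; exact h c hc)
  have h2 : Real.exp x * (Real.cos (θ + y') - Real.cos (θ + y)) ≤ Real.sin θ * (y - y') := by
    calc _ ≤ Real.exp x * (Real.sin θ / Real.exp x * (θ + y - (θ + y'))) := by gcongr
      _ = _ := by field_simp; ring
  simp only [height]
  linarith

theorem height_mono_up {θ x y y' : ℝ} (hy : y ≤ y')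
    (h : ∀ c ∈ Icc (θ + y) (θ + y'), Real.sin θ ≤ Real.exp x * Real.sin c) :
    height θ x y ≤ height θ x y' := by
  rw [← height_neg, ← height_neg θ x y']
  refine height_mono_down (by linarith) fun c hc => ?_
  have := h (-c) ⟨by linarith [hc.2], by linarith [hc.1]⟩
  rw [Real.sin_neg] at this ⊢
  linarith

/-- The sign of cos(θ + y) divides the strip into valleys (negative) and hills (positive). In a
valley, moving right raises `height`. On a hill one moves vertically to the edge of a valley, in a
direction along which the y-derivative keeps its sign. Only on the outer hill, where the sole
reachable edge is the one below, can a preliminary horizontal move be needed. -/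
theorem exists_descent_of_nonneg {θ δ x y : ℝ} (hθ : |θ| < Real.pi / 2) (hδ : 0 < δ) (hδ1 : δ ≤ 1)
    (hy : |y| ≤ 2 * Real.pi - δ) (hη : 0 ≤ θ + y) :
    ∃ x₁ y₂ : ℝ, |y₂| ≤ 2 * Real.pi - δ ∧ Real.pi / 2 ≤ |θ + y₂| ∧ |θ + y₂| ≤ 3 * Real.pi / 2 ∧
      (∀ x' ∈ uIcc x x₁, height θ x y ≤ height θ x' y) ∧
      (∀ y' ∈ uIcc y y₂, height θ x y ≤ height θ x₁ y') ∧
      ∀ x' ≥ x₁, height θ x y ≤ height θ x' y₂ := by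
  obtain ⟨t1, t2⟩ := abs_lt.mp hθ
  obtain ⟨y1, y2⟩ := abs_le.mp hy
  have hpi := Real.pi_gt_three
  have hc : 0 ≤ Real.cos θ := Real.cos_nonneg_of_neg_pi_div_two_le_of_le t1.le t2.le
  rcases le_or_gt (Real.pi / 2) (θ + y) with hA | hA
  · rcases le_or_gt (θ + y) (3 * Real.pi / 2) with hB | hB
    · have hcos : Real.cos (θ + y) ≤ 0 :=
        Real.cos_nonpos_of_pi_div_two_le_of_le hA (by linarith)
      refine ⟨x, y, hy, by rwa [abs_of_nonneg hη], by rwa [abs_of_nonneg hη], ?_, ?_, ?_⟩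
      · simp
      · simp
      · exact fun x' hx' => height_mono_right hc hcos hx'
    · -- the outer hill
      -- Reduction mod 2π brings the angle into (-π/2, θ), where sine is increasing; μ < θ because y
      -- < 2π.
      set μ := θ + y - 2 * Real.pi with hμ
      have hμ1 : -(Real.pi / 2) < μ := by linarith
      have hμ2 : μ < θ := by linarith
      have hsm : Real.sin μ < Real.sin θ :=
        Real.sin_lt_sin_of_lt_of_le_pi_div_two hμ1.le t2.le hμ2
      have hcμ : 0 ≤ Real.cos (θ + y) := by
        rw [← Real.cos_sub_two_pi]
        exact Real.cos_nonneg_of_neg_pi_div_two_le_of_le hμ1.le (by linarith)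
      -- vertical descent, and then to the right
      have key : ∀ x₁, Real.exp x₁ * Real.sin μ ≤ Real.sin θ →
          (∀ x' ∈ uIcc x x₁, height θ x y ≤ height θ x' y) →
          ∃ x₁ y₂ : ℝ, |y₂| ≤ 2 * Real.pi - δ ∧ Real.pi / 2 ≤ |θ + y₂| ∧
            |θ + y₂| ≤ 3 * Real.pi / 2 ∧
            (∀ x' ∈ uIcc x x₁, height θ x y ≤ height θ x' y) ∧
            (∀ y' ∈ uIcc y y₂, height θ x y ≤ height θ x₁ y') ∧
            ∀ x' ≥ x₁, height θ x y ≤ height θ x' y₂ := by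
        intro x₁ h1 h2
        have hv : ∀ y' ∈ Icc (3 * Real.pi / 2 - θ) y, height θ x y ≤ height θ x₁ y' := by
          intro y' hy'
          refine (h2 x₁ right_mem_uIcc).trans (height_mono_down hy'.2 fun c hc' => ?_)
          refine le_trans ?_ h1
          gcongr 1
          rw [← Real.sin_sub_two_pi]
          exact Real.sin_le_sin_of_le_of_le_pi_div_two (by linarith [hc'.1, hy'.1])
            (by linarith) (by linarith [hc'.2])
        have hη2 : θ + (3 * Real.pi / 2 - θ) = 3 * Real.pi / 2 := by ring
        have hab : |θ + (3 * Real.pi / 2 - θ)| = 3 * Real.pi / 2 := by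
          rw [hη2, abs_of_pos (by linarith)]
        refine ⟨x₁, 3 * Real.pi / 2 - θ, ?_, by rw [hab]; linarith, hab.le, h2, ?_, ?_⟩
        · rw [abs_of_pos (by linarith)]; linarith
        · rw [uIcc_of_ge (by linarith)]
          exact hv
        · intro x' hx'
          refine (hv _ ⟨le_rfl, by linarith⟩).trans (height_mono_right hc ?_ hx')
          rw [hη2]
          exact Real.cos_nonpos_of_pi_div_two_le_of_le (by linarith) (by linarith)
      by_cases hx : Real.exp x * Real.sin μ ≤ Real.sin θ
      · exact key x hx (by simp)
      · push Not at hx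
        -- At x₁ = 0 the condition for vertical descent is just sin μ ≤ sin θ. The sign of sin μ
        -- decides from which side x = 0 is approached.
        refine key 0 (by simpa using hsm.le) ?_
        have hcos : Real.cos (θ + y) = Real.cos μ := by rw [hμ, Real.cos_sub_two_pi]
        rw [hcos] at hcμ
        rcases le_or_gt 0 (Real.sin μ) with h0 | h0
        · have hx0 : 0 ≤ x := by
            by_contra hx0
            have := Real.exp_le_one_iff.mpr (not_le.mp hx0).le
            nlinarith
          have hμ0 : 0 ≤ μ := by
            by_contra hh
            have := Real.sin_neg_of_neg_of_neg_pi_lt (not_le.mp hh) (by linarith)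
            linarith
          rw [uIcc_of_ge hx0]
          intro x' hx'
          refine height_mono_left_of_nonneg ?_ ?_ hx'.2 hx'.1 <;> rw [hcos]
          · exact hcμ
          · exact Real.cos_le_cos_of_nonneg_of_le_pi hμ0 (by linarith) hμ2.le
        · have hx0 : x ≤ 0 := by
            by_contra hx0
            have := Real.one_le_exp (not_le.mp hx0).le
            nlinarith
          have hθ0 : θ ≤ 0 := by
            by_contra hh
            have h3 := Real.sin_pos_of_pos_of_lt_pi (not_le.mp hh) (by linarith)
            nlinarith [mul_pos (Real.exp_pos x) (neg_pos.mpr h0)]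
          rw [uIcc_of_le hx0]
          intro x' hx'
          refine height_mono_right_of_nonpos ?_ ?_ hx'.1 hx'.2 <;> rw [hcos]
          · exact hcμ
          · rw [← Real.cos_neg μ, ← Real.cos_neg θ]
            exact Real.cos_le_cos_of_nonneg_of_le_pi (by linarith) (by linarith) (by linarith)
  -- On the central hill sine is increasing, so the sign of the y-derivative at the starting point
  -- persists all the way down to angle -π/2, or all the way up to π/2.
  · rcases le_or_gt (Real.exp x * Real.sin (θ + y)) (Real.sin θ) with hs | hs
    · have hv : ∀ y' ∈ Icc (-(Real.pi / 2) - θ) y, height θ x y ≤ height θ x y' := by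
        intro y' hy'
        refine height_mono_down hy'.2 fun c hc' => le_trans ?_ hs
        gcongr 1
        exact Real.sin_le_sin_of_le_of_le_pi_div_two (by linarith [hc'.1, hy'.1])
          (by linarith) (by linarith [hc'.2])
      have hη2 : θ + (-(Real.pi / 2) - θ) = -(Real.pi / 2) := by ring
      have hab : |θ + (-(Real.pi / 2) - θ)| = Real.pi / 2 := by
        rw [hη2, abs_neg, abs_of_pos (by linarith)]
      refine ⟨x, -(Real.pi / 2) - θ, ?_, hab.ge, by rw [hab]; linarith, by simp, ?_, ?_⟩
      · rw [abs_le]; constructor <;> linarith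
      · rw [uIcc_of_ge (by linarith)]
        exact hv
      · intro x' hx'
        refine (hv _ ⟨le_rfl, by linarith⟩).trans (height_mono_right hc ?_ hx')
        rw [hη2]
        simp
    · have hv : ∀ y' ∈ Icc y (Real.pi / 2 - θ), height θ x y ≤ height θ x y' := by
        intro y' hy'
        refine height_mono_up hy'.1 fun c hc' => hs.le.trans ?_
        gcongr 1
        exact Real.sin_le_sin_of_le_of_le_pi_div_two (by linarith)
          (by linarith [hc'.2, hy'.2]) (by linarith [hc'.1])
      have hη2 : θ + (Real.pi / 2 - θ) = Real.pi / 2 := by ring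
      have hab : |θ + (Real.pi / 2 - θ)| = Real.pi / 2 := by
        rw [hη2, abs_of_pos (by linarith)]
      refine ⟨x, Real.pi / 2 - θ, ?_, hab.ge, by rw [hab]; linarith, by simp, ?_, ?_⟩
      · rw [abs_le]; constructor <;> linarith
      · rw [uIcc_of_le (by linarith)]
        exact hv
      · intro x' hx'
        refine (hv _ ⟨by linarith, le_rfl⟩).trans (height_mono_right hc ?_ hx')
        rw [hη2]
        simp

/-- Every point of the strip is joined, by two segments and a horizontal ray along which `height`
is at least its initial value, to one of the two valleys at `Re ω = +∞`. -/
theorem exists_descent {θ δ x y : ℝ} (hθ : |θ| < Real.pi / 2) (hδ : 0 < δ) (hδ1 : δ ≤ 1)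
    (hy : |y| ≤ 2 * Real.pi - δ) :
    ∃ x₁ y₂ : ℝ, |y₂| ≤ 2 * Real.pi - δ ∧ Real.pi / 2 ≤ |θ + y₂| ∧ |θ + y₂| ≤ 3 * Real.pi / 2 ∧
      (∀ x' ∈ uIcc x x₁, height θ x y ≤ height θ x' y) ∧
      (∀ y' ∈ uIcc y y₂, height θ x y ≤ height θ x₁ y') ∧
      ∀ x' ≥ x₁, height θ x y ≤ height θ x' y₂ := by
  rcases le_total 0 (θ + y) with h | h
  · exact exists_descent_of_nonneg hθ hδ hδ1 hy h
  · obtain ⟨x₁, y₂, h1, h2, h3, h4, h5, h6⟩ := exists_descent_of_nonneg (θ := -θ) (y := -y) (x := x)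
      (by rwa [abs_neg]) hδ hδ1 (by rwa [abs_neg]) (by linarith)
    have e : |-θ + y₂| = |θ + -y₂| := by rw [← abs_neg]; ring_nf
    rw [e] at h2 h3
    have e2 : ∀ x' y' : ℝ, height (-θ) x' y' = height θ x' (-y') := fun x' y' => by
      rw [← height_neg θ x' (-y'), neg_neg]
    refine ⟨x₁, -y₂, by rwa [abs_neg], h2, h3, fun x' hx' => ?_, fun y' hy' => ?_,
      fun x' hx' => ?_⟩
    · simpa [e2] using h4 x' hx'
    · have hm : -y' ∈ uIcc (-y) y₂ := by
        rw [mem_uIcc] at hy' ⊢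
        rcases hy' with hy' | hy'
        · exact Or.inr ⟨by linarith, by linarith⟩
        · exact Or.inl ⟨by linarith, by linarith⟩
      simpa [e2] using h5 _ hm
    · simpa [e2] using h6 x' hx'

/-! ### The decay of `exp (-N (1 + ω - exp ω))` -/

/-- `‖exp (-N (1 + ω - exp ω))‖ = exp (-|N| height)`. -/
theorem re_mul_phase (N : ℂ) (x y : ℝ) :
    (N * (1 + (x + y * I) - exp (x + y * I))).re = ‖N‖ * height (arg N) x y := by
  have h1 : N.re = ‖N‖ * Real.cos (arg N) := (norm_mul_cos_arg N).symm
  have h2 : N.im = ‖N‖ * Real.sin (arg N) := (norm_mul_sin_arg N).symm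
  simp only [mul_re, sub_re, add_re, one_re, ofReal_re, I_re, ofReal_im, I_im, sub_im, add_im,
    one_im, mul_im, exp_re, exp_im, height, Real.cos_add, mul_zero, mul_one, sub_zero, add_zero, zero_add]
  rw [h1, h2]
  ring

/-- In a valley the exponential term of `height` is nonnegative and can be dropped, leaving linear
growth in x. -/
theorem height_ge {θ x y : ℝ} (hy : |y| ≤ 2 * Real.pi)
    (h1 : Real.cos (θ + y) ≤ 0) : Real.cos θ * (1 + x) - 2 * Real.pi ≤ height θ x y := by
  have h2 : |Real.sin θ * y| ≤ 1 * (2 * Real.pi) := by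
    rw [abs_mul]
    exact mul_le_mul (Real.abs_sin_le_one θ) hy (abs_nonneg _) zero_le_one
  have h3 := (abs_le.mp h2).2
  have h4 := mul_nonneg (Real.exp_pos x).le (neg_nonneg.mpr h1)
  simp only [height]
  linarith

theorem cos_nonpos_of_abs {η : ℝ} (h1 : Real.pi / 2 ≤ |η|) (h2 : |η| ≤ 3 * Real.pi / 2) :
    Real.cos η ≤ 0 := by
  rw [← Real.cos_abs]
  exact Real.cos_nonpos_of_pi_div_two_le_of_le h1 (by linarith)

theorem norm_exp_phase (N : ℂ) (x y : ℝ) :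
    ‖exp (-(N * (1 + (x + y * I) - exp (x + y * I))))‖ =
      Real.exp (-(‖N‖ * height (arg N) x y)) := by
  rw [norm_exp, neg_re, re_mul_phase]

theorem norm_exp_phase_le {N : ℂ} {x y : ℝ} (hy : |y| ≤ 2 * Real.pi)
    (h1 : Real.pi / 2 ≤ |arg N + y|) (h2 : |arg N + y| ≤ 3 * Real.pi / 2) :
    ‖exp (-(N * (1 + (x + y * I) - exp (x + y * I))))‖ ≤
      Real.exp (2 * Real.pi * ‖N‖ - N.re * (1 + x)) := by
  rw [norm_exp_phase]
  apply Real.exp_le_exp.mpr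
  have h := mul_le_mul_of_nonneg_left (height_ge (x := x) hy (cos_nonpos_of_abs h1 h2))
    (norm_nonneg N)
  rw [← norm_mul_cos_arg N]
  linarith

theorem tendsto_valley_bound {N : ℂ} (hN : 0 < N.re) :
    Tendsto (fun x : ℝ => Real.exp (2 * Real.pi * ‖N‖ - N.re * (1 + x))) atTop (𝓝 0) := by
  apply Real.tendsto_exp_atBot.comp
  apply tendsto_atBot_add_const_left
  apply tendsto_neg_atTop_atBot.comp
  exact (tendsto_atTop_add_const_left _ _ tendsto_id).const_mul_atTop hN

/-! ### The functions `α₀` and `g₀` -/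

theorem I_mul_aFun (ω : ℂ) : I * aFun ω = 1 - exp ω := by
  rw [aFun]; linear_combination (-(1 - exp ω)) * I_sq

theorem alpha_sq_eq {ω : ℂ} (hω : ω ∈ strip) : alpha ω ^ 2 = 2 * (1 + ω - exp ω) := by
  have := alpha_sq hω
  rw [I_mul_aFun] at this
  linear_combination 2 * this

theorem alpha_zero : alpha 0 = 0 := by
  have := alpha_sq_eq zero_mem_strip
  simpa using this

theorem alpha_ne_zero {ω : ℂ} (hω : ω ∈ strip) (h0 : ω ≠ 0) : alpha ω ≠ 0 := by
  intro h
  have := alpha_sq_eq hω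
  rw [h] at this
  exact exp_ne hω h0 (by linear_combination (1 / 2 : ℂ) * this)

theorem one_sub_exp_ne_zero {ω : ℂ} (hω : ω ∈ strip) (h0 : ω ≠ 0) : 1 - exp ω ≠ 0 := by
  intro h
  obtain ⟨n, hn⟩ := exp_eq_one_iff.mp (sub_eq_zero.mp h).symm
  have him : ω.im = n * (2 * Real.pi) := by rw [hn]; simp
  have hω' : |ω.im| < 2 * Real.pi := hω
  have hpi := Real.pi_pos
  rw [him, abs_mul, abs_of_pos (by positivity : 0 < 2 * Real.pi)] at hω'
  have h1 : |(n : ℝ)| < 1 := by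
    by_contra hc
    nlinarith [not_lt.mp hc]
  have h2 : n = 0 := by
    rw [← Int.abs_lt_one_iff]
    exact_mod_cast h1
  exact h0 (by rw [hn, h2]; simp)

theorem aFun_ne_zero {ω : ℂ} (hω : ω ∈ strip) (h0 : ω ≠ 0) : aFun ω ≠ 0 := by
  intro h
  have := I_mul_aFun ω
  rw [h, mul_zero] at this
  exact one_sub_exp_ne_zero hω h0 this.symm

theorem differentiableAt_alpha {ω : ℂ} (hω : ω ∈ strip) : DifferentiableAt ℂ alpha ω :=
  differentiableOn_alpha.differentiableAt (isOpen_strip.mem_nhds hω)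

/-- The equation for α₀² leaves the sign of α₀ open; the branch condition fixes it. As α₀ = O(ω), it
gives a₀ - α₀ = o(ω), so α₀ and a₀ have the same derivative at 0. -/
theorem hasDerivAt_alpha_zero : HasDerivAt alpha I 0 := by
  have hd := (differentiableAt_alpha zero_mem_strip).hasDerivAt
  have hO : alpha =O[𝓝 0] fun ω => ω := by
    have := hd.differentiableAt.isBigO_sub
    simpa [alpha_zero] using this
  have hsq : (fun ω => alpha ω ^ 2) =o[𝓝 0] fun ω : ℂ => ω := by
    have h1 : (fun ω => alpha ω ^ 2) =O[𝓝 0] fun ω : ℂ => ω ^ 2 := hO.pow 2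
    exact h1.trans_isLittleO (isLittleO_pow_id one_lt_two)
  have h2 : (fun ω => aFun ω - alpha ω) =o[𝓝 0] fun ω : ℂ => ω := by
    have h3 := (alpha_branch.trans hsq).sub (hsq.const_mul_left (I / 3))
    refine h3.congr_left fun ω => ?_
    ring
  have ha : HasDerivAt aFun I 0 := by
    have := ((Complex.hasDerivAt_exp 0).const_sub 1).const_mul (-I)
    exact this.congr_deriv (by simp)
  have h4 : HasDerivAt (fun ω => aFun ω - alpha ω) 0 0 := by
    rw [hasDerivAt_iff_isLittleO]
    simpa [aFun, alpha_zero] using h2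
  have h5 := ha.sub h4
  rw [sub_zero] at h5
  exact h5.congr_of_eventuallyEq (Eventually.of_forall fun ω => by simp)

theorem hasDerivAt_alpha {ω : ℂ} (hω : ω ∈ strip) (h0 : ω ≠ 0) :
    HasDerivAt alpha ((1 - exp ω) / alpha ω) ω := by
  have hd := (differentiableAt_alpha hω).hasDerivAt
  have h1 := hd.pow 2
  have h2 : HasDerivAt (fun ω : ℂ => 2 * (1 + ω - exp ω)) (2 * (1 - exp ω)) ω :=
    (((hasDerivAt_id ω).const_add 1).sub (Complex.hasDerivAt_exp ω)).const_mul 2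
  have h3 : (alpha ^ 2) =ᶠ[𝓝 ω] fun ω : ℂ => 2 * (1 + ω - exp ω) := by
    filter_upwards [isOpen_strip.mem_nhds hω] with z hz using alpha_sq_eq hz
  have h4 := (h2.congr_of_eventuallyEq h3).unique h1
  refine hd.congr_deriv ?_
  have hα := alpha_ne_zero hω h0
  rw [eq_div_iff hα]
  have : deriv alpha ω * alpha ω * 2 = (1 - exp ω) * 2 := by
    norm_num at h4
    linear_combination -h4
  exact mul_right_cancel₀ two_ne_zero this

/-- The derivative of `α₀` and the values of `a₀`, `g₀` are related by `-i α₀' + a₀ g₀ = 1`. -/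
theorem deriv_alpha_add {ω : ℂ} (hω : ω ∈ strip) :
    -I * deriv alpha ω + aFun ω * gFun ω = 1 := by
  by_cases h0 : ω = 0
  · rw [h0, hasDerivAt_alpha_zero.deriv]
    simp [aFun]
  · rw [(hasDerivAt_alpha hω h0).deriv, gFun, if_neg h0, ← I_mul_aFun]
    have h1 := alpha_ne_zero hω h0
    have h2 := aFun_ne_zero hω h0
    field_simp
    linear_combination (-aFun ω) * I_sq

theorem hasDerivAt_gFun {ω : ℂ} (hω : ω ∈ strip) (h0 : ω ≠ 0) :
    HasDerivAt gFun (I * exp ω / (1 - exp ω) ^ 2 + (1 - exp ω) / alpha ω ^ 3) ω := by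
  have h1 := alpha_ne_zero hω h0
  have h2 := aFun_ne_zero hω h0
  have h3 := one_sub_exp_ne_zero hω h0
  have ha : HasDerivAt aFun (I * exp ω) ω := by
    have := ((Complex.hasDerivAt_exp ω).const_sub 1).const_mul (-I)
    exact this.congr_deriv (by ring)
  have hd := (ha.inv h2).sub ((hasDerivAt_alpha hω h0).inv h1)
  have he : gFun =ᶠ[𝓝 ω] aFun⁻¹ - alpha⁻¹ := by
    filter_upwards [isOpen_compl_singleton.mem_nhds (show ω ∈ ({0}ᶜ : Set ℂ) from h0)] with z hz
    have hz' : z ≠ 0 := hz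
    rw [gFun, if_neg hz']
    simp
  refine (hd.congr_of_eventuallyEq he).congr_deriv ?_
  have ha2 : aFun ω ^ 2 = -(1 - exp ω) ^ 2 := by
    simp only [aFun]; rw [mul_pow, neg_sq, I_sq]; ring
  rw [ha2]
  field_simp
  ring

/-- Here g₀ = -(a₀ - α₀)/(a₀α₀), where a₀ - α₀ ~ (i/3)ω² and a₀, α₀ ~ iω. -/
theorem continuousAt_gFun_zero : ContinuousAt gFun 0 := by
  obtain ⟨t1, t2, t3⟩ := tendsto_branch_aux (α := alpha)
    (fun ω hω => by linear_combination (1 / 2 : ℂ) * alpha_sq_eq hω) hasDerivAt_alpha_zero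
  rw [continuousAt_iff_punctured_nhds]
  have h0 : gFun 0 = -(I / 3) / (I * I) := by
    rw [gFun, if_pos rfl, I_mul_I]; ring
  rw [h0]
  refine (t3.neg.div (t2.mul t1) (by simp)).congr' ?_
  filter_upwards [self_mem_nhdsWithin,
    nhdsWithin_le_nhds (isOpen_strip.mem_nhds zero_mem_strip)] with ω hω hs
  have h0' : ω ≠ 0 := hω
  have h1 := alpha_ne_zero hs h0'
  have h2 := aFun_ne_zero hs h0'
  rw [gFun, if_neg h0']
  simp only [Pi.div_apply]
  field_simp
  ring

theorem differentiableOn_gFun : DifferentiableOn ℂ gFun strip := by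
  refine (differentiableOn_compl_singleton_and_continuousAt_iff
    (isOpen_strip.mem_nhds zero_mem_strip)).mp ⟨?_, continuousAt_gFun_zero⟩
  intro ω hω
  exact (hasDerivAt_gFun hω.1 hω.2).differentiableAt.differentiableWithinAt

/-! ### The derivative of g₀ at the origin -/

theorem tendsto_exp_fourth :
    Tendsto (fun ω : ℂ => (exp ω - 1 - ω - ω ^ 2 / 2 - ω ^ 3 / 6) / ω ^ 4) (𝓝[≠] 0)
      (𝓝 (1 / 24)) := by
  rw [tendsto_iff_norm_sub_tendsto_zero]
  have hlim : Tendsto (fun ω : ℂ => ‖ω‖) (𝓝[≠] 0) (𝓝 0) := by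
    have : Tendsto (fun ω : ℂ => ‖ω‖) (𝓝 0) (𝓝 0) := by
      simpa using (continuous_norm (E := ℂ)).tendsto 0
    exact this.mono_left nhdsWithin_le_nhds
  refine squeeze_zero' (Eventually.of_forall fun _ => norm_nonneg _) ?_ hlim
  filter_upwards [hlim.eventually (gt_mem_nhds one_pos), self_mem_nhdsWithin] with ω h1 h0
  have h0' : ω ≠ 0 := h0
  have hb := exp_bound h1.le (n := 5) (by norm_num)
  have e1 : (exp ω - 1 - ω - ω ^ 2 / 2 - ω ^ 3 / 6) / ω ^ 4 - 1 / 24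
      = (exp ω - ∑ m ∈ Finset.range 5, ω ^ m / m.factorial) / ω ^ 4 := by
    simp [Finset.sum_range_succ, Nat.factorial]
    field_simp
    ring
  rw [e1, norm_div, norm_pow, div_le_iff₀ (by positivity)]
  refine hb.trans ?_
  have : ((Nat.succ 5 : ℕ) : ℝ) * ((Nat.factorial 5 : ℝ) * ((5 : ℕ) : ℝ))⁻¹ ≤ 1 := by
    norm_num [Nat.factorial]
  calc _ ≤ ‖ω‖ ^ 5 * 1 := by gcongr
    _ = _ := by ring

/-- Eliminating α₀ by α₀(1 - a₀g₀) = a₀ gives 2(1 + ω - e^ω)(1 - a₀g₀)² = a₀², which involves g₀ and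
e^ω only. Its coefficient of ω⁴ determines g₀'(0). The expansion is carried out with exact
remainders: ρ for the exponential, γ for the slope of g₀. -/
theorem deriv_gFun_zero : deriv gFun 0 = -I / 12 := by
  have hd := (differentiableOn_gFun.differentiableAt
    (isOpen_strip.mem_nhds zero_mem_strip)).hasDerivAt
  have tγ := hasDerivAt_iff_tendsto_slope.mp hd
  have tρ := tendsto_exp_fourth
  have tω : Tendsto (fun ω : ℂ => ω) (𝓝[≠] 0) (𝓝 0) := tendsto_id.mono_left nhdsWithin_le_nhds
  set ρ : ℂ → ℂ := fun ω => (exp ω - 1 - ω - ω ^ 2 / 2 - ω ^ 3 / 6) / ω ^ 4 with hρ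
  set γ : ℂ → ℂ := slope gFun 0 with hγ
  set A₁ : ℂ → ℂ := fun ω => 1 / 2 + ω / 6 + ω ^ 2 * ρ ω with hA₁
  set B₁ : ℂ → ℂ := fun ω => A₁ ω / 3 - I * (1 + ω * A₁ ω) * γ ω with hB₁
  set B : ℂ → ℂ := fun ω => 1 / 3 + ω * B₁ ω with hB
  have tA₁ : Tendsto A₁ (𝓝[≠] 0) (𝓝 (1 / 2 + 0 / 6 + 0 ^ 2 * (1 / 24))) :=
    (tendsto_const_nhds.add (tω.div_const 6)).add ((tω.pow 2).mul tρ)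
  have tB₁ : Tendsto B₁ (𝓝[≠] 0) (𝓝 ((1 / 2 + 0 / 6 + 0 ^ 2 * (1 / 24)) / 3 -
      I * (1 + 0 * (1 / 2 + 0 / 6 + 0 ^ 2 * (1 / 24))) * deriv gFun 0)) :=
    (tA₁.div_const 3).sub (((tendsto_const_nhds.add (tω.mul tA₁)).const_mul I).mul tγ)
  have tB : Tendsto B (𝓝[≠] 0) (𝓝 (1 / 3 + 0 * ((1 / 2 + 0 / 6 + 0 ^ 2 * (1 / 24)) / 3 -
      I * (1 + 0 * (1 / 2 + 0 / 6 + 0 ^ 2 * (1 / 24))) * deriv gFun 0))) :=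
    tendsto_const_nhds.add (tω.mul tB₁)
  have key := (((((tB₁.const_mul 2).sub_const (1 / 3)).sub ((tω.mul tρ).const_mul 2)).add
    (tB.pow 2)).add (tB.const_mul (2 / 3))).add ((tω.mul (tB.pow 2)).div_const 3)
  have key2 := (key.add ((tρ.const_mul 2).mul
    (((tω.mul tB).const_add 1).pow 2))).sub (tA₁.pow 2)
  have hz : ∀ᶠ ω in 𝓝[≠] (0 : ℂ), 2 * B₁ ω - 1 / 3 - 2 * (ω * ρ ω) + B ω ^ 2 + 2 / 3 * B ω +
      ω * B ω ^ 2 / 3 + 2 * ρ ω * (1 + ω * B ω) ^ 2 - A₁ ω ^ 2 = 0 := by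
    filter_upwards [self_mem_nhdsWithin,
      nhdsWithin_le_nhds (isOpen_strip.mem_nhds zero_mem_strip)] with ω hω hs
    have h0 : ω ≠ 0 := hω
    have h1 := alpha_ne_zero hs h0
    have h2 := aFun_ne_zero hs h0
    have hexp : exp ω = 1 + ω * (1 + ω * A₁ ω) := by
      have hr : ω ^ 4 * ρ ω = exp ω - 1 - ω - ω ^ 2 / 2 - ω ^ 3 / 6 := by
        simp only [ρ]
        field_simp
      have hAA : A₁ ω = 1 / 2 + ω / 6 + ω ^ 2 * ρ ω := rfl
      rw [hAA]
      linear_combination -hr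
    have hg : gFun ω = I / 3 + ω * γ ω := by
      simp only [γ, slope_def_field, sub_zero]
      rw [show gFun 0 = I / 3 by rw [gFun, if_pos rfl]]
      field_simp
      ring
    have ha : aFun ω = I * ω * (1 + ω * A₁ ω) := by
      rw [aFun, hexp]; ring
    have hag : 1 - aFun ω * gFun ω = 1 + ω * B ω := by
      rw [ha, hg]
      have hBB : B ω = 1 / 3 + ω * B₁ ω := rfl
      have hBB₁ : B₁ ω = A₁ ω / 3 - I * (1 + ω * A₁ ω) * γ ω := rfl
      rw [hBB, hBB₁]
      linear_combination (-(ω * (1 + ω * A₁ ω)) / 3) * I_sq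
    have hrel : 2 * (1 + ω - exp ω) * (1 - aFun ω * gFun ω) ^ 2 = aFun ω ^ 2 := by
      rw [← alpha_sq_eq hs, gFun, if_neg h0]
      field_simp
      ring
    rw [hag, ha, hexp, mul_pow, mul_pow, I_sq] at hrel
    -- The terms of order ω² and ω³ cancel identically, so ω⁴ can be divided out before passing to
    -- the limit.
    have h3 : ω ^ 4 * (2 * B₁ ω - 1 / 3 - 2 * (ω * ρ ω) + B ω ^ 2 + 2 / 3 * B ω +
      ω * B ω ^ 2 / 3 + 2 * ρ ω * (1 + ω * B ω) ^ 2 - A₁ ω ^ 2) = 0 := by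
      have hBB : B ω = 1 / 3 + ω * B₁ ω := rfl
      have hAA : A₁ ω = 1 / 2 + ω / 6 + ω ^ 2 * ρ ω := rfl
      rw [hBB, hAA]
      rw [hBB, hAA] at hrel
      linear_combination -hrel
    exact (mul_eq_zero.mp h3).resolve_left (pow_ne_zero 4 h0)
  -- After simplification the limiting relation is 1/6 - 2i g₀'(0) = 0.
  have h := tendsto_nhds_unique (key2.congr' hz) tendsto_const_nhds
  linear_combination (I / 2) * h + (deriv gFun 0) * I_sq

/-! ### The correction term -/

/-- `1 / 12 - i g₀'`, which vanishes at `ω = 0`. -/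
noncomputable def hFun (ω : ℂ) : ℂ := 1 / 12 - I * deriv gFun ω

/-- The quotient of `1 / 12 - i g₀'` by `1 - e^ω`. -/
noncomputable def qFun (ω : ℂ) : ℂ := -(dslope hFun 0 ω / dslope exp 0 ω)

theorem differentiableOn_deriv_gFun : DifferentiableOn ℂ (deriv gFun) strip :=
  differentiableOn_gFun.deriv isOpen_strip

theorem differentiableOn_hFun : DifferentiableOn ℂ hFun strip :=
  (differentiableOn_const _).sub (differentiableOn_deriv_gFun.const_mul I)

/-- This is the coincidence between Stirling's coefficient 1/12 and g₀'(0) that makes the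
integration by parts possible. -/
theorem hFun_zero : hFun 0 = 0 := by
  rw [hFun, deriv_gFun_zero]
  linear_combination (1 / 12 : ℂ) * I_sq

theorem mul_dslope_exp (ω : ℂ) : ω * dslope exp 0 ω = exp ω - 1 := by
  simpa using sub_smul_dslope exp 0 ω

theorem dslope_exp_ne_zero {ω : ℂ} (hω : ω ∈ strip) : dslope exp 0 ω ≠ 0 := by
  by_cases h0 : ω = 0
  · rw [h0, dslope_same, Complex.deriv_exp, exp_zero]
    exact one_ne_zero
  · intro h
    have h1 := mul_dslope_exp ω
    rw [h, mul_zero] at h1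
    exact one_sub_exp_ne_zero hω h0 (by linear_combination h1)

/-- The width of the strip excludes the zeros ±2πi of 1 - e^ω. The zero at 0 is simple and is
matched by the zero of `hFun`. -/
theorem differentiableOn_qFun : DifferentiableOn ℂ qFun strip := by
  have hs := isOpen_strip.mem_nhds zero_mem_strip
  exact (((differentiableOn_dslope hs).mpr differentiableOn_hFun).div
    ((differentiableOn_dslope hs).mpr Complex.differentiable_exp.differentiableOn)
    fun ω hω => dslope_exp_ne_zero hω).neg

theorem mul_qFun {ω : ℂ} (hω : ω ∈ strip) : (1 - exp ω) * qFun ω = hFun ω := by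
  have h1 := mul_dslope_exp ω
  have h2 : ω * dslope hFun 0 ω = hFun ω := by
    simpa [hFun_zero] using sub_smul_dslope hFun 0 ω
  have h3 := dslope_exp_ne_zero hω
  rw [qFun, ← h2, show 1 - exp ω = -(ω * dslope exp 0 ω) by rw [h1]; ring]
  field_simp

/-! ### Bounds on closed substrips -/

/-- An integrable weight on the real line. -/
noncomputable def weight (x : ℝ) : ℝ := (1 + |x|) ^ (-(3 / 2) : ℝ)

theorem weight_pos (x : ℝ) : 0 < weight x := by
  unfold weight; positivity

theorem weight_le_one (x : ℝ) : weight x ≤ 1 :=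
  Real.rpow_le_one_of_one_le_of_nonpos (by linarith [abs_nonneg x]) (by norm_num)

theorem integrable_weight : Integrable weight := by
  have := integrable_one_add_norm (E := ℝ) (μ := volume) (r := 3 / 2) (by simp; norm_num)
  exact this

theorem continuous_weight : Continuous weight := by
  unfold weight
  refine Continuous.rpow_const (by fun_prop) fun x => Or.inl ?_
  have := abs_nonneg x
  positivity

theorem rpow_neg_le_mul_weight {x t c : ℝ} (ht : 0 < t) (hc : 0 < c) (h : 1 + |x| ≤ c * t) :
    t ^ (-(3 / 2) : ℝ) ≤ c ^ (3 / 2 : ℝ) * weight x := by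
  have hx : 0 < 1 + |x| := by positivity
  have h1 : (c * t) ^ (-(3 / 2) : ℝ) ≤ weight x :=
    Real.rpow_le_rpow_of_nonpos hx h (by norm_num)
  rw [Real.mul_rpow hc.le ht.le] at h1
  have h2 : c ^ (3 / 2 : ℝ) * c ^ (-(3 / 2) : ℝ) = 1 := by
    rw [← Real.rpow_add hc]; norm_num
  have h3 : 0 < c ^ (3 / 2 : ℝ) := by positivity
  calc t ^ (-(3 / 2) : ℝ) = c ^ (3 / 2 : ℝ) * (c ^ (-(3 / 2) : ℝ) * t ^ (-(3 / 2) : ℝ)) := by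
        rw [← mul_assoc, h2, one_mul]
    _ ≤ _ := by gcongr

theorem three_rpow_le : (3 : ℝ) ^ (3 / 2 : ℝ) ≤ 9 := by
  calc (3 : ℝ) ^ (3 / 2 : ℝ) ≤ 3 ^ (2 : ℝ) := by gcongr <;> norm_num
    _ = 9 := by norm_num

theorem exp_neg_half_le_weight (x : ℝ) : Real.exp (-|x| / 2) ≤ 9 * weight x := by
  have h1 : Real.exp (-|x| / 2) = Real.exp (|x| / 3) ^ (-(3 / 2) : ℝ) := by
    rw [← Real.exp_mul]; congr 1; ring
  rw [h1]
  refine (rpow_neg_le_mul_weight (c := 3) (x := x) (Real.exp_pos _) (by norm_num) ?_).trans ?_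
  · linarith [Real.add_one_le_exp (|x| / 3)]
  · have := weight_pos x
    gcongr
    exact three_rpow_le

theorem weight_le_of_near {x x' : ℝ} (h : |x' - x| ≤ 1 / 2) : weight x' ≤ 9 * weight x := by
  refine (rpow_neg_le_mul_weight (c := 3) (x := x) (by positivity) (by norm_num) ?_).trans ?_
  · have := abs_sub_abs_le_abs_sub x x'
    rw [abs_sub_comm] at this
    linarith [abs_nonneg x']
  · have := weight_pos x
    gcongr
    exact three_rpow_le

theorem norm_one_sub_exp_ge {ω : ℂ} (h : 8 ≤ |ω.re|) :
    1 / 2 ≤ ‖1 - exp ω‖ ∧ Real.exp ω.re / 2 ≤ ‖1 - exp ω‖ := by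
  have h1 := norm_sub_norm_le (1 : ℂ) (exp ω)
  have h2 := norm_sub_norm_le (exp ω) (1 : ℂ)
  rw [norm_sub_rev] at h2
  rw [norm_one, norm_exp] at h1 h2
  rcases le_or_gt 0 ω.re with hp | hn
  · rw [abs_of_nonneg hp] at h
    have := Real.add_one_le_exp ω.re
    constructor <;> linarith
  · rw [abs_of_neg hn] at h
    have h3 : Real.exp ω.re ≤ 1 / 2 := by
      have h4 : Real.exp ω.re = (Real.exp (-ω.re))⁻¹ := by rw [Real.exp_neg, inv_inv]
      rw [h4, one_div]
      have := Real.add_one_le_exp (-ω.re)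
      gcongr
      linarith
    constructor <;> linarith

theorem norm_one_sub_exp_le (ω : ℂ) : ‖1 - exp ω‖ ≤ 1 + Real.exp ω.re := by
  refine (norm_sub_le _ _).trans ?_
  rw [norm_one, norm_exp]

/-- Lower bounds for `α₀²` away from the imaginary axis. -/
theorem norm_alpha_sq_ge {ω : ℂ} (hω : ω ∈ strip) (h : 8 ≤ |ω.re|) :
    1 + |ω.re| ≤ ‖alpha ω‖ ^ 2 ∧ Real.exp ω.re ≤ ‖alpha ω‖ ^ 2 := by
  have hω' : |ω.im| < 2 * Real.pi := hω
  have hpi := Real.pi_lt_d2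
  rw [← norm_pow, alpha_sq_eq hω, norm_mul, norm_ofNat]
  rcases le_or_gt 0 ω.re with hp | hn
  · rw [abs_of_nonneg hp] at h ⊢
    have h1 := norm_sub_norm_le (exp ω) (1 + ω)
    rw [norm_sub_rev, norm_exp] at h1
    have h2 : ‖1 + ω‖ ≤ 1 + (ω.re + 2 * Real.pi) := by
      refine (norm_add_le _ _).trans ?_
      rw [norm_one]
      have := norm_le_abs_re_add_abs_im ω
      rw [abs_of_nonneg hp] at this
      linarith
    -- From x = 8 on, the bound e^x ≥ 1 + x + x²/2 dominates 2(1 + x + 2π), which is what the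
    -- threshold 8 is chosen for on this side.
    have h3 := Real.quadratic_le_exp_of_nonneg hp
    constructor <;> nlinarith
  · rw [abs_of_neg hn] at h ⊢
    have h1 := abs_re_le_norm (1 + ω - exp ω)
    rw [sub_re, add_re, one_re] at h1
    have h2 : -(exp ω).re ≤ 1 := by
      have := (abs_re_le_norm (exp ω)).trans_eq (norm_exp ω)
      have h3 := Real.exp_le_one_iff.mpr hn.le
      linarith [(abs_le.mp this).1]
    have h3 := Real.exp_le_one_iff.mpr hn.le
    have h4 := neg_le_abs (1 + ω.re - (exp ω).re)
    have h5 : (exp ω).re ≥ -1 := by linarith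
    constructor <;> linarith

theorem norm_gFun_le_of_far {ω : ℂ} (hω : ω ∈ strip) (h : 8 ≤ |ω.re|) : ‖gFun ω‖ ≤ 3 := by
  have h0 : ω ≠ 0 := fun h0 => by norm_num [h0] at h
  rw [gFun, if_neg h0]
  refine (norm_sub_le _ _).trans ?_
  rw [norm_div, norm_div, norm_one]
  have h1 : ‖aFun ω‖ = ‖1 - exp ω‖ := by rw [aFun, norm_mul, norm_neg, norm_I, one_mul]
  have h2 := (norm_one_sub_exp_ge h).1
  have h3 := (norm_alpha_sq_ge hω h).1
  have h4 : 1 ≤ ‖alpha ω‖ := by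
    by_contra hc
    nlinarith [norm_nonneg (alpha ω)]
  have h5 : 1 / ‖aFun ω‖ ≤ 2 := by
    rw [h1, div_le_iff₀ (by linarith)]; linarith
  have h6 : 1 / ‖alpha ω‖ ≤ 1 := by
    rw [div_le_iff₀ (by linarith)]; linarith
  linarith

/-- The term with (1 - e^ω)² decays exponentially on both sides. The term (1 - e^ω)/α₀³ decays
exponentially on the right, but only like |x|^{-3/2} on the left, where α₀² grows linearly; this is
the source of the exponent in `weight`. -/
theorem norm_deriv_gFun_le_of_far {ω : ℂ} (hω : ω ∈ strip) (h : 8 ≤ |ω.re|) :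
    ‖deriv gFun ω‖ ≤ 60 * weight ω.re := by
  have h0 : ω ≠ 0 := fun h0 => by norm_num [h0] at h
  rw [(hasDerivAt_gFun hω h0).deriv]
  obtain ⟨b1, b2⟩ := norm_one_sub_exp_ge h
  obtain ⟨a1, a2⟩ := norm_alpha_sq_ge hω h
  have hw := exp_neg_half_le_weight ω.re
  have hwp := weight_pos ω.re
  set m := ‖1 - exp ω‖ with hm
  have hmp : 0 < m := by linarith
  set A := ‖alpha ω‖ ^ 2 with hA
  have hAp : 0 < A := by linarith [abs_nonneg ω.re]
  have hα3 : ‖alpha ω‖ ^ 3 = A ^ (3 / 2 : ℝ) := by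
    rw [hA, ← Real.rpow_natCast, ← Real.rpow_natCast, ← Real.rpow_mul (norm_nonneg _)]
    norm_num
  have hE := Real.exp_pos ω.re
  -- the first term
  have t1 : Real.exp ω.re / m ^ 2 ≤ 4 * Real.exp (-|ω.re| / 2) := by
    rw [div_le_iff₀ (by positivity)]
    have hmono : Real.exp (-|ω.re|) ≤ Real.exp (-|ω.re| / 2) :=
      Real.exp_le_exp.mpr (by linarith [abs_nonneg ω.re])
    rcases le_or_gt 0 ω.re with hp | hn
    · rw [abs_of_nonneg hp] at hmono ⊢
      have hinv : Real.exp (-ω.re) * Real.exp ω.re = 1 := by rw [← Real.exp_add]; simp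
      calc Real.exp ω.re = 4 * Real.exp (-ω.re) * (Real.exp ω.re / 2) ^ 2 := by
            linear_combination (-Real.exp ω.re) * hinv
        _ ≤ _ := by gcongr
    · rw [abs_of_neg hn, neg_neg] at hmono ⊢
      calc Real.exp ω.re = 4 * Real.exp ω.re * (1 / 2) ^ 2 := by ring
        _ ≤ _ := by gcongr
  -- the second term
  have t2 : m / A ^ (3 / 2 : ℝ) ≤ 2 * Real.exp (-|ω.re| / 2) + 2 * weight ω.re := by
    have hmle := norm_one_sub_exp_le ω
    rw [← hm] at hmle
    have hr : A ^ (-(3 / 2) : ℝ) = (A ^ (3 / 2 : ℝ))⁻¹ := Real.rpow_neg hAp.le _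
    rw [div_eq_mul_inv, ← hr]
    rcases le_or_gt 0 ω.re with hp | hn
    · have h1 : A ^ (-(3 / 2) : ℝ) ≤ Real.exp ω.re ^ (-(3 / 2) : ℝ) :=
        Real.rpow_le_rpow_of_nonpos hE a2 (by norm_num)
      have h2 : m ≤ 2 * Real.exp ω.re := by linarith [Real.one_le_exp hp]
      have h3 : Real.exp ω.re * Real.exp ω.re ^ (-(3 / 2) : ℝ) = Real.exp (-|ω.re| / 2) := by
        rw [← Real.exp_mul, ← Real.exp_add, abs_of_nonneg hp]; congr 1; ring
      have : 0 < A ^ (-(3 / 2) : ℝ) := by positivity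
      calc m * A ^ (-(3 / 2) : ℝ) ≤ 2 * Real.exp ω.re * Real.exp ω.re ^ (-(3 / 2) : ℝ) := by gcongr
        _ = 2 * Real.exp (-|ω.re| / 2) := by rw [mul_assoc, h3]
        _ ≤ _ := by linarith
    · have h1 : A ^ (-(3 / 2) : ℝ) ≤ weight ω.re :=
        Real.rpow_le_rpow_of_nonpos (by positivity) a1 (by norm_num)
      have h2 : m ≤ 2 := by linarith [Real.exp_le_one_iff.mpr hn.le]
      have : 0 < A ^ (-(3 / 2) : ℝ) := by positivity
      have h3 : m * A ^ (-(3 / 2) : ℝ) ≤ 2 * weight ω.re := by gcongr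
      linarith [Real.exp_pos (-|ω.re| / 2)]
  refine (norm_add_le _ _).trans ?_
  rw [norm_div, norm_div, norm_mul, norm_I, one_mul, norm_pow, norm_pow, hα3, norm_exp]
  linarith

/-- In q = (1/12 - i g₀')/(1 - e^ω) the derivative g₀' decays, while the denominator tends to 1 on
the left and to infinity on the right. Subtracting the limiting constants prepares a Cauchy estimate
for q', which is small although q is not. -/
theorem norm_qFun_le_of_far {ω : ℂ} (hω : ω ∈ strip) (h : 8 ≤ |ω.re|) :
    ‖qFun ω - if ω.re ≤ 0 then 1 / 12 else 0‖ ≤ 200 * weight ω.re := by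
  obtain ⟨b1, b2⟩ := norm_one_sub_exp_ge h
  have hm0 : 1 - exp ω ≠ 0 := fun h => by rw [h, norm_zero] at b1; linarith
  have hg := norm_deriv_gFun_le_of_far hω h
  have hw := exp_neg_half_le_weight ω.re
  have hwp := weight_pos ω.re
  have hmono : Real.exp (-|ω.re|) ≤ Real.exp (-|ω.re| / 2) :=
    Real.exp_le_exp.mpr (by linarith [abs_nonneg ω.re])
  have hq : qFun ω = hFun ω / (1 - exp ω) := by
    rw [← mul_qFun hω]; field_simp
  have hIg : ‖I * deriv gFun ω‖ ≤ 60 * weight ω.re := by rwa [norm_mul, norm_I, one_mul]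
  split_ifs with hs
  · rw [abs_of_nonpos hs, neg_neg] at hmono
    have e : qFun ω - 1 / 12 = (exp ω / 12 - I * deriv gFun ω) / (1 - exp ω) := by
      rw [hq, hFun]; field_simp; ring
    rw [e, norm_div, div_le_iff₀ (by linarith)]
    have h1 := norm_sub_le (exp ω / 12) (I * deriv gFun ω)
    have h2 : ‖exp ω / 12‖ = Real.exp ω.re / 12 := by rw [norm_div, norm_exp]; norm_num
    rw [abs_of_nonpos hs, neg_neg] at hw
    nlinarith
  · have hs' := (not_le.mp hs).le
    rw [abs_of_nonneg hs'] at hmono hw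
    rw [sub_zero, hq, norm_div, div_le_iff₀ (by linarith), hFun]
    have h1 := norm_sub_le (1 / 12 : ℂ) (I * deriv gFun ω)
    have h2 : ‖(1 / 12 : ℂ)‖ = 1 / 12 := by norm_num
    have h3 : 1 ≤ 9 * weight ω.re * Real.exp ω.re := by
      have hinv : Real.exp (-ω.re) * Real.exp ω.re = 1 := by rw [← Real.exp_add]; simp
      calc (1 : ℝ) = Real.exp (-ω.re) * Real.exp ω.re := hinv.symm
        _ ≤ _ := by
          gcongr
          exact hmono.trans hw
    nlinarith

theorem exists_bound_of_continuousOn {f : ℂ → ℂ} (hf : ContinuousOn f strip) {δ : ℝ} (hδ : 0 < δ)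
    (X : ℝ) : ∃ C, ∀ ω : ℂ, |ω.im| ≤ 2 * Real.pi - δ → |ω.re| ≤ X → ‖f ω‖ ≤ C := by
  have hK : IsCompact (Icc (-X) X ×ℂ Icc (-(2 * Real.pi - δ)) (2 * Real.pi - δ)) :=
    isCompact_Icc.reProdIm isCompact_Icc
  have hsub : Icc (-X) X ×ℂ Icc (-(2 * Real.pi - δ)) (2 * Real.pi - δ) ⊆ strip := by
    intro ω hω
    have h2 := abs_le.mpr (mem_Icc.mp (mem_reProdIm.mp hω).2)
    show |ω.im| < 2 * Real.pi
    linarith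
  obtain ⟨C, hC⟩ := hK.exists_bound_of_continuousOn (hf.mono hsub)
  exact ⟨C, fun ω h1 h2 => hC ω (mem_reProdIm.mpr ⟨abs_le.mp h2, abs_le.mp h1⟩)⟩

theorem exists_weight_bound {f : ℂ → ℂ} (hf : ContinuousOn f strip) {δ : ℝ} (hδ : 0 < δ)
    {X C₁ : ℝ} (h : ∀ ω : ℂ, |ω.im| ≤ 2 * Real.pi - δ → X ≤ |ω.re| → ‖f ω‖ ≤ C₁ * weight ω.re) :
    ∃ C, ∀ ω : ℂ, |ω.im| ≤ 2 * Real.pi - δ → ‖f ω‖ ≤ C * weight ω.re := by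
  obtain ⟨C₂, hC₂⟩ := exists_bound_of_continuousOn hf hδ |X|
  have hX := weight_pos X
  refine ⟨max C₁ (|C₂| / weight X), fun ω hω => ?_⟩
  have hwp := weight_pos ω.re
  rcases le_total X |ω.re| with hx | hx
  · refine (h ω hω hx).trans ?_
    gcongr
    exact le_max_left _ _
  · have hx' := hx.trans (le_abs_self X)
    have hw : weight X ≤ weight ω.re :=
      Real.rpow_le_rpow_of_nonpos (by positivity) (by linarith) (by norm_num)
    calc ‖f ω‖ ≤ |C₂| := (hC₂ ω hω hx').trans (le_abs_self _)
      _ = |C₂| / weight X * weight X := by field_simp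
      _ ≤ |C₂| / weight X * weight ω.re := by gcongr
      _ ≤ _ := by gcongr; exact le_max_right _ _

theorem mem_strip_of_le {ω : ℂ} {δ : ℝ} (hδ : 0 < δ) (h : |ω.im| ≤ 2 * Real.pi - δ) :
    ω ∈ strip := by
  show |ω.im| < 2 * Real.pi
  linarith

/-- Cauchy's estimate for q - κ on a disc of radius δ/2, which stays inside the strip. Because δ ≤ 1
and |Re ω| ≥ 9, the disc also stays in the region |Re z| ≥ 8 and on one side of the imaginary axis,
so that κ is the same constant throughout. -/
theorem norm_deriv_qFun_le_of_far {δ : ℝ} (hδ : 0 < δ) (hδ1 : δ ≤ 1) {ω : ℂ}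
    (hω : |ω.im| ≤ 2 * Real.pi - δ) (h : 9 ≤ |ω.re|) :
    ‖deriv qFun ω‖ ≤ 3600 / δ * weight ω.re := by
  set κ : ℂ := if ω.re ≤ 0 then 1 / 12 else 0 with hκ
  have hball : ∀ z ∈ Metric.closedBall ω (δ / 2), z ∈ strip ∧ 8 ≤ |z.re| ∧
      |z.re - ω.re| ≤ 1 / 2 := by
    intro z hz
    rw [Metric.mem_closedBall, dist_eq_norm] at hz
    have h1 := (abs_re_le_norm (z - ω)).trans hz
    have h2 := (abs_im_le_norm (z - ω)).trans hz
    rw [sub_re] at h1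
    rw [sub_im] at h2
    have h3 := abs_sub_abs_le_abs_sub z.im ω.im
    have h4 := abs_sub_abs_le_abs_sub ω.re z.re
    rw [abs_sub_comm] at h4
    exact ⟨mem_strip_of_le (half_pos hδ) (by linarith), by linarith, by linarith⟩
  have hd : DiffContOnCl ℂ (fun z => qFun z - κ) (Metric.ball ω (δ / 2)) := by
    apply DifferentiableOn.diffContOnCl
    rw [closure_ball _ (by positivity)]
    exact (differentiableOn_qFun.mono fun z hz => (hball z hz).1).sub_const κ
  have hb : ∀ z ∈ Metric.sphere ω (δ / 2), ‖qFun z - κ‖ ≤ 1800 * weight ω.re := by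
    intro z hz
    obtain ⟨h1, h2, h3⟩ := hball z (Metric.sphere_subset_closedBall hz)
    have h4 := norm_qFun_le_of_far h1 h2
    have h5 : (if z.re ≤ 0 then (1 / 12 : ℂ) else 0) = κ := by
      rw [hκ]
      have h6 := abs_le.mp h3
      rcases le_or_gt 0 ω.re with hp | hn
      · rw [abs_of_nonneg hp] at h
        rw [if_neg (by linarith), if_neg (by linarith)]
      · rw [abs_of_neg hn] at h
        rw [if_pos (by linarith), if_pos (by linarith)]
    rw [h5] at h4
    have h7 := weight_le_of_near h3
    linarith
  have := norm_deriv_le_of_forall_mem_sphere_norm_le (half_pos hδ) hd hb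
  rw [deriv_sub_const] at this
  refine this.trans_eq ?_
  field_simp
  ring

/-- The bounds on `g₀` and `q` in a closed substrip. -/
theorem exists_bounds {δ : ℝ} (hδ : 0 < δ) (hδ1 : δ ≤ 1) :
    ∃ C, 0 < C ∧ ∀ ω : ℂ, |ω.im| ≤ 2 * Real.pi - δ → ‖gFun ω‖ ≤ C ∧ ‖qFun ω‖ ≤ C ∧
      ‖deriv gFun ω‖ ≤ C * weight ω.re ∧ ‖deriv qFun ω‖ ≤ C * weight ω.re := by
  obtain ⟨C₁, h₁⟩ := exists_bound_of_continuousOn differentiableOn_gFun.continuousOn hδ 8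
  obtain ⟨C₂, h₂⟩ := exists_bound_of_continuousOn differentiableOn_qFun.continuousOn hδ 8
  obtain ⟨C₃, h₃⟩ := exists_weight_bound differentiableOn_deriv_gFun.continuousOn hδ
    fun ω hω hx => norm_deriv_gFun_le_of_far (mem_strip_of_le hδ hω) hx
  obtain ⟨C₄, h₄⟩ := exists_weight_bound
    (differentiableOn_qFun.deriv isOpen_strip).continuousOn hδ
    fun ω hω hx => norm_deriv_qFun_le_of_far hδ hδ1 hω hx
  refine ⟨|C₁| + |C₂| + |C₃| + |C₄| + 201, by positivity, fun ω hω => ?_⟩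
  have hs := mem_strip_of_le hδ hω
  have hw1 := weight_le_one ω.re
  have hwp := weight_pos ω.re
  have p1 := abs_nonneg C₁
  have p2 := abs_nonneg C₂
  have p3 := abs_nonneg C₃
  have p4 := abs_nonneg C₄
  have l1 := le_abs_self C₁
  have l2 := le_abs_self C₂
  have l3 := le_abs_self C₃
  have l4 := le_abs_self C₄
  refine ⟨?_, ?_, ?_, ?_⟩
  · rcases le_total 8 |ω.re| with hx | hx
    · linarith [norm_gFun_le_of_far hs hx]
    · linarith [h₁ ω hω hx]
  · rcases le_total 8 |ω.re| with hx | hx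
    · have h5 := norm_qFun_le_of_far hs hx
      have h6 : ‖(if ω.re ≤ 0 then (1 / 12 : ℂ) else 0)‖ ≤ 1 := by
        split_ifs <;> norm_num
      have h7 := norm_sub_norm_le (qFun ω) (if ω.re ≤ 0 then (1 / 12 : ℂ) else 0)
      linarith
    · linarith [h₂ ω hω hx]
  · refine (h₃ ω hω).trans ?_
    gcongr
    linarith
  · refine (h₄ ω hω).trans ?_
    gcongr
    linarith

/-! ### The complementary error function -/

theorem re_sq_add (v : ℂ) (t : ℝ) : (-(v + t) ^ 2).re = (-v ^ 2).re - 2 * v.re * t - t ^ 2 := by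
  simp only [neg_re, sq, mul_re, add_re, add_im, ofReal_re, ofReal_im, add_zero]
  ring

theorem integrable_gaussian_Ioi {c : ℝ} (hc : 0 < c) :
    IntegrableOn (fun t : ℝ => Real.exp (-c * t ^ 2)) (Ioi 0) :=
  (integrable_exp_neg_mul_sq hc).integrableOn

theorem norm_erfc_le {v : ℂ} (hv : 0 ≤ v.re) : ‖erfc v‖ ≤ ‖exp (-v ^ 2)‖ := by
  have hpi := Real.sqrt_pos.mpr Real.pi_pos
  have h : ‖∫ t in Ioi (0 : ℝ), exp (-(v + t) ^ 2)‖ ≤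
      ∫ t in Ioi (0 : ℝ), ‖exp (-v ^ 2)‖ * Real.exp (-1 * t ^ 2) := by
    refine norm_integral_le_of_norm_le ((integrable_gaussian_Ioi one_pos).const_mul _) ?_
    filter_upwards [ae_restrict_mem measurableSet_Ioi] with t ht
    have ht : 0 < t := ht
    rw [norm_exp, norm_exp, ← Real.exp_add, re_sq_add]
    apply Real.exp_le_exp.mpr
    nlinarith [mul_nonneg hv ht.le]
  rw [integral_const_mul, integral_gaussian_Ioi, div_one] at h
  rw [erfc, norm_mul, norm_div, norm_real, Real.norm_of_nonneg hpi.le, norm_ofNat]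
  calc _ ≤ 2 / Real.sqrt Real.pi * (‖exp (-v ^ 2)‖ * (Real.sqrt Real.pi / 2)) := by gcongr
    _ = _ := by field_simp

/-- The integrand depends on v + t only, so its v-derivative equals its t-derivative, and the
differentiated integral is evaluated by the fundamental theorem of calculus. -/
theorem hasDerivAt_erfc (v : ℂ) :
    HasDerivAt erfc (-(2 / (Real.sqrt Real.pi : ℂ)) * exp (-v ^ 2)) v := by
  set m : ℝ := ‖v‖ + 1 with hm
  have hm0 : 0 < m := by positivity
  -- a bound, uniform on a ball, for the Gaussian factor
  have hb : ∀ w ∈ Metric.ball v 1, ∀ t : ℝ,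
      (-(w + t) ^ 2).re ≤ 3 * m ^ 2 - (1 / 2) * t ^ 2 := by
    intro w hw t
    have hwn : ‖w‖ ≤ m := by
      have h1 : ‖w - v‖ < 1 := by rwa [Metric.mem_ball, dist_eq_norm] at hw
      have h2 := norm_sub_norm_le w v
      linarith
    rw [re_sq_add]
    have h1 : (-w ^ 2).re ≤ m ^ 2 := by
      refine (re_le_norm _).trans ?_
      rw [norm_neg, norm_pow]
      gcongr
    have h2 : |w.re| ≤ m := (abs_re_le_norm w).trans hwn
    have h3 : w.re ^ 2 ≤ m ^ 2 := by
      rw [← sq_abs w.re]; gcongr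
    -- Completing the square: -2 Re(w) t ≤ 2 (Re w)² + t²/2.
    nlinarith [sq_nonneg (2 * w.re + t)]
  have hint2 : IntegrableOn (fun t : ℝ => Real.exp (3 * m ^ 2 - 1 / 2 * t ^ 2)) (Ioi 0) := by
    have := (integrable_gaussian_Ioi (c := 1 / 2) (by norm_num)).const_mul (Real.exp (3 * m ^ 2))
    refine IntegrableOn.congr_fun this (fun t _ => ?_) measurableSet_Ioi
    rw [← Real.exp_add]
    ring_nf
  have hint : IntegrableOn (fun t : ℝ => 2 * (m + |t|) * Real.exp (3 * m ^ 2 - 1 / 2 * t ^ 2))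
      (Ioi 0) := by
    have h1 := (integrable_mul_exp_neg_mul_sq (b := 1 / 2) (by norm_num)).abs.integrableOn
      (s := Ioi 0)
    have h2 := (h1.const_mul (2 * Real.exp (3 * m ^ 2))).add (hint2.const_mul (2 * m))
    refine IntegrableOn.congr_fun h2 (fun t _ => ?_) measurableSet_Ioi
    simp only [Pi.add_apply]
    rw [abs_mul, Real.abs_exp, show 3 * m ^ 2 - 1 / 2 * t ^ 2 = 3 * m ^ 2 + -(1 / 2) * t ^ 2 by ring,
      Real.exp_add]
    ring
  have key := hasDerivAt_integral_of_dominated_loc_of_deriv_le (μ := volume.restrict (Ioi (0 : ℝ)))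
    (F := fun (w : ℂ) (t : ℝ) => exp (-(w + t) ^ 2))
    (F' := fun (w : ℂ) (t : ℝ) => -2 * (w + t) * exp (-(w + t) ^ 2))
    (x₀ := v) (s := Metric.ball v 1)
    (bound := fun t : ℝ => 2 * (m + |t|) * Real.exp (3 * m ^ 2 - 1 / 2 * t ^ 2))
    (Metric.ball_mem_nhds _ one_pos) ?_ ?_ ?_ ?_ hint ?_
  · have hFTC : ∫ t in Ioi (0 : ℝ), -2 * (v + t) * exp (-(v + t) ^ 2) = 0 - exp (-v ^ 2) := by
      have := integral_Ioi_of_hasDerivAt_of_tendsto' (a := (0 : ℝ)) (m := (0 : ℂ))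
        (f := fun t : ℝ => exp (-(v + t) ^ 2))
        (f' := fun t : ℝ => -2 * (v + t) * exp (-(v + t) ^ 2)) ?_ key.1 ?_
      · simpa using this
      · intro t _
        have h1 : HasDerivAt (fun t : ℝ => v + (t : ℂ)) 1 t :=
          (hasDerivAt_id t).ofReal_comp.const_add v
        refine ((h1.pow 2).neg.cexp).congr_deriv ?_
        simp only [Pi.neg_apply, Pi.pow_apply]
        push_cast
        ring
      · rw [tendsto_zero_iff_norm_tendsto_zero]
        have hlim : Tendsto (fun t : ℝ => Real.exp (3 * m ^ 2 - 1 / 2 * t ^ 2)) atTop (𝓝 0) := by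
          apply Real.tendsto_exp_atBot.comp
          apply tendsto_atBot_add_const_left
          apply tendsto_neg_atTop_atBot.comp
          exact (tendsto_pow_atTop two_ne_zero).const_mul_atTop (by norm_num)
        refine squeeze_zero (fun _ => norm_nonneg _) (fun t => ?_) hlim
        rw [norm_exp]
        exact Real.exp_le_exp.mpr (hb v (Metric.mem_ball_self one_pos) t)
    have h2 := key.2.const_mul (2 / (Real.sqrt Real.pi : ℂ))
    rw [hFTC] at h2
    refine h2.congr_deriv ?_
    ring
  · exact Eventually.of_forall fun w => by
      apply Measurable.aestronglyMeasurable; fun_prop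
  · refine Integrable.mono' hint2 (by apply Measurable.aestronglyMeasurable; fun_prop) ?_
    refine Eventually.of_forall fun t => ?_
    rw [norm_exp]
    exact Real.exp_le_exp.mpr (hb v (Metric.mem_ball_self one_pos) t)
  · apply Measurable.aestronglyMeasurable; fun_prop
  · refine Eventually.of_forall fun t w hw => ?_
    have hwn : ‖w‖ ≤ m := by
      have h1 : ‖w - v‖ < 1 := by rwa [Metric.mem_ball, dist_eq_norm] at hw
      have h2 := norm_sub_norm_le w v
      linarith
    rw [norm_mul, norm_mul, norm_exp, norm_neg, norm_ofNat]
    have h1 : ‖w + (t : ℂ)‖ ≤ m + |t| := by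
      refine (norm_add_le _ _).trans ?_
      rw [norm_real, Real.norm_eq_abs]
      gcongr
    have h2 := Real.exp_le_exp.mpr (hb w hw t)
    gcongr
  · refine Eventually.of_forall fun t w _ => ?_
    have h1 : HasDerivAt (fun w : ℂ => w + (t : ℂ)) 1 w := (hasDerivAt_id w).add_const _
    refine ((h1.pow 2).neg.cexp).congr_deriv ?_
    simp only [Pi.neg_apply, Pi.pow_apply]
    push_cast
    ring

theorem erfc_zero : erfc 0 = 1 := by
  have h : ∫ t in Ioi (0 : ℝ), exp (-((0 : ℂ) + t) ^ 2) = ((Real.sqrt Real.pi / 2 : ℝ) : ℂ) := by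
    have := integral_gaussian_Ioi 1
    rw [div_one] at this
    rw [← this, ← integral_complex_ofReal]
    refine setIntegral_congr_fun measurableSet_Ioi fun t _ => ?_
    push_cast
    simp
  have : (Real.sqrt Real.pi : ℂ) ≠ 0 := by exact_mod_cast (Real.sqrt_pos.mpr Real.pi_pos).ne'
  rw [erfc, h]
  push_cast
  field_simp

theorem erfc_add_erfc_neg (v : ℂ) : erfc v + erfc (-v) = 2 := by
  have hd : ∀ v, HasDerivAt (fun v => erfc v + erfc (-v)) 0 v := by
    intro v
    have h2 := (hasDerivAt_erfc (-v)).comp v (hasDerivAt_id v).neg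
    refine ((hasDerivAt_erfc v).add h2).congr_deriv ?_
    simp
  have := is_const_of_deriv_eq_zero (fun v => (hd v).differentiableAt) (fun v => (hd v).deriv) v 0
  simp only [neg_zero, erfc_zero] at this
  rw [this]
  norm_num

/-! ### Stirling's formula in the right half-plane -/

theorem log_add_one_of_re_pos {z : ℂ} (hz : 0 < z.re) : log (z + 1) = log z + log (1 + z⁻¹) := by
  have hz0 : z ≠ 0 := fun h => by simp [h] at hz
  have hi : 0 < (1 + z⁻¹).re := by
    rw [add_re, one_re, inv_re]
    have := div_pos hz (normSq_pos.mpr hz0)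
    linarith
  have hi0 : 1 + z⁻¹ ≠ 0 := fun h => by simp [h] at hi
  have h1 := abs_lt.mp (abs_arg_lt_pi_div_two_iff.mpr (Or.inl hz))
  have h2 := abs_lt.mp (abs_arg_lt_pi_div_two_iff.mpr (Or.inl hi))
  rw [← (log_mul_eq_add_log_iff hz0 hi0).mpr ⟨by linarith, by linarith⟩]
  congr 1
  field_simp

/-- The logarithm of the quotient of consecutive values of the scaled gamma function. -/
noncomputable def stirlingStep (z : ℂ) : ℂ := (z + 1 / 2) * log (1 + z⁻¹) - 1

/-- In w = 1/z both expressions begin with w²/12 - w³/12. The comparison term telescopes when summed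
over z, z + 1, …, and produces the coefficient 1/12. -/
theorem norm_stirlingStep_sub_le {z : ℂ} (hz : 2 ≤ ‖z‖) :
    ‖stirlingStep z - (z⁻¹ - (z + 1)⁻¹) / 12‖ ≤ (‖z‖ ^ 4)⁻¹ := by
  have hz0 : z ≠ 0 := fun h => by norm_num [h] at hz
  obtain ⟨w, hw⟩ : ∃ w, w = z⁻¹ := ⟨_, rfl⟩
  have hw0 : w ≠ 0 := hw ▸ inv_ne_zero hz0
  have hwn : ‖w‖ ≤ 1 / 2 := by
    rw [hw, norm_inv, one_div]; gcongr
  have hlog := norm_log_sub_logTaylor_le 4 (z := w) (by linarith)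
  obtain ⟨e, he⟩ : ∃ e, e = log (1 + w) - logTaylor (4 + 1) w := ⟨_, rfl⟩
  rw [← he] at hlog
  have hT : logTaylor (4 + 1) w = w - w ^ 2 / 2 + w ^ 3 / 3 - w ^ 4 / 4 := by
    simp only [logTaylor, Finset.sum_range_succ, Finset.sum_range_zero]
    push_cast
    ring
  have he' : log (1 + w) = w - w ^ 2 / 2 + w ^ 3 / 3 - w ^ 4 / 4 + e := by
    rw [he, hT]; ring
  have h1w : 1 / 2 ≤ ‖1 + w‖ := by
    have := norm_sub_le_norm_add (1 : ℂ) w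
    rw [norm_one] at this
    linarith
  have h1w0 : 1 + w ≠ 0 := fun h => by rw [h, norm_zero] at h1w; linarith
  have hz1 : (z + 1)⁻¹ = w / (1 + w) := by
    rw [hw]
    have : z + 1 ≠ 0 := by
      intro h
      apply h1w0
      rw [hw, eq_neg_of_add_eq_zero_left h]; norm_num
    rw [hw] at h1w0
    field_simp
  have key : stirlingStep z - (z⁻¹ - (z + 1)⁻¹) / 12 =
      (w⁻¹ + 1 / 2) * e - w ^ 4 / 8 - w ^ 4 / 12 * (1 + w)⁻¹ := by
    rw [stirlingStep, hz1, ← hw, he', show z = w⁻¹ by rw [hw, inv_inv]]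
    field_simp
    ring
  have hzn : (‖z‖ ^ 4)⁻¹ = ‖w‖ ^ 4 := by rw [hw, norm_inv, inv_pow]
  have hwp : 0 < ‖w‖ := norm_pos_iff.mpr hw0
  have he2 : ‖e‖ ≤ 2 / 5 * ‖w‖ ^ 5 := by
    refine hlog.trans ?_
    have : (1 - ‖w‖)⁻¹ ≤ 2 := by
      rw [inv_le_comm₀ (by linarith) two_pos]; linarith
    calc _ ≤ ‖w‖ ^ (4 + 1) * 2 / ((4 : ℕ) + 1) := by gcongr
      _ = _ := by norm_num; ring
  have a1 : ‖(w⁻¹ + 1 / 2) * e‖ ≤ 1 / 2 * ‖w‖ ^ 4 := by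
    rw [norm_mul]
    have : ‖w⁻¹ + 1 / 2‖ ≤ ‖w‖⁻¹ + 1 / 2 := by
      refine (norm_add_le _ _).trans ?_
      rw [norm_inv]; norm_num
    calc _ ≤ (‖w‖⁻¹ + 1 / 2) * (2 / 5 * ‖w‖ ^ 5) := by gcongr
      _ = 2 / 5 * ‖w‖ ^ 4 * (1 + ‖w‖ / 2) := by field_simp
      _ ≤ 2 / 5 * ‖w‖ ^ 4 * (1 + (1 / 2) / 2) := by gcongr
      _ = _ := by ring
  have a2 : ‖w ^ 4 / 8‖ = 1 / 8 * ‖w‖ ^ 4 := by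
    rw [norm_div, norm_pow]; norm_num; ring
  have a3 : ‖w ^ 4 / 12 * (1 + w)⁻¹‖ ≤ 1 / 6 * ‖w‖ ^ 4 := by
    rw [norm_mul, norm_div, norm_pow, norm_inv]
    have : ‖1 + w‖⁻¹ ≤ 2 := by
      rw [inv_le_comm₀ (by linarith) two_pos]; linarith
    calc _ ≤ ‖w‖ ^ 4 / ‖(12 : ℂ)‖ * 2 := by gcongr
      _ = _ := by norm_num; ring
  rw [key, hzn]
  refine (norm_sub_le _ _).trans ?_
  have := norm_sub_le ((w⁻¹ + 1 / 2) * e) (w ^ 4 / 8)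
  have hp : 0 < ‖w‖ ^ 4 := by positivity
  linarith

/-- The gamma function, divided by the elementary factor of Stirling's formula. -/
noncomputable def scaledGamma (z : ℂ) : ℂ := Gamma (z + 1) * exp (z - (z + 1 / 2) * log z)

theorem scaledGamma_eq {z : ℂ} (hz : 0 < z.re) (n : ℕ) :
    scaledGamma z = scaledGamma (z + n) * exp (∑ k ∈ Finset.range n, stirlingStep (z + k)) := by
  induction n with
  | zero => simp
  | succ n ih =>
    rw [ih, Finset.sum_range_succ, add_comm (Finset.sum _ _), exp_add, ← mul_assoc]
    congr 1
    set y := z + n with hy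
    have hyr : 0 < y.re := by
      rw [hy, add_re, natCast_re]; positivity
    have hy1 : y + 1 ≠ 0 := fun h => by
      have := congrArg re h
      simp only [add_re, one_re, zero_re] at this
      linarith
    have e1 : z + ((n + 1 : ℕ) : ℂ) = y + 1 := by rw [hy]; push_cast; ring
    rw [e1, scaledGamma, scaledGamma, Gamma_add_one (y + 1) hy1, stirlingStep, mul_assoc,
      ← exp_add]
    have e2 : y + 1 - (y + 1 + 1 / 2) * log (y + 1) + ((y + 1 / 2) * log (1 + y⁻¹) - 1) =
        y - (y + 1 / 2) * log y + -log (y + 1) := by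
      rw [log_add_one_of_re_pos hyr]; ring
    rw [e2, exp_add, exp_neg, exp_log hy1]
    field_simp

/-- Euler's limit formula compares Γ(z + n + 1) with n!, for which the real Stirling formula is
available. Along integer translates this already fixes the constant √(2π). -/
theorem tendsto_scaledGamma {z : ℂ} (hz : 0 < z.re) :
    Tendsto (fun n : ℕ => scaledGamma (z + n)) atTop (𝓝 (Real.sqrt (2 * Real.pi) : ℂ)) := by
  have hzk : ∀ k : ℕ, z + k ≠ 0 := fun k h => by
    have := congrArg re h
    simp only [add_re, natCast_re, zero_re] at this
    have : (0 : ℝ) ≤ k := by positivity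
    linarith
  have hΓ : Gamma z ≠ 0 := Gamma_ne_zero_of_re_pos hz
  have hprod : ∀ n : ℕ, Gamma (z + n + 1) = Gamma z * ∏ j ∈ Finset.range (n + 1), (z + j) := by
    intro n
    induction n with
    | zero =>
      have := Gamma_add_one z (by simpa using hzk 0)
      simp [this, mul_comm]
    | succ n ih =>
      have e : z + ((n + 1 : ℕ) : ℂ) = z + n + 1 := by push_cast; ring
      rw [Finset.prod_range_succ, ← mul_assoc, ← ih, e,
        Gamma_add_one (z + n + 1) (by rw [← e]; exact hzk _), mul_comm]
  have t1 : Tendsto (fun n : ℕ => Gamma z / GammaSeq z n) atTop (𝓝 (Gamma z / Gamma z)) :=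
    tendsto_const_nhds.div (GammaSeq_tendsto_Gamma z) hΓ
  rw [div_self hΓ] at t1
  have t2 : Tendsto (fun n : ℕ => (Stirling.stirlingSeq n : ℂ)) atTop
      (𝓝 (Real.sqrt Real.pi : ℂ)) :=
    (continuous_ofReal.tendsto _).comp Stirling.tendsto_stirlingSeq_sqrt_pi
  have tz : Tendsto (fun n : ℕ => (n : ℂ) * (z / n)) atTop (𝓝 z) := by
    refine tendsto_const_nhds.congr' ?_
    filter_upwards [eventually_ne_atTop 0] with n hn
    have : (n : ℂ) ≠ 0 := by exact_mod_cast hn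
    field_simp
  have t3 := tendsto_nat_mul_log_one_add_of_tendsto tz
  have t4 : Tendsto (fun n : ℕ => log (1 + z / n)) atTop (𝓝 0) := by
    have h0 : Tendsto (fun n : ℕ => 1 + z / n) atTop (𝓝 (1 + 0)) :=
      tendsto_const_nhds.add (tendsto_const_div_atTop_nhds_zero_nat z)
    rw [add_zero] at h0
    have := (continuousAt_clog (x := 1) (by simp)).tendsto.comp h0
    rwa [log_one] at this
  have t5 : Tendsto (fun n : ℕ => exp (z - ((z + 1 / 2) * log (1 + z / n) + n * log (1 + z / n))))
      atTop (𝓝 (exp (z - ((z + 1 / 2) * 0 + z)))) :=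
    (continuous_exp.tendsto _).comp (tendsto_const_nhds.sub ((t4.const_mul _).add t3))
  have t6 := (t1.mul (t2.mul_const (Real.sqrt 2 : ℂ))).mul t5
  have e0 : (1 : ℂ) * ((Real.sqrt Real.pi : ℂ) * (Real.sqrt 2 : ℂ)) *
      exp (z - ((z + 1 / 2) * 0 + z)) = (Real.sqrt (2 * Real.pi) : ℂ) := by
    rw [Real.sqrt_mul (by norm_num)]
    push_cast
    simp [mul_comm]
  rw [e0] at t6
  refine t6.congr' ?_
  filter_upwards [eventually_ne_atTop 0] with n hn
  have hn0 : (n : ℂ) ≠ 0 := by exact_mod_cast hn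
  have hnr : (0 : ℝ) < n := by positivity
  have hP : ∏ j ∈ Finset.range (n + 1), (z + (j : ℂ)) ≠ 0 := Finset.prod_ne_zero_iff.mpr
    fun j _ => hzk j
  have hG : Gamma z / GammaSeq z n =
      Gamma (z + n + 1) / (exp (z * log n) * (n.factorial : ℂ)) := by
    rw [GammaSeq, hprod, cpow_def_of_ne_zero hn0, mul_comm z]
    have : (n.factorial : ℂ) ≠ 0 := by exact_mod_cast n.factorial_ne_zero
    field_simp
  have hfac : (n.factorial : ℂ) = (Stirling.stirlingSeq n : ℂ) * (Real.sqrt 2 : ℂ) *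
      exp (log n / 2 + n * log n - n) := by
    have hr : (n.factorial : ℝ) = Stirling.stirlingSeq n * Real.sqrt 2 *
        Real.exp (Real.log n / 2 + n * Real.log n - n) := by
      rw [Real.exp_sub, Real.exp_add, Real.exp_nat_mul, Real.exp_log hnr, Stirling.stirlingSeq,
        show Real.exp (Real.log n / 2) = Real.sqrt n by
          rw [Real.sqrt_eq_rpow, Real.rpow_def_of_pos hnr]; ring_nf,
        Real.sqrt_mul (by norm_num), div_pow, ← Real.exp_nat_mul, mul_one]
      have := Real.exp_ne_zero (n : ℝ)
      field_simp
    have := congrArg (fun x : ℝ => (x : ℂ)) hr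
    push_cast at this
    rw [this]
  have hlog : log (z + n) = log n + log (1 + z / n) := by
    have h1 : 1 + z / n ≠ 0 := by
      have := hzk n
      intro h
      apply this
      field_simp at h
      linear_combination h
    have := log_ofReal_mul hnr h1
    rw [show ((n : ℝ) : ℂ) * (1 + z / n) = z + n by push_cast; field_simp; ring] at this
    rw [this, ← natCast_log]
  have hS : (Stirling.stirlingSeq n : ℂ) ≠ 0 ∧ (Real.sqrt 2 : ℂ) ≠ 0 := by
    have : (n.factorial : ℂ) ≠ 0 := by exact_mod_cast n.factorial_ne_zero
    rw [hfac] at this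
    simp only [ne_eq, mul_eq_zero, not_or] at this
    exact this.1
  rw [hG, scaledGamma, hfac, hlog]
  have e3 : z + n - (z + n + 1 / 2) * (log n + log (1 + z / n)) =
      (z - ((z + 1 / 2) * log (1 + z / n) + n * log (1 + z / n))) -
        (z * log n + (log n / 2 + n * log n - n)) := by ring
  rw [e3, exp_sub _ (z * log n + _), exp_add (z * log n)]
  obtain ⟨hS1, hS2⟩ := hS
  have := exp_ne_zero (z * log n)
  have := exp_ne_zero (log n / 2 + n * log n - n)
  field_simp

theorem sum_inv_sq_add_one_le (n : ℕ) :
    ∑ k ∈ Finset.range n, ((1 : ℝ) + k ^ 2)⁻¹ ≤ 4 - 4 / (n + 1) := by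
  induction n with
  | zero => simp
  | succ n ih =>
    rw [Finset.sum_range_succ]
    -- A telescoping majorant: it amounts to (n + 1)(n + 2) ≤ 4(1 + n²).
    have h : ((1 : ℝ) + n ^ 2)⁻¹ ≤ 4 / (n + 1) - 4 / (n + 1 + 1) := by
      rw [div_sub_div _ _ (by positivity) (by positivity), inv_eq_one_div,
        div_le_div_iff₀ (by positivity) (by positivity)]
      have hn : (0 : ℝ) ≤ n := by positivity
      nlinarith [sq_nonneg ((n : ℝ) - 1)]
    push_cast
    linarith

/-- In the right half-plane |z + k|² ≥ |z|² + k², hence |z + k|⁴ ≥ |z|²(1 + k²). The errors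
therefore sum to O(|z|⁻²), uniformly in n and in arg z. -/
theorem norm_sum_stirlingStep_sub_le {z : ℂ} (hz : 2 ≤ z.re) (n : ℕ) :
    ‖∑ k ∈ Finset.range n, stirlingStep (z + k) - (z⁻¹ - (z + n)⁻¹) / 12‖ ≤ 4 / ‖z‖ ^ 2 := by
  have hz2 : 2 ≤ ‖z‖ := hz.trans (re_le_norm z)
  have hsq : ∀ k : ℕ, ‖z‖ ^ 2 + k ^ 2 ≤ ‖z + k‖ ^ 2 := by
    intro k
    rw [Complex.sq_norm, Complex.sq_norm, normSq_apply, normSq_apply]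
    simp only [add_re, natCast_re, add_im, natCast_im, add_zero]
    nlinarith [mul_nonneg (show (0 : ℝ) ≤ z.re by linarith) (show (0 : ℝ) ≤ k by positivity)]
  have htel : (z⁻¹ - (z + n)⁻¹) / 12 =
      ∑ k ∈ Finset.range n, ((z + k)⁻¹ - (z + k + 1)⁻¹) / 12 := by
    have := Finset.sum_range_sub' (fun k : ℕ => (z + k)⁻¹ / 12) n
    simp only [Nat.cast_zero, add_zero] at this
    rw [sub_div, ← this]
    refine Finset.sum_congr rfl fun k _ => ?_
    push_cast
    rw [add_assoc]
    ring
  rw [htel, ← Finset.sum_sub_distrib]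
  refine (norm_sum_le _ _).trans ?_
  have hk : ∀ k ∈ Finset.range n,
      ‖stirlingStep (z + k) - ((z + k)⁻¹ - (z + k + 1)⁻¹) / 12‖ ≤
        ((1 : ℝ) + k ^ 2)⁻¹ * (‖z‖ ^ 2)⁻¹ := by
    intro k _
    have h1 := hsq k
    have h2 : 2 ≤ ‖z + k‖ := by
      refine le_trans ?_ (re_le_norm _)
      rw [add_re, natCast_re]
      have : (0 : ℝ) ≤ k := by positivity
      linarith
    refine (norm_stirlingStep_sub_le h2).trans ?_
    rw [← mul_inv]
    gcongr
    calc ((1 : ℝ) + k ^ 2) * ‖z‖ ^ 2 ≤ ‖z + k‖ ^ 2 * ‖z + k‖ ^ 2 := by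
          gcongr <;> nlinarith
      _ = _ := by ring
  refine (Finset.sum_le_sum hk).trans ?_
  rw [← Finset.sum_mul, div_eq_mul_inv]
  gcongr
  have := sum_inv_sq_add_one_le n
  have : (0 : ℝ) ≤ 4 / (n + 1) := by positivity
  linarith

/-- Stirling's formula with its first correction, in the right half-plane. -/
theorem norm_scaledGamma_sub_le {z : ℂ} (hz : 3 ≤ z.re) :
    ‖scaledGamma z / Real.sqrt (2 * Real.pi) - 1 - 1 / (12 * z)‖ ≤ 8 / ‖z‖ ^ 2 := by
  have hz3 : 3 ≤ ‖z‖ := hz.trans (re_le_norm z)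
  have hz0 : z ≠ 0 := fun h => by norm_num [h] at hz3
  have hs0 : (Real.sqrt (2 * Real.pi) : ℂ) ≠ 0 := by
    have := Real.pi_pos
    exact_mod_cast (Real.sqrt_pos.mpr (by positivity)).ne'
  set S : ℕ → ℂ := fun n => ∑ k ∈ Finset.range n, stirlingStep (z + k) with hS
  have hlim : Tendsto (fun n => exp (S n)) atTop
      (𝓝 (scaledGamma z / Real.sqrt (2 * Real.pi))) := by
    have t := (tendsto_const_nhds (x := scaledGamma z)).div
      (tendsto_scaledGamma (z := z) (by linarith)) hs0
    refine t.congr' ?_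
    have hev := (tendsto_scaledGamma (z := z) (by linarith)).eventually_ne hs0
    filter_upwards [hev] with n hn
    rw [Pi.div_apply, scaledGamma_eq (z := z) (by linarith) n, mul_div_cancel_left₀ _ hn]
  have hnorm : ∀ n : ℕ, ‖z‖ ≤ ‖z + n‖ := by
    intro n
    rw [← abs_of_nonneg (norm_nonneg z), ← abs_of_nonneg (norm_nonneg (z + n)), ← sq_le_sq,
      Complex.sq_norm, Complex.sq_norm, normSq_apply, normSq_apply]
    simp only [add_re, natCast_re, add_im, natCast_im, add_zero]
    have : (0 : ℝ) ≤ n := by positivity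
    nlinarith [mul_nonneg (show (0 : ℝ) ≤ z.re by linarith) this]
  have t0 : Tendsto (fun n : ℕ => ‖(z + n)⁻¹‖) atTop (𝓝 0) := by
    have h1 : Tendsto (fun n : ℕ => (n : ℝ)⁻¹) atTop (𝓝 0) := tendsto_inv_atTop_nhds_zero_nat
    refine squeeze_zero' (Eventually.of_forall fun _ => norm_nonneg _) ?_ h1
    filter_upwards [eventually_gt_atTop 0] with n hn
    rw [norm_inv]
    have : (0 : ℝ) < n := by exact_mod_cast hn
    gcongr
    refine le_trans ?_ (re_le_norm _)
    rw [add_re, natCast_re]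
    linarith
  -- The estimate is made at finite n, with the end of the telescoped sum kept as an extra error
  -- that disappears as n → ∞.
  have hb : ∀ n : ℕ, ‖exp (S n) - 1 - 1 / (12 * z)‖ ≤ 8 / ‖z‖ ^ 2 + ‖(z + n)⁻¹‖ := by
    intro n
    obtain ⟨e, he⟩ : ∃ e, e = S n - (z⁻¹ - (z + n)⁻¹) / 12 := ⟨_, rfl⟩
    have hen : ‖e‖ ≤ 4 / ‖z‖ ^ 2 := he ▸ norm_sum_stirlingStep_sub_le (by linarith) n
    have hSn : S n = z⁻¹ / 12 - (z + n)⁻¹ / 12 + e := by rw [he]; ring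
    have n1 : ‖z⁻¹ / 12‖ = ‖z‖⁻¹ / 12 := by rw [norm_div, norm_inv]; norm_num
    have n2 : ‖(z + n)⁻¹ / 12‖ = ‖(z + n)⁻¹‖ / 12 := by rw [norm_div]; norm_num
    have n3 : ‖(z + n)⁻¹‖ ≤ ‖z‖⁻¹ := by
      rw [norm_inv]
      have := hnorm n
      gcongr
    have n4 : 4 / ‖z‖ ^ 2 ≤ 4 / 3 * ‖z‖⁻¹ := by
      rw [← div_eq_mul_inv, div_le_div_iff₀ (by positivity) (by positivity)]
      nlinarith
    have hzi : ‖z‖⁻¹ ≤ 1 / 3 := by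
      rw [one_div]; gcongr
    have hSb : ‖S n‖ ≤ 2 * ‖z‖⁻¹ := by
      rw [hSn]
      have a1 := norm_add_le (z⁻¹ / 12 - (z + n)⁻¹ / 12) e
      have a2 := norm_sub_le (z⁻¹ / 12) ((z + n)⁻¹ / 12)
      have : 0 ≤ ‖z‖⁻¹ := by positivity
      linarith
    have hexp := norm_exp_sub_one_sub_id_le (x := S n) (by linarith)
    have hsq : ‖S n‖ ^ 2 ≤ 4 / ‖z‖ ^ 2 := by
      calc _ ≤ (2 * ‖z‖⁻¹) ^ 2 := by gcongr
        _ = _ := by field_simp; norm_num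
    have hdec : exp (S n) - 1 - 1 / (12 * z) =
        (exp (S n) - 1 - S n) + (e - (z + n)⁻¹ / 12) := by
      rw [hSn]; field_simp; ring
    rw [hdec]
    have a1 := norm_add_le (exp (S n) - 1 - S n) (e - (z + n)⁻¹ / 12)
    have a2 := norm_sub_le e ((z + n)⁻¹ / 12)
    have : 0 ≤ ‖(z + n)⁻¹‖ := norm_nonneg _
    have : 8 / ‖z‖ ^ 2 = 4 / ‖z‖ ^ 2 + 4 / ‖z‖ ^ 2 := by ring
    linarith
  have tl := ((hlim.sub_const 1).sub_const (1 / (12 * z))).norm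
  have tr : Tendsto (fun n : ℕ => 8 / ‖z‖ ^ 2 + ‖(z + n)⁻¹‖) atTop (𝓝 (8 / ‖z‖ ^ 2 + 0)) :=
    tendsto_const_nhds.add t0
  rw [add_zero] at tr
  exact le_of_tendsto_of_tendsto' tl tr hb

/-! ### The incomplete gamma function on the Riemann surface of the logarithm -/

theorem norm_exp_neg_exp_sub_le (N : ℂ) {x : ℝ} (hx : 0 ≤ x) :
    ‖exp (-exp (x : ℂ) - N * x)‖ ≤ Real.exp (N.re ^ 2 / 2) * Real.exp (-x) := by
  rw [norm_exp, ← Real.exp_add]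
  apply Real.exp_le_exp.mpr
  have e : (-exp (x : ℂ) - N * x).re = -Real.exp x - N.re * x := by
    rw [sub_re, neg_re, exp_ofReal_re, re_mul_ofReal]
  rw [e]
  have := Real.quadratic_le_exp_of_nonneg hx
  nlinarith [sq_nonneg (x + N.re)]

theorem integrableOn_Ioi_exp_neg_exp_sub (N : ℂ) :
    IntegrableOn (fun x : ℝ => exp (-exp (x : ℂ) - N * x)) (Ioi 0) := by
  have h1 : IntegrableOn (fun x : ℝ => Real.exp (N.re ^ 2 / 2) * Real.exp (-x)) (Ioi 0) :=
    (integrableOn_exp_neg_Ioi 0).const_mul _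
  refine Integrable.mono' h1 (by apply Measurable.aestronglyMeasurable; fun_prop) ?_
  filter_upwards [ae_restrict_mem measurableSet_Ioi] with x hx
  exact norm_exp_neg_exp_sub_le N (le_of_lt hx)

theorem tendsto_exp_neg_exp_sub (N : ℂ) :
    Tendsto (fun x : ℝ => exp (-exp (x : ℂ) - N * x)) atTop (𝓝 0) := by
  rw [tendsto_zero_iff_norm_tendsto_zero]
  have h := Real.tendsto_exp_neg_atTop_nhds_zero.const_mul (Real.exp (N.re ^ 2 / 2))
  rw [mul_zero] at h
  refine squeeze_zero' (Eventually.of_forall fun _ => norm_nonneg _) ?_ h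
  filter_upwards [eventually_ge_atTop 0] with x hx
  exact norm_exp_neg_exp_sub_le N hx

/-- An entire function has an entire primitive; integrability on the positive real axis gives that
primitive a limit at +∞, which is subtracted. -/
theorem exists_tailPrimitive (N : ℂ) : ∃ V : ℂ → ℂ,
    (∀ u, HasDerivAt V (exp (-exp u - N * u)) u) ∧ Tendsto (fun x : ℝ => V x) atTop (𝓝 0) := by
  have hf : Differentiable ℂ fun u => exp (-exp u - N * u) := by fun_prop
  obtain ⟨g, -, hg⟩ := hf.isExactOn_univ.with_val_at 0 0
  have hl := tendsto_limUnder_of_hasDerivAt_of_integrableOn_Ioi (a := 0)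
    (f := fun x : ℝ => g x) (fun x _ => (hg x (mem_univ _)).comp_ofReal)
    (integrableOn_Ioi_exp_neg_exp_sub N)
  refine ⟨fun u => g u - limUnder atTop fun x : ℝ => g x, fun u => ?_, ?_⟩
  · exact (hg u (mem_univ _)).sub_const _
  · simpa using hl.sub_const (limUnder atTop fun x : ℝ => g x)

/-- The entire function of `u` with derivative `exp (-e^u - N u)` that tends to `0` as
`u → +∞` on the real axis; it is `-Γ(-N, e^u)`. -/
noncomputable def tailPrimitive (N : ℂ) : ℂ → ℂ := Classical.choose (exists_tailPrimitive N)

theorem hasDerivAt_tailPrimitive (N u : ℂ) :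
    HasDerivAt (tailPrimitive N) (exp (-exp u - N * u)) u :=
  (Classical.choose_spec (exists_tailPrimitive N)).1 u

theorem tendsto_tailPrimitive (N : ℂ) :
    Tendsto (fun x : ℝ => tailPrimitive N x) atTop (𝓝 0) :=
  (Classical.choose_spec (exists_tailPrimitive N)).2

/-! ### Monodromy of the incomplete gamma function and Hankel's formula -/

theorem exp_add_two_pi_mul_I (u : ℂ) : exp (u + 2 * Real.pi * I) = exp u := by
  rw [exp_add, exp_two_pi_mul_I, mul_one]

/-- The connection coefficient of `tailPrimitive`. -/
noncomputable def connection (N : ℂ) : ℂ :=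
  tailPrimitive N (2 * Real.pi * I) - exp (-(2 * Real.pi * I * N)) * tailPrimitive N 0

/-- The shift by 2πi multiplies the integrand by e^{-2πiN}, so the two primitives differ by a
constant. -/
theorem tailPrimitive_add (N u : ℂ) : tailPrimitive N (u + 2 * Real.pi * I) =
    exp (-(2 * Real.pi * I * N)) * tailPrimitive N u + connection N := by
  have hd : ∀ u, HasDerivAt (fun u => tailPrimitive N (u + 2 * Real.pi * I) -
      exp (-(2 * Real.pi * I * N)) * tailPrimitive N u) 0 u := by
    intro u
    have h1 := (hasDerivAt_tailPrimitive N (u + 2 * Real.pi * I)).comp_add_const u _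
    refine (h1.sub ((hasDerivAt_tailPrimitive N u).const_mul _)).congr_deriv ?_
    rw [exp_add_two_pi_mul_I, ← exp_add, sub_eq_zero]
    congr 1
    ring
  have := is_const_of_deriv_eq_zero (fun v => (hd v).differentiableAt) (fun v => (hd v).deriv) u 0
  simp only [zero_add] at this
  rw [connection, ← this]
  ring

/-- Integration by parts; the constant is fixed by the vanishing at +∞. It gives the recurrence for
`connection` that extends Hankel's formula from Re N < 0 to all N. -/
theorem tailPrimitive_sub_one (N u : ℂ) :
    tailPrimitive (N - 1) u = -N * tailPrimitive N u - exp (-exp u - N * u) := by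
  have hd : ∀ u, HasDerivAt (fun u => tailPrimitive (N - 1) u -
      (-N * tailPrimitive N u - exp (-exp u - N * u))) 0 u := by
    intro u
    have h1 : HasDerivAt (fun u => -exp u - N * u) (-exp u - N * 1) u :=
      (Complex.hasDerivAt_exp u).neg.sub ((hasDerivAt_id u).const_mul N)
    refine ((hasDerivAt_tailPrimitive (N - 1) u).sub
      (((hasDerivAt_tailPrimitive N u).const_mul (-N)).sub h1.cexp)).congr_deriv ?_
    rw [show -exp u - (N - 1) * u = (-exp u - N * u) + u by ring, exp_add]
    ring
  have hc := is_const_of_deriv_eq_zero (fun v => (hd v).differentiableAt) (fun v => (hd v).deriv)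
  have ht : Tendsto (fun x : ℝ => tailPrimitive (N - 1) x -
      (-N * tailPrimitive N x - exp (-exp (x : ℂ) - N * x))) atTop (𝓝 (0 - (-N * 0 - 0))) :=
    (tendsto_tailPrimitive (N - 1)).sub
      (((tendsto_tailPrimitive N).const_mul (-N)).sub (tendsto_exp_neg_exp_sub N))
  have h2 := tendsto_nhds_unique (ht.congr fun x : ℝ => hc (x : ℂ) u) tendsto_const_nhds
  simp only [mul_zero, sub_zero] at h2
  exact sub_eq_zero.mp h2.symm

theorem connection_sub_one (N : ℂ) : connection (N - 1) = -N * connection N := by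
  rw [connection, connection, tailPrimitive_sub_one, tailPrimitive_sub_one,
    show (2 * Real.pi * I : ℂ) = 0 + 2 * Real.pi * I by ring, exp_add_two_pi_mul_I, zero_add,
    show -(2 * Real.pi * I * (N - 1)) = -(2 * Real.pi * I * N) + 2 * Real.pi * I by ring,
    exp_add_two_pi_mul_I,
    show -exp 0 - N * (2 * Real.pi * I) = (-exp 0 - N * 0) + -(2 * Real.pi * I * N) by ring,
    exp_add]
  ring

/-- Mean value inequality on a half-strip: a primitive whose derivative decays to the left has
asymptotically no increment over 2πi there, which lets the connection coefficient be read off at -∞.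
-/
theorem tendsto_sub_of_deriv_bound {V V' : ℂ → ℂ} {b : ℝ → ℝ} (hb : Tendsto b atBot (𝓝 0))
    (hV : ∀ u, HasDerivAt V (V' u) u)
    (h : ∀ x : ℝ, x ≤ 0 → ∀ u : ℂ, u.re ≤ x → 0 ≤ u.im → u.im ≤ 2 * Real.pi → ‖V' u‖ ≤ b x) :
    Tendsto (fun x : ℝ => V (x + 2 * Real.pi * I) - V x) atBot (𝓝 0) := by
  have hpi := Real.pi_pos
  rw [tendsto_zero_iff_norm_tendsto_zero]
  have hb2 := hb.mul_const (2 * Real.pi)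
  rw [zero_mul] at hb2
  refine squeeze_zero' (Eventually.of_forall fun _ => norm_nonneg _) ?_ hb2
  filter_upwards [eventually_le_atBot 0] with x hx
  have hconv : Convex ℝ {u : ℂ | u.re ≤ x ∧ 0 ≤ u.im ∧ u.im ≤ 2 * Real.pi} :=
    (convex_halfSpace_re_le x).inter ((convex_halfSpace_im_ge 0).inter (convex_halfSpace_im_le _))
  have := hconv.norm_image_sub_le_of_norm_hasDerivWithin_le (f := V) (f' := V') (C := b x)
    (x := (x : ℂ)) (y := x + 2 * Real.pi * I) (fun u _ => (hV u).hasDerivWithinAt)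
    (fun u hu => h x hx u hu.1 hu.2.1 hu.2.2) (by simp; positivity) (by simp; positivity)
  refine this.trans_eq ?_
  rw [add_sub_cancel_left]
  simp [abs_of_pos hpi]

/-- A separate case because the recurrence degenerates at N = 0. There the integrand tends to 1 on
the left, so u is subtracted from the primitive before comparing increments. -/
theorem connection_zero : connection 0 = 2 * Real.pi * I := by
  have h1 : ∀ u, HasDerivAt (fun u => tailPrimitive 0 u - u) (exp (-exp u) - 1) u := by
    intro u
    refine ((hasDerivAt_tailPrimitive 0 u).sub (hasDerivAt_id u)).congr_deriv ?_
    simp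
  have hb : Tendsto (fun x => 2 * Real.exp x) atBot (𝓝 0) := by
    simpa using Real.tendsto_exp_atBot.const_mul 2
  have ht := tendsto_sub_of_deriv_bound hb h1 fun x hx u hu _ _ => by
    have hn : ‖-exp u‖ ≤ Real.exp x := by
      rw [norm_neg, norm_exp]; exact Real.exp_le_exp.mpr hu
    have := norm_exp_sub_one_le (hn.trans (Real.exp_le_one_iff.mpr hx))
    linarith
  have h2 : ∀ x : ℝ, tailPrimitive 0 (x + 2 * Real.pi * I) - (x + 2 * Real.pi * I) -
      (tailPrimitive 0 x - x) = connection 0 - 2 * Real.pi * I := by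
    intro x
    rw [tailPrimitive_add]
    simp only [mul_zero, neg_zero, exp_zero, one_mul]
    ring
  have := tendsto_nhds_unique (ht.congr h2) tendsto_const_nhds
  exact sub_eq_zero.mp this.symm

/-- Euler's integral on the real line. -/
theorem integral_exp_neg_exp_add {s : ℂ} (hs : 0 < s.re) :
    Integrable (fun x : ℝ => exp (-exp (x : ℂ) + s * x)) ∧
      ∫ x : ℝ, exp (-exp (x : ℂ) + s * x) = Gamma s := by
  have himg : Real.exp '' univ = Ioi 0 := by rw [image_univ, Real.range_exp]
  have hd : ∀ x ∈ univ, HasDerivWithinAt Real.exp (Real.exp x) univ x :=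
    fun x _ => (Real.hasDerivAt_exp x).hasDerivWithinAt
  have hinj : univ.InjOn Real.exp := Real.exp_injective.injOn
  have heq : ∀ x : ℝ, |Real.exp x| • (((Real.exp (-(Real.exp x)) : ℝ) : ℂ) *
      ((Real.exp x : ℝ) : ℂ) ^ (s - 1)) = exp (-exp (x : ℂ) + s * x) := by
    intro x
    have hx : ((Real.exp x : ℝ) : ℂ) ≠ 0 := by exact_mod_cast (Real.exp_pos x).ne'
    rw [Real.abs_exp, real_smul, cpow_def_of_ne_zero hx, ← ofReal_log (Real.exp_pos x).le,
      Real.log_exp]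
    push_cast
    rw [← exp_add, ← exp_add]
    congr 1
    ring
  have hi := GammaIntegral_convergent hs
  rw [← himg, integrableOn_image_iff_integrableOn_abs_deriv_smul MeasurableSet.univ hd hinj] at hi
  have hint : Gamma s = ∫ x in Ioi (0 : ℝ), ((Real.exp (-x) : ℝ) : ℂ) * (x : ℂ) ^ (s - 1) :=
    Gamma_eq_integral hs
  rw [← himg, integral_image_eq_integral_abs_deriv_smul MeasurableSet.univ hd hinj] at hint
  simp only [heq, Measure.restrict_univ] at hint
  rw [integrableOn_univ] at hi
  exact ⟨hi.congr (Eventually.of_forall heq), hint.symm⟩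

/-- For Re N < 0 the integral over the whole real line converges to Γ(-N), so the primitive tends to
-Γ(-N) at -∞. The vanishing increment there gives the coefficient (e^{-2πiN} - 1) Γ(-N), and the
reflection formula does the rest. -/
theorem connection_of_re_neg {N : ℂ} (hN : N.re < 0) :
    connection N = 2 * Real.pi * I * exp (-(Real.pi * I * N)) / Gamma (N + 1) := by
  have hpi := Real.pi_pos
  obtain ⟨hi, hΓ⟩ := integral_exp_neg_exp_add (s := -N) (by simpa using hN)
  have e : ∀ x : ℝ, exp (-exp (x : ℂ) + -N * x) = exp (-exp (x : ℂ) - N * x) := fun x => by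
    congr 1; ring
  simp only [e] at hi hΓ
  have hder : ∀ x : ℝ, HasDerivAt (fun x : ℝ => tailPrimitive N x)
      (exp (-exp (x : ℂ) - N * x)) x := fun x => (hasDerivAt_tailPrimitive N x).comp_ofReal
  have hbot := tendsto_limUnder_of_hasDerivAt_of_integrableOn_Iic (a := 0)
    (fun x _ => hder x) hi.integrableOn
  have hval := integral_of_hasDerivAt_of_tendsto hder hi hbot (tendsto_tailPrimitive N)
  rw [hΓ] at hval
  have hb : Tendsto (fun x => Real.exp (1 + 2 * Real.pi * |N.im|) * Real.exp (-N.re * x)) atBot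
      (𝓝 0) := by
    have h1 : Tendsto (fun x => Real.exp (-N.re * x)) atBot (𝓝 0) :=
      Real.tendsto_exp_atBot.comp (tendsto_id.const_mul_atBot (by linarith))
    simpa using h1.const_mul (Real.exp (1 + 2 * Real.pi * |N.im|))
  have ht := tendsto_sub_of_deriv_bound hb (hasDerivAt_tailPrimitive N)
    fun x hx u hu h0 h1 => by
      rw [norm_exp, ← Real.exp_add]
      apply Real.exp_le_exp.mpr
      rw [sub_re, neg_re, mul_re]
      have a1 : -(exp u).re ≤ 1 := by
        have h2 : |(exp u).re| ≤ 1 := by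
          refine (abs_re_le_norm _).trans ?_
          rw [norm_exp]
          exact Real.exp_le_one_iff.mpr (hu.trans hx)
        linarith [(abs_le.mp h2).1]
      have a2 : N.im * u.im ≤ 2 * Real.pi * |N.im| := by
        have h3 : N.im * u.im ≤ |N.im| * u.im := by gcongr; exact le_abs_self _
        nlinarith [mul_le_mul_of_nonneg_left h1 (abs_nonneg N.im)]
      nlinarith
  have h2 : ∀ x : ℝ, tailPrimitive N (x + 2 * Real.pi * I) - tailPrimitive N x =
      (exp (-(2 * Real.pi * I * N)) - 1) * tailPrimitive N x + connection N := by
    intro x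
    rw [tailPrimitive_add]
    ring
  have h3 := tendsto_nhds_unique (ht.congr h2) ((hbot.const_mul _).add_const _)
  have h4 : connection N = (exp (-(2 * Real.pi * I * N)) - 1) * Gamma (-N) := by
    rw [hval]
    linear_combination -h3
  have h5 := Gamma_mul_Gamma_one_sub (-N)
  rw [sub_neg_eq_add, add_comm 1 N] at h5
  have h6 : exp (-(2 * Real.pi * I * N)) - 1 =
      2 * I * exp (-(Real.pi * I * N)) * sin (Real.pi * -N) := by
    rw [sin]
    have q1 : exp (-(Real.pi * -N) * I) = exp (Real.pi * I * N) := by congr 1; ring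
    have q2 : exp (Real.pi * -N * I) = exp (-(Real.pi * I * N)) := by congr 1; ring
    rw [q1, q2]
    have q3 : exp (-(Real.pi * I * N)) * exp (Real.pi * I * N) = 1 := by
      rw [← exp_add]; simp
    have q4 : exp (-(2 * Real.pi * I * N)) = exp (-(Real.pi * I * N)) * exp (-(Real.pi * I * N)) := by
      rw [← exp_add]; congr 1; ring
    linear_combination q4 + q3 + (-exp (-(Real.pi * I * N)) * exp (Real.pi * I * N) +
      exp (-(Real.pi * I * N)) * exp (-(Real.pi * I * N))) * I_sq
  -- At negative integers the true value of 1/Γ(N + 1) is 0, in agreement with division by the value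
  -- 0 that `Gamma` takes at its poles; the sine vanishes there as well.
  by_cases hG : Gamma (N + 1) = 0
  · obtain ⟨m, hm⟩ := Gamma_eq_zero_iff (N + 1) |>.mp hG
    have hs : sin (Real.pi * -N) = 0 := by
      rw [show Real.pi * -N = ((m + 1 : ℕ) : ℂ) * Real.pi by
        push_cast; linear_combination -(Real.pi : ℂ) * hm]
      exact sin_nat_mul_pi _
    rw [h4, h6, hs, hG]
    simp
  · have hs : sin (Real.pi * -N) ≠ 0 := by
      intro hs
      rw [hs, div_zero, mul_eq_zero, or_iff_left hG] at h5
      exact Gamma_ne_zero_of_re_pos (by simpa using hN) h5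
    rw [eq_div_iff hG, h4, h6]
    rw [eq_div_iff hs] at h5
    linear_combination (2 * I * exp (-(Real.pi * I * N))) * h5

/-- Hankel's formula. -/
theorem connection_eq (N : ℂ) :
    connection N = 2 * Real.pi * I * exp (-(Real.pi * I * N)) / Gamma (N + 1) := by
  have key : ∀ n : ℕ, ∀ N : ℂ, N.re < n →
      connection N = 2 * Real.pi * I * exp (-(Real.pi * I * N)) / Gamma (N + 1) := by
    intro n
    induction n with
    | zero => exact fun N hN => connection_of_re_neg (by simpa using hN)
    | succ n ih =>
      intro N hN
      by_cases h0 : N = 0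
      · rw [h0, connection_zero]
        simp
      · have h1 := ih (N - 1) (by
          rw [sub_re, one_re]; push_cast at hN; linarith)
        rw [connection_sub_one, sub_add_cancel] at h1
        have h2 : exp (-(Real.pi * I * (N - 1))) = -exp (-(Real.pi * I * N)) := by
          rw [show -(Real.pi * I * (N - 1)) = -(Real.pi * I * N) + Real.pi * I by ring, exp_add,
            exp_pi_mul_I]
          ring
        rw [h2] at h1
        rw [Gamma_add_one N h0, ← mul_right_inj' (neg_ne_zero.mpr h0), h1]
        by_cases hG : Gamma N = 0
        · simp [hG]
        · field_simp
  obtain ⟨n, hn⟩ := exists_nat_gt N.re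
  exact key n N hn

theorem tendsto_tailPrimitive_add (N : ℂ) :
    Tendsto (fun x : ℝ => tailPrimitive N (x + 2 * Real.pi * I)) atTop
      (𝓝 (2 * Real.pi * I * exp (-(Real.pi * I * N)) / Gamma (N + 1))) := by
  have := ((tendsto_tailPrimitive N).const_mul (exp (-(2 * Real.pi * I * N)))).add_const
    (connection N)
  rw [mul_zero, zero_add, connection_eq] at this
  refine this.congr fun x => ?_
  rw [tailPrimitive_add, connection_eq]

/-! ### The hyperterminant in terms of the incomplete gamma function -/

/-- For σ₀z = e^x > 0 the ray integral rescales to K(e^x). By `hasDerivAt_K`, K(e^x) and -Γ(N+1)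
V(x) have the same derivative in x, and both vanish at +∞. -/
theorem exp_mul_rayIntegral {N : ℂ} (hN : 0 < N.re) (s : ℂ) (x : ℝ) :
    exp (-exp (x : ℂ)) / exp (N * (x - s)) * rayIntegral (x - s) (N + 1) s =
      exp (Real.pi * I * N) * Gamma (N + 1) * tailPrimitive N x := by
  have hN1 : -1 < N.re := by linarith
  set K : ℝ → ℂ := fun w => ∫ q in Ioi (0 : ℝ),
    exp (N * Real.log q) * (exp (-(w * (1 + q) : ℝ)) / (1 + q)) with hK
  -- the derivative with respect to `x`
  have hd : ∀ x : ℝ, HasDerivAt (fun x : ℝ => K (Real.exp x) + Gamma (N + 1) * tailPrimitive N x)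
      0 x := by
    intro x
    have h1 := (hasDerivAt_K hN1 (Real.exp_pos x)).scomp x (Real.hasDerivAt_exp x)
    have h2 := ((hasDerivAt_tailPrimitive N x).comp_ofReal).const_mul (Gamma (N + 1))
    refine (h1.add h2).congr_deriv ?_
    rw [Real.log_exp, real_smul, ofReal_exp,
      show -(N + 1) * (x : ℂ) = -N * x + -x by ring, exp_add, exp_neg (x : ℂ),
      show -exp (x : ℂ) - N * x = -exp (x : ℂ) + -N * x by ring, exp_add (-exp (x : ℂ))]
    have := exp_ne_zero (x : ℂ)
    field_simp
    ring
  have hc := is_const_of_deriv_eq_zero (fun v => (hd v).differentiableAt) (fun v => (hd v).deriv)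
  have hK0 : Tendsto (fun x : ℝ => K (Real.exp x)) atTop (𝓝 0) := by
    rw [tendsto_zero_iff_norm_tendsto_zero]
    have hint := integrable_kernel hN1 one_pos
    have hlim : Tendsto (fun x : ℝ => Real.exp (-Real.exp x) *
        ∫ q in Ioi (0 : ℝ), Real.exp (-1 * q) * Real.exp (N.re * Real.log q)) atTop (𝓝 0) := by
      have := (Real.tendsto_exp_neg_atTop_nhds_zero.comp Real.tendsto_exp_atTop).mul_const
        (∫ q in Ioi (0 : ℝ), Real.exp (-1 * q) * Real.exp (N.re * Real.log q))
      simpa using this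
    refine squeeze_zero' (Eventually.of_forall fun _ => norm_nonneg _) ?_ hlim
    filter_upwards [eventually_ge_atTop 0] with x hx
    rw [← integral_const_mul]
    refine norm_integral_le_of_norm_le (hint.const_mul _) ?_
    filter_upwards [ae_restrict_mem measurableSet_Ioi] with q hq
    have hq : 0 < q := hq
    have hE : 1 ≤ Real.exp x := Real.one_le_exp hx
    rw [norm_mul, norm_kernel, norm_div, norm_exp, ← mul_assoc, ← Real.exp_add, mul_comm]
    gcongr
    have h1 : ‖(1 + q : ℂ)‖ = 1 + q := by
      rw [show (1 + q : ℂ) = ((1 + q : ℝ) : ℂ) by push_cast; ring, norm_real,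
        Real.norm_of_nonneg (by linarith)]
    rw [h1]
    refine (div_le_self (Real.exp_pos _).le (by linarith)).trans ?_
    apply Real.exp_le_exp.mpr
    simp only [neg_re, ofReal_re]
    nlinarith
  have hKV : K (Real.exp x) + Gamma (N + 1) * tailPrimitive N x = 0 := by
    have ht := hK0.add ((tendsto_tailPrimitive N).const_mul (Gamma (N + 1)))
    have := tendsto_nhds_unique (ht.congr fun y => hc y x) tendsto_const_nhds
    simpa using this.symm
  have hKx : K (Real.exp x) = -(Gamma (N + 1) * tailPrimitive N x) := by
    linear_combination hKV
  rw [rayIntegral_eq, add_sub_cancel_right, add_sub_cancel, ← ofReal_exp,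
    M_eq_K N (Real.exp_pos _) (Real.exp_pos x), Real.log_exp, Real.log_exp,
    show (∫ q in Ioi (0 : ℝ), exp (N * Real.log q) *
      (exp (-(Real.exp x * (1 + q) : ℝ)) / (1 + q))) = K (Real.exp x) from rfl, hKx]
  have e1 : exp ((Real.pi - s.im) * I) = -exp (-(s.im * I)) := by
    rw [show (Real.pi - s.im) * I = -(s.im * I) + Real.pi * I by ring, exp_add, exp_pi_mul_I]
    ring
  have e2 : exp s = Real.exp s.re * exp (s.im * I) := by
    rw [ofReal_exp, ← exp_add, re_add_im]
  have e3 : exp (N * ((Real.pi - s.im) * I)) =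
      exp (Real.pi * I * N) * exp (-(N * s)) * exp (N * s.re) := by
    rw [← exp_add, ← exp_add]
    congr 1
    linear_combination (-N) * (re_add_im s)
  have e4 : exp (N * (x - s)) = exp (N * x) * exp (-(N * s)) := by
    rw [← exp_add]; congr 1; ring
  have e5 : exp (-N * s.re) = (exp (N * s.re))⁻¹ := by rw [← exp_neg]; congr 1; ring
  rw [e1, e2, e3, e4, e5, exp_neg (s.im * I), exp_neg ((Real.exp x : ℝ) : ℂ)]
  have n1 := exp_ne_zero (s.im * I)
  have n2 : ((Real.exp s.re : ℝ) : ℂ) ≠ 0 := by exact_mod_cast (Real.exp_pos _).ne'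
  have n3 := exp_ne_zero (N * s.re)
  have n4 := exp_ne_zero (N * x)
  have n5 := exp_ne_zero (-(N * s))
  have n6 := exp_ne_zero ((Real.exp x : ℝ) : ℂ)
  field_simp

/-- Both sides are entire in u = s + ζ and agree for real u, so the identity theorem covers the
whole Riemann surface. -/
theorem exp_mul_firstHyperterminant {N : ℂ} (hN : 0 < N.re) (s ζ : ℂ) :
    exp (-(exp s * exp ζ)) / exp (N * ζ) * firstHyperterminant ζ (N + 1) s =
      exp (Real.pi * I * N) * Gamma (N + 1) * tailPrimitive N (s + ζ) := by
  have ha : 0 < (N + 1).re := by rw [add_re, one_re]; linarith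
  have hF := differentiable_firstHyperterminant ha s
  have hV : Differentiable ℂ (tailPrimitive N) :=
    fun u => (hasDerivAt_tailPrimitive N u).differentiableAt
  have h1 : Differentiable ℂ fun u => exp (-exp u) / exp (N * (u - s)) *
      firstHyperterminant (u - s) (N + 1) s := by
    have hc : Differentiable ℂ fun u => firstHyperterminant (u - s) (N + 1) s :=
      hF.comp (differentiable_id.sub_const s)
    have h3 : Differentiable ℂ fun u => exp (-exp u) / exp (N * (u - s)) :=
      Differentiable.div (by fun_prop) (by fun_prop) fun u => exp_ne_zero _
    exact h3.mul hc
  have h2 : Differentiable ℂ fun u => exp (Real.pi * I * N) * Gamma (N + 1) * tailPrimitive N u :=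
    hV.const_mul _
  have hEq : (fun u => exp (-exp u) / exp (N * (u - s)) * firstHyperterminant (u - s) (N + 1) s) =
      fun u => exp (Real.pi * I * N) * Gamma (N + 1) * tailPrimitive N u := by
    refine AnalyticOnNhd.eq_of_frequently_eq (z₀ := 0)
      (fun u _ => h1.analyticAt u) (fun u _ => h2.analyticAt u) ?_
    have ht : Tendsto (fun x : ℝ => (x : ℂ)) (𝓝[≠] 0) (𝓝[≠] 0) := by
      refine tendsto_nhdsWithin_iff.mpr ⟨?_, ?_⟩
      · have := continuous_ofReal.tendsto (0 : ℝ)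
        rw [ofReal_zero] at this
        exact this.mono_left nhdsWithin_le_nhds
      · filter_upwards [self_mem_nhdsWithin] with x hx
        simpa using hx
    refine ht.frequently (Eventually.of_forall fun x => ?_).frequently
    rw [firstHyperterminant_eq ha (by simp [Real.pi_pos])]
    exact exp_mul_rayIntegral hN s x
  have := congrFun hEq (s + ζ)
  simp only [add_sub_cancel_left] at this
  rw [exp_add] at this
  exact this

/-! ### The difference of the hyperterminant and its approximation -/

/-- The exponential `exp (-α₀² N / 2)` as an entire function of `ω`. -/
noncomputable def phase (N ω : ℂ) : ℂ := exp (-(N * (1 + ω - exp ω)))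

theorem hasDerivAt_phase (N ω : ℂ) :
    HasDerivAt (phase N) (-(N * (1 - exp ω)) * phase N ω) ω := by
  have h := (((hasDerivAt_id ω).const_add 1).sub (Complex.hasDerivAt_exp ω)).const_mul N
  refine h.neg.cexp.congr_deriv ?_
  simp [phase, mul_comm]

theorem exp_neg_alpha_sq {ω : ℂ} (hω : ω ∈ strip) (N : ℂ) :
    exp (-(alpha ω ^ 2 / 2 * N)) = phase N ω := by
  rw [alpha_sq_eq hω, phase]
  congr 1
  ring

theorem norm_phase (N : ℂ) (x y : ℝ) :
    ‖phase N (x + y * I)‖ = Real.exp (-(‖N‖ * height (arg N) x y)) :=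
  norm_exp_phase N x y

/-- The normalized hyperterminant as a function of `ω`. -/
noncomputable def hyperFun (N ω : ℂ) : ℂ :=
  exp (Real.pi * I * N) * Gamma (N + 1) * tailPrimitive N (ω + log N + Real.pi * I)

/-- The square root of `N / 2`. -/
noncomputable def rootHalf (N : ℂ) : ℂ := (N / 2) ^ (1 / 2 : ℂ)

/-- The square root of `2 π / N`. -/
noncomputable def rootInv (N : ℂ) : ℂ := (2 * Real.pi / N) ^ (1 / 2 : ℂ)

/-- The leading approximation of `hyperFun`. -/
noncomputable def approxFun (N ω : ℂ) : ℂ :=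
  Real.pi * I * erfc (alpha ω * rootHalf N) + I * rootInv N * gFun ω * phase N ω

theorem log_real_div {N : ℂ} (hN : 0 < N.re) {c : ℝ} (hc : 0 < c) :
    log ((c : ℂ) / N) = Real.log c - log N := by
  have hN0 : N ≠ 0 := fun h => by simp [h] at hN
  have harg := abs_lt.mp (abs_arg_lt_pi_div_two_iff.mpr (Or.inl hN))
  rw [div_eq_mul_inv, log_ofReal_mul hc (inv_ne_zero hN0), log_inv]
  · ring
  · linarith [Real.pi_pos]

theorem rootHalf_eq {N : ℂ} (hN : 0 < N.re) :
    rootHalf N = exp ((log N - Real.log 2) / 2) := by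
  have hN0 : N ≠ 0 := fun h => by simp [h] at hN
  have h : N / 2 = ((2⁻¹ : ℝ) : ℂ) * N := by push_cast; ring
  rw [rootHalf, cpow_def_of_ne_zero (div_ne_zero hN0 two_ne_zero), h,
    log_ofReal_mul (by norm_num) hN0, Real.log_inv]
  push_cast
  congr 1
  ring

theorem rootInv_eq {N : ℂ} (hN : 0 < N.re) :
    rootInv N = exp ((Real.log (2 * Real.pi) - log N) / 2) := by
  have hN0 : N ≠ 0 := fun h => by simp [h] at hN
  have hpi := Real.pi_pos
  have h : (2 * Real.pi : ℂ) = ((2 * Real.pi : ℝ) : ℂ) := by push_cast; ring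
  have hpi0 : ((2 * Real.pi : ℝ) : ℂ) ≠ 0 := by exact_mod_cast (by positivity)
  rw [rootInv, h, cpow_def_of_ne_zero (div_ne_zero hpi0 hN0), log_real_div hN (by positivity)]
  congr 1
  ring

theorem rootHalf_sq {N : ℂ} (hN : 0 < N.re) : rootHalf N ^ 2 = N / 2 := by
  have hN0 : N ≠ 0 := fun h => by simp [h] at hN
  rw [rootHalf_eq hN, ← exp_nat_mul]
  have h : ((2 : ℕ) : ℂ) * ((log N - Real.log 2) / 2) = log N - Real.log 2 := by push_cast; ring
  rw [h, exp_sub, exp_log hN0, ← ofReal_exp, Real.exp_log two_pos]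
  norm_num

theorem exp_half_log {c : ℝ} (hc : 0 < c) : Real.exp (Real.log c / 2) = Real.sqrt c := by
  rw [Real.sqrt_eq_rpow, Real.rpow_def_of_pos hc]
  ring_nf

theorem two_mul_rootHalf {N : ℂ} (hN : 0 < N.re) :
    2 * (Real.sqrt Real.pi : ℂ) * rootHalf N = N * rootInv N := by
  have hN0 : N ≠ 0 := fun h => by simp [h] at hN
  have hpi := Real.pi_pos
  rw [rootHalf_eq hN, rootInv_eq hN]
  have e1 : N * exp ((Real.log (2 * Real.pi) - log N) / 2) =
      exp ((Real.log (2 * Real.pi) + log N) / 2) := by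
    nth_rewrite 1 [← exp_log hN0]
    rw [← exp_add]; congr 1; ring
  have e2 : (2 : ℂ) * (Real.sqrt Real.pi : ℂ) =
      exp (((Real.log 2 + Real.log (2 * Real.pi)) / 2 : ℝ) : ℂ) := by
    rw [← ofReal_exp, ← Real.log_mul (by norm_num) (by positivity), exp_half_log (by positivity),
      ← mul_assoc, Real.sqrt_mul (by norm_num),
      show (2 * 2 : ℝ) = 2 ^ 2 by norm_num, Real.sqrt_sq (by norm_num)]
    push_cast
    rfl
  rw [e1, e2, ← exp_add]
  congr 1
  push_cast
  ring

theorem rootHalf_re_pos {N : ℂ} (hN : 0 < N.re) : 0 < (rootHalf N).re := by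
  have harg := abs_lt.mp (abs_arg_lt_pi_div_two_iff.mpr (Or.inl hN))
  rw [rootHalf_eq hN, exp_re]
  refine mul_pos (Real.exp_pos _) (Real.cos_pos_of_mem_Ioo ?_)
  have : ((log N - Real.log 2) / 2).im = arg N / 2 := by
    rw [show (log N - Real.log 2) / 2 = (log N - Real.log 2) / ((2 : ℝ) : ℂ) by push_cast; ring,
      div_ofReal_im, sub_im, ofReal_im, sub_zero, log_im]
  rw [this]
  constructor <;> linarith [Real.pi_pos]

theorem norm_rootInv {N : ℂ} (hN : 0 < N.re) :
    ‖rootInv N / N‖ = Real.sqrt (2 * Real.pi) * ‖N‖ ^ (-(3 / 2) : ℝ) := by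
  have hN0 : N ≠ 0 := fun h => by simp [h] at hN
  have hNp : 0 < ‖N‖ := norm_pos_iff.mpr hN0
  have hpi := Real.pi_pos
  have h1 : ((Real.log (2 * Real.pi) - log N) / 2).re =
      Real.log (2 * Real.pi) / 2 - Real.log ‖N‖ / 2 := by
    rw [show (Real.log (2 * Real.pi) - log N) / 2 =
      (Real.log (2 * Real.pi) - log N) / ((2 : ℝ) : ℂ) by push_cast; ring,
      div_ofReal_re, sub_re, ofReal_re, log_re]
    ring
  rw [norm_div, rootInv_eq hN, norm_exp, h1, sub_eq_add_neg, Real.exp_add,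
    exp_half_log (by positivity), mul_div_assoc]
  congr 1
  rw [Real.rpow_def_of_pos hNp, div_eq_mul_inv]
  nth_rewrite 2 [← Real.exp_log hNp]
  rw [← Real.exp_neg, ← Real.exp_add]
  congr 1
  ring

/-- `Γ(N + 1) e^N N^{-N} / √(2 π N)`. -/
noncomputable def stirlingRatio (N : ℂ) : ℂ := scaledGamma N / Real.sqrt (2 * Real.pi)

/-- Since e^u = -N e^ω, the derivative of the primitive turns into `phase`; the factors depending on
N alone collect into Γ(N + 1) over its Stirling approximation. -/
theorem hasDerivAt_hyperFun {N : ℂ} (hN : 0 < N.re) (ω : ℂ) :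
    HasDerivAt (hyperFun N) (N * rootInv N * stirlingRatio N * phase N ω) ω := by
  have hN0 : N ≠ 0 := fun h => by simp [h] at hN
  have hpi := Real.pi_pos
  have h1 := ((hasDerivAt_tailPrimitive N (ω + log N + Real.pi * I)).comp ω
    (((hasDerivAt_id ω).add_const (log N)).add_const (Real.pi * I))).const_mul
      (exp (Real.pi * I * N) * Gamma (N + 1))
  refine h1.congr_deriv ?_
  have e1 : exp (ω + log N + Real.pi * I) = -(N * exp ω) := by
    rw [exp_add, exp_add, exp_log hN0, exp_pi_mul_I]; ring
  have e2 : rootInv N = Real.sqrt (2 * Real.pi) * exp (-(log N / 2)) := by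
    rw [rootInv_eq hN, ← exp_half_log (by positivity), ofReal_exp, ← exp_add]
    congr 1
    push_cast
    ring
  have hs0 : (Real.sqrt (2 * Real.pi) : ℂ) ≠ 0 := by
    exact_mod_cast (Real.sqrt_pos.mpr (by positivity)).ne'
  rw [e1, e2, stirlingRatio, scaledGamma, phase]
  have e3 : N * (Real.sqrt (2 * Real.pi) * exp (-(log N / 2))) *
      (Gamma (N + 1) * exp (N - (N + 1 / 2) * log N) / Real.sqrt (2 * Real.pi)) *
      exp (-(N * (1 + ω - exp ω))) = Gamma (N + 1) * (N * exp (-(log N / 2)) *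
        exp (N - (N + 1 / 2) * log N) * exp (-(N * (1 + ω - exp ω)))) := by
    field_simp
  rw [e3]
  have e4 : N * exp (-(log N / 2)) = exp (log N / 2) := by
    calc N * exp (-(log N / 2)) = exp (log N) * exp (-(log N / 2)) := by rw [exp_log hN0]
      _ = _ := by rw [← exp_add]; ring_nf
  rw [e4, mul_one, mul_comm (exp (Real.pi * I * N)), mul_assoc, ← exp_add, ← exp_add, ← exp_add]
  congr 2
  ring

/-- The contributions of order N from erfc and from differentiating `phase` are -iα₀' and a₀g₀,
which add up to 1 by `deriv_alpha_add`. This is the role of g₀ in the expansion. -/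
theorem hasDerivAt_approxFun {N : ℂ} (hN : 0 < N.re) {ω : ℂ} (hω : ω ∈ strip) :
    HasDerivAt (approxFun N) (rootInv N * phase N ω * (N + I * deriv gFun ω)) ω := by
  have hg := (differentiableOn_gFun.differentiableAt (isOpen_strip.mem_nhds hω)).hasDerivAt
  have hα := (differentiableAt_alpha hω).hasDerivAt
  have h1 := ((hasDerivAt_erfc (alpha ω * rootHalf N)).comp ω
    (hα.mul_const (rootHalf N))).const_mul (Real.pi * I)
  have h2 := (hg.const_mul (I * rootInv N)).mul (hasDerivAt_phase N ω)
  refine (h1.add h2).congr_deriv ?_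
  have e1 : exp (-(alpha ω * rootHalf N) ^ 2) = phase N ω := by
    rw [← exp_neg_alpha_sq hω, mul_pow, rootHalf_sq hN]
    congr 1
    ring
  rw [e1]
  have hsp : (Real.sqrt Real.pi : ℂ) ≠ 0 := by
    exact_mod_cast (Real.sqrt_pos.mpr Real.pi_pos).ne'
  have hsq : (Real.pi : ℂ) = (Real.sqrt Real.pi : ℂ) * (Real.sqrt Real.pi : ℂ) := by
    rw [← ofReal_mul, Real.mul_self_sqrt Real.pi_pos.le]
  have e2 : (Real.pi : ℂ) * I * (-(2 / (Real.sqrt Real.pi : ℂ)) * phase N ω *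
      (deriv alpha ω * rootHalf N)) = -I * deriv alpha ω * phase N ω * (N * rootInv N) := by
    rw [← two_mul_rootHalf hN]
    nth_rewrite 1 [hsq]
    field_simp
  rw [e2]
  have hid := deriv_alpha_add hω
  rw [← I_mul_aFun]
  linear_combination (phase N ω * N * rootInv N) * hid -
    (rootInv N * gFun ω * N * aFun ω * phase N ω) * I_sq

/-- The first coefficient of Stirling's formula, up to `O(1 / N)`. -/
noncomputable def stirlingCoeff (N : ℂ) : ℂ := N * (stirlingRatio N - 1)

/-- The difference of the hyperterminant and its approximation, with a further correction. -/
noncomputable def diffFun (N ω : ℂ) : ℂ :=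
  hyperFun N ω - approxFun N ω +
    12 * stirlingCoeff N * (rootInv N / N) * (qFun ω * phase N ω)

/-- The splitting is c - i g₀' = 12c (1/12 - i g₀') + (12c - 1) i g₀' with c = `stirlingCoeff N`.
The first part is 12c (1 - e^ω) q and is integrated by parts. Scaling by 12c, instead of subtracting
1/12 from c, leaves no constant term, so that only the decaying functions g₀' and q' remain. -/
theorem hasDerivAt_diffFun {N : ℂ} (hN : 0 < N.re) {ω : ℂ} (hω : ω ∈ strip) :
    HasDerivAt (diffFun N) (rootInv N / N * phase N ω *
      (N * (12 * stirlingCoeff N - 1) * (I * deriv gFun ω) +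
        12 * stirlingCoeff N * deriv qFun ω)) ω := by
  have hN0 : N ≠ 0 := fun h => by simp [h] at hN
  have hq := (differentiableOn_qFun.differentiableAt (isOpen_strip.mem_nhds hω)).hasDerivAt
  refine (((hasDerivAt_hyperFun hN ω).sub (hasDerivAt_approxFun hN hω)).add
    ((hq.mul (hasDerivAt_phase N ω)).const_mul
      (12 * stirlingCoeff N * (rootInv N / N)))).congr_deriv ?_
  have h1 := mul_qFun hω
  rw [hFun] at h1
  have h2 : N * stirlingRatio N = stirlingCoeff N + N := by rw [stirlingCoeff]; ring
  field_simp
  linear_combination (N * rootInv N * phase N ω) * h2 -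
    (12 * N * rootInv N * phase N ω * stirlingCoeff N) * h1

/-- Stirling's error 8/|N|² is multiplied by 12 N²; the second constant is 1 + 96/3. -/
theorem norm_stirlingCoeff_le {N : ℂ} (hN : 3 ≤ N.re) :
    ‖N * (12 * stirlingCoeff N - 1)‖ ≤ 96 ∧ ‖12 * stirlingCoeff N‖ ≤ 33 := by
  have hN3 : 3 ≤ ‖N‖ := hN.trans (re_le_norm N)
  have hN0 : N ≠ 0 := fun h => by norm_num [h] at hN3
  have h := norm_scaledGamma_sub_le hN
  have e : N * (12 * stirlingCoeff N - 1) =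
      12 * N ^ 2 * (scaledGamma N / Real.sqrt (2 * Real.pi) - 1 - 1 / (12 * N)) := by
    rw [stirlingCoeff, stirlingRatio]
    field_simp
  have h1 : ‖N * (12 * stirlingCoeff N - 1)‖ ≤ 96 := by
    rw [e, norm_mul, norm_mul, norm_pow, norm_ofNat]
    calc _ ≤ 12 * ‖N‖ ^ 2 * (8 / ‖N‖ ^ 2) := by gcongr
      _ = 96 := by field_simp; norm_num
  refine ⟨h1, ?_⟩
  rw [norm_mul] at h1
  have h2 := norm_sub_norm_le (12 * stirlingCoeff N) 1
  rw [norm_one] at h2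
  nlinarith [norm_nonneg (12 * stirlingCoeff N - 1)]

/-! ### Limits in the valleys -/

theorem tendsto_phase {N : ℂ} (hN : 0 < N.re) {y : ℝ} (hy : |y| ≤ 2 * Real.pi)
    (h1 : Real.pi / 2 ≤ |arg N + y|) (h2 : |arg N + y| ≤ 3 * Real.pi / 2) :
    Tendsto (fun x : ℝ => phase N (x + y * I)) atTop (𝓝 0) := by
  rw [tendsto_zero_iff_norm_tendsto_zero]
  exact squeeze_zero (fun _ => norm_nonneg _) (fun x => norm_exp_phase_le hy h1 h2)
    (tendsto_valley_bound hN)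

theorem norm_sub_le_vertical {f f' : ℂ → ℂ} {x y y' m : ℝ}
    (hf : ∀ t ∈ uIcc y y', HasDerivAt f (f' (x + t * I)) (x + t * I))
    (hb : ∀ t ∈ uIcc y y', ‖f' (x + t * I)‖ ≤ m) :
    ‖f (x + y' * I) - f (x + y * I)‖ ≤ m * |y' - y| := by
  have hd : ∀ t ∈ uIcc y y', HasDerivWithinAt (fun t : ℝ => f (x + t * I))
      (f' (x + t * I) * I) (uIcc y y') t := by
    intro t ht
    have h1 : HasDerivAt (fun t : ℝ => (x : ℂ) + t * I) I t := by
      have := ((hasDerivAt_id t).ofReal_comp.mul_const I).const_add (x : ℂ)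
      simpa using this
    exact ((hf t ht).comp t h1).hasDerivWithinAt
  have := (convex_uIcc y y').norm_image_sub_le_of_norm_hasDerivWithin_le hd (C := m)
    (fun t ht => by rw [norm_mul, norm_I, mul_one]; exact hb t ht) left_mem_uIcc right_mem_uIcc
  simpa [Real.norm_eq_abs] using this

/-- Comparison with a primitive of the weight makes the bound independent of the length of the
segment, as needed for unbounded horizontal legs. -/
theorem norm_sub_le_horizontal {f f' : ℂ → ℂ} {a b y m : ℝ} (hm : 0 ≤ m)
    (hf : ∀ t ∈ uIcc a b, HasDerivAt f (f' (t + y * I)) (t + y * I))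
    (hb : ∀ t ∈ uIcc a b, ‖f' (t + y * I)‖ ≤ m * weight t) :
    ‖f (b + y * I) - f (a + y * I)‖ ≤ m * ∫ t, weight t := by
  wlog hab : a ≤ b generalizing a b
  · rw [norm_sub_rev]
    rw [uIcc_comm] at hf hb
    exact this hf hb (not_le.mp hab).le
  rw [uIcc_of_le hab] at hf hb
  have hd : ∀ t ∈ Icc a b, HasDerivAt (fun t : ℝ => f (t + y * I) - f (a + y * I))
      (f' (t + y * I)) t := by
    intro t ht
    have h1 : HasDerivAt (fun t : ℝ => (t : ℂ) + y * I) 1 t := by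
      have := (hasDerivAt_id t).ofReal_comp.add_const (y * I : ℂ)
      simpa using this
    have := ((hf t ht).comp t h1).sub_const (f (a + y * I))
    rwa [mul_one] at this
  have hB : ∀ t, HasDerivAt (fun t => m * ∫ u in a..t, weight u) (m * weight t) t := fun t =>
    (continuous_weight.integral_hasStrictDerivAt a t).hasDerivAt.const_mul m
  have := image_norm_le_of_norm_deriv_right_le_deriv_boundary
    (fun t ht => (hd t ht).continuousAt.continuousWithinAt)
    (fun t ht => (hd t (Ico_subset_Icc_self ht)).hasDerivWithinAt) (by simp) hB
    (fun t ht => hb t (Ico_subset_Icc_self ht)) (right_mem_Icc.mpr hab)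
  refine this.trans ?_
  rw [intervalIntegral.integral_of_le hab]
  exact mul_le_mul_of_nonneg_left (setIntegral_le_integral integrable_weight
    (Eventually.of_forall fun t => (weight_pos t).le)) hm

/-- In a valley, the limit does not depend on the height of the horizontal line. -/
theorem tendsto_valley_transfer {N : ℂ} (hN : 0 < N.re) {f f' : ℂ → ℂ} {ε B b : ℝ}
    (hε : |ε| = 1) (hb : b ≤ 2 * Real.pi)
    (hf : ∀ ω : ℂ, |ω.im| ≤ b → HasDerivAt f (f' ω) ω)
    (hB : ∀ ω : ℂ, |ω.im| ≤ b → ‖f' ω‖ ≤ B * ‖phase N ω‖) {y y' : ℝ} (hy : |y| ≤ b)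
    (hy' : |y'| ≤ b) (h1 : ε * (arg N + y) ∈ Icc (Real.pi / 2) (3 * Real.pi / 2))
    (h2 : ε * (arg N + y') ∈ Icc (Real.pi / 2) (3 * Real.pi / 2)) {l : ℂ}
    (hl : Tendsto (fun x : ℝ => f (x + y * I)) atTop (𝓝 l)) :
    Tendsto (fun x : ℝ => f (x + y' * I)) atTop (𝓝 l) := by
  have hmem : ∀ t ∈ uIcc y y', |t| ≤ b ∧ Real.pi / 2 ≤ |arg N + t| ∧
      |arg N + t| ≤ 3 * Real.pi / 2 := by
    intro t ht
    have c1 : t ∈ Icc (-b) b :=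
      (uIcc_subset_Icc (abs_le.mp hy) (abs_le.mp hy')) ht
    have hconv : Convex ℝ {t : ℝ | ε * (arg N + t) ∈ Icc (Real.pi / 2) (3 * Real.pi / 2)} := by
      intro p hp q hq u v hu hv huv
      have : ε * (arg N + (u • p + v • q)) =
          u • (ε * (arg N + p)) + v • (ε * (arg N + q)) := by
        simp only [smul_eq_mul]
        linear_combination (-ε * arg N) * huv
      rw [mem_ofPred_eq, this]
      exact convex_Icc _ _ hp hq hu hv huv
    have c2 : t ∈ {t : ℝ | ε * (arg N + t) ∈ Icc (Real.pi / 2) (3 * Real.pi / 2)} := by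
      rw [← segment_eq_uIcc] at ht
      exact hconv.segment_subset h1 h2 ht
    have c3 : |arg N + t| = ε * (arg N + t) := by
      rw [← abs_of_nonneg (le_trans (by positivity) c2.1), abs_mul, hε, one_mul]
    rw [c3]
    exact ⟨abs_le.mpr c1, c2.1, c2.2⟩
  have hB0 : 0 ≤ |B| := abs_nonneg B
  have hz : Tendsto (fun x : ℝ => f (x + y' * I) - f (x + y * I)) atTop (𝓝 0) := by
    rw [tendsto_zero_iff_norm_tendsto_zero]
    have hlim := ((tendsto_valley_bound hN).const_mul |B|).mul_const |y' - y|
    rw [mul_zero, zero_mul] at hlim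
    refine squeeze_zero (fun _ => norm_nonneg _) (fun x => ?_) hlim
    refine norm_sub_le_vertical (f' := f') (fun t ht => hf _ (by simpa using (hmem t ht).1))
      fun t ht => ?_
    obtain ⟨m1, m2, m3⟩ := hmem t ht
    refine (hB _ (by simpa using m1)).trans ?_
    have := norm_exp_phase_le (N := N) (x := x) (m1.trans hb) m2 m3
    calc B * ‖phase N (x + t * I)‖ ≤ |B| * ‖phase N (x + t * I)‖ := by
          gcongr; exact le_abs_self B
      _ ≤ _ := by gcongr; exact this
  simpa using hz.add hl

/-- The sign ε labels the valley. On its central line arg N + y = επ the argument of the incomplete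
gamma function has imaginary part 0 or 2π, where the limits are the normalization at +∞ and Hankel's
formula; the rest of the valley follows by transfer. -/
theorem tendsto_hyperFun {N : ℂ} (hN : 0 < N.re) {ε : ℝ} (hε : ε = 1 ∨ ε = -1) {y : ℝ}
    (hy : |y| ≤ 2 * Real.pi) (h : ε * (arg N + y) ∈ Icc (Real.pi / 2) (3 * Real.pi / 2)) :
    Tendsto (fun x : ℝ => hyperFun N (x + y * I)) atTop (𝓝 (Real.pi * I * (1 + ε))) := by
  have hN0 : N ≠ 0 := fun h => by simp [h] at hN
  have hpi := Real.pi_pos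
  have harg := abs_lt.mp (abs_arg_lt_pi_div_two_iff.mpr (Or.inl hN))
  have hΓ : Gamma (N + 1) ≠ 0 := Gamma_ne_zero_of_re_pos (by rw [add_re, one_re]; linarith)
  have hshift : Tendsto (fun x : ℝ => x + Real.log ‖N‖) atTop atTop :=
    tendsto_atTop_add_const_right _ _ tendsto_id
  have hlog : log N = Real.log ‖N‖ + arg N * I := by
    rw [← re_add_im (log N), log_re, log_im]
  have hεε : ε * ε = 1 := by rcases hε with h | h <;> rw [h] <;> norm_num
  have hcenter : Tendsto (fun x : ℝ => hyperFun N (x + ((ε * Real.pi - arg N : ℝ) : ℂ) * I)) atTop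
      (𝓝 (Real.pi * I * (1 + ε))) := by
    rcases hε with rfl | rfl
    · have h1 := ((tendsto_tailPrimitive_add N).comp hshift).const_mul
        (exp (Real.pi * I * N) * Gamma (N + 1))
      have e1 : exp (Real.pi * I * N) * Gamma (N + 1) *
          (2 * Real.pi * I * exp (-(Real.pi * I * N)) / Gamma (N + 1)) =
          Real.pi * I * (1 + (1 : ℝ)) := by
        rw [exp_neg]
        have := exp_ne_zero (Real.pi * I * N)
        push_cast
        field_simp
        ring
      rw [e1] at h1
      refine h1.congr fun x => ?_
      simp only [Function.comp_apply]
      rw [hyperFun, hlog]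
      congr 2
      push_cast
      ring
    · have h1 := ((tendsto_tailPrimitive N).comp hshift).const_mul
        (exp (Real.pi * I * N) * Gamma (N + 1))
      have e1 : exp (Real.pi * I * N) * Gamma (N + 1) * 0 = Real.pi * I * (1 + (-1 : ℝ)) := by
        push_cast; ring
      rw [e1] at h1
      refine h1.congr fun x => ?_
      simp only [Function.comp_apply]
      rw [hyperFun, hlog]
      congr 2
      push_cast
      ring
  refine tendsto_valley_transfer hN (ε := ε) (b := 2 * Real.pi)
    (by rcases hε with h | h <;> rw [h] <;> norm_num) le_rfl
    (fun ω _ => hasDerivAt_hyperFun hN ω) (B := ‖N * rootInv N * stirlingRatio N‖)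
    (fun ω _ => (norm_mul _ _).le) ?_ hy ?_ h hcenter
  · rw [abs_le]
    rcases hε with h | h <;> rw [h] <;> constructor <;> linarith
  · have : ε * (arg N + (ε * Real.pi - arg N)) = Real.pi := by
      linear_combination Real.pi * hεε
    rw [this]
    constructor <;> linarith

/-- By the mean value theorem the value is t (sin c - sin θ) for some c between θ and θ + t, an
interval on which sine increases. -/
theorem height_zero_pos {θ t : ℝ} (hθ : |θ| < Real.pi / 2) (ht : 0 < t)
    (htθ : t ≤ Real.pi / 2 - θ) : 0 < height θ 0 t := by
  obtain ⟨h1, h2⟩ := abs_lt.mp hθ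
  obtain ⟨c, hc, hs⟩ := exists_deriv_eq_slope Real.cos (a := θ) (b := θ + t) (by linarith)
    Real.continuous_cos.continuousOn Real.differentiable_cos.differentiableOn
  rw [Real.deriv_cos, add_sub_cancel_left, eq_div_iff ht.ne'] at hs
  have hsin : Real.sin θ < Real.sin c :=
    Real.sin_lt_sin_of_lt_of_le_pi_div_two h1.le (by linarith [hc.2]) hc.1
  simp only [height, Real.exp_zero, add_zero, mul_one, one_mul]
  nlinarith

theorem height_mul_sign {ε : ℝ} (hε : ε = 1 ∨ ε = -1) (θ x t : ℝ) :
    height θ x (ε * t) = height (ε * θ) x t := by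
  rcases hε with rfl | rfl
  · simp
  · rw [neg_one_mul, neg_one_mul, ← height_neg θ, neg_neg]

/-- The sign of the real part of `α₀ √(N / 2)` at the bottom of the hill, on either side. -/
theorem re_alpha_mul_rootHalf {N : ℂ} (hN : 0 < N.re) {ε : ℝ} (hε : ε = 1 ∨ ε = -1) {x : ℝ}
    (hx : 0 ≤ x) :
    ε * (alpha (x + ((ε * (Real.pi / 2 - ε * arg N) : ℝ) : ℂ) * I) * rootHalf N).re < 0 := by
  have hpi := Real.pi_pos
  have hargabs : |arg N| < Real.pi / 2 := abs_arg_lt_pi_div_two_iff.mpr (Or.inl hN)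
  have hN0 : N ≠ 0 := fun h => by simp [h] at hN
  have hNp : 0 < ‖N‖ := norm_pos_iff.mpr hN0
  have hεabs : |ε| = 1 := by rcases hε with h | h <;> rw [h] <;> norm_num
  have hεε : ε * ε = 1 := by rcases hε with h | h <;> rw [h] <;> norm_num
  set θ := ε * arg N with hθdef
  have hθ : |θ| < Real.pi / 2 := by rwa [hθdef, abs_mul, hεabs, one_mul]
  obtain ⟨harg1, harg2⟩ := abs_lt.mp hθ
  set L := Real.pi / 2 - θ with hL
  have hL0 : 0 < L := by linarith
  -- The path leaves the saddle point 0 along the imaginary axis, reaches the edge of the valley at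
  -- t = L, and then runs to the right along that edge.
  let γ : ℝ → ℂ := fun t => ((max (t - L) 0 : ℝ) : ℂ) + ((ε * min t L : ℝ) : ℂ) * I
  have hγc : Continuous γ := by fun_prop
  have hγs : ∀ t ∈ Ioi (0 : ℝ), γ t ∈ strip := by
    intro t ht
    have ht : 0 < t := ht
    have h1 : (γ t).im = ε * min t L := by simp [γ]
    have h2 : 0 < min t L := lt_min ht hL0
    have h3 := min_le_right t L
    show |(γ t).im| < 2 * Real.pi
    rw [h1, abs_mul, hεabs, one_mul, abs_of_pos h2]
    linarith
  have hpos : ∀ t ∈ Ioi (0 : ℝ), 0 < height (arg N) (max (t - L) 0) (ε * min t L) := by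
    intro t ht
    have ht : 0 < t := ht
    rw [height_mul_sign hε, ← hθdef]
    rcases le_total t L with hle | hle
    · rw [min_eq_left hle, max_eq_right (by linarith)]
      exact height_zero_pos hθ ht (by linarith)
    · rw [min_eq_right hle]
      refine (height_zero_pos hθ hL0 le_rfl).trans_le (height_mono_right ?_ ?_ (le_max_right _ _))
      · exact Real.cos_nonneg_of_neg_pi_div_two_le_of_le harg1.le harg2.le
      · rw [hL, add_sub_cancel, Real.cos_pi_div_two]
  let f : ℝ → ℝ := fun t => ε * (alpha (γ t) * rootHalf N).re
  have hfc : ContinuousOn f (Ioi 0) := by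
    have h1 : ContinuousOn (fun t => alpha (γ t)) (Ioi 0) :=
      differentiableOn_alpha.continuousOn.comp hγc.continuousOn hγs
    exact (continuous_re.comp_continuousOn (h1.mul continuousOn_const)).const_mul ε
  -- The square of α₀√(N/2) has real part |N| times `height`, positive on the path, whereas the
  -- square of a purely imaginary number has nonpositive real part. The sign of f is therefore
  -- constant and can be read off near 0.
  have hf0 : ∀ t ∈ Ioi (0 : ℝ), f t ≠ 0 := by
    intro t ht h0
    have hre : (alpha (γ t) * rootHalf N).re = 0 := by
      have : ε ≠ 0 := fun h => by rw [h] at hεε; norm_num at hεε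
      exact (mul_eq_zero.mp h0).resolve_left this
    have h1 : (alpha (γ t) * rootHalf N) ^ 2 = N * (1 + γ t - exp (γ t)) := by
      rw [mul_pow, rootHalf_sq hN, alpha_sq_eq (hγs t ht)]; ring
    have h2 := congrArg re h1
    rw [re_mul_phase, sq, mul_re, hre] at h2
    have h3 := mul_pos hNp (hpos t ht)
    nlinarith [mul_self_nonneg (alpha (γ t) * rootHalf N).im]
  -- the sign near the origin
  have hnear : ∃ t ∈ Ioi (0 : ℝ), f t < 0 := by
    have hd := hasDerivAt_alpha_zero
    have hl : HasDerivAt (fun t : ℝ => ((ε * t : ℝ) : ℂ) * I) ((ε : ℂ) * I) 0 := by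
      have := (((hasDerivAt_id (0 : ℝ)).const_mul ε).ofReal_comp).mul_const I
      simpa using this
    have hd' : HasDerivAt alpha I (((ε * 0 : ℝ) : ℂ) * I) := by simpa using hd
    have hc := hd'.comp (0 : ℝ) hl
    have ht := (hasDerivAt_iff_tendsto_slope.mp hc).mono_left
      (nhdsWithin_mono (0 : ℝ) (fun t (ht : t ∈ Ioi (0 : ℝ)) => ne_of_gt ht))
    have ht2 := ((continuous_re.tendsto _).comp (ht.mul_const (rootHalf N))).const_mul ε
    have hval : ε * (I * ((ε : ℂ) * I) * rootHalf N).re = -(rootHalf N).re := by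
      have : I * ((ε : ℂ) * I) * rootHalf N = ((-ε : ℝ) : ℂ) * rootHalf N := by
        push_cast; linear_combination (ε * rootHalf N) * I_sq
      rw [this, re_ofReal_mul]
      linear_combination (-(rootHalf N).re) * hεε
    rw [hval] at ht2
    have hev := ht2.eventually (gt_mem_nhds (show -(rootHalf N).re < 0 by
      linarith [rootHalf_re_pos hN]))
    have hev2 : ∀ᶠ t in 𝓝[>] (0 : ℝ), t ∈ Ioo 0 L := Ioo_mem_nhdsGT hL0
    obtain ⟨t, h1, h2⟩ := (hev.and hev2).exists
    refine ⟨t, h2.1, ?_⟩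
    have hγt : γ t = ((ε * t : ℝ) : ℂ) * I := by
      simp only [γ]
      rw [max_eq_right (by linarith [h2.2]), min_eq_left h2.2.le]
      simp
    have hslope : slope (alpha ∘ fun t : ℝ => ((ε * t : ℝ) : ℂ) * I) 0 t =
        ((t⁻¹ : ℝ) : ℂ) * alpha (γ t) := by
      rw [slope, hγt]
      simp [alpha_zero]
    simp only [Function.comp_apply] at h1
    have h3 : ε * (((t⁻¹ : ℝ) : ℂ) * alpha (γ t) * rootHalf N).re < 0 := by
      rw [← hslope]; exact h1
    rw [mul_assoc, re_ofReal_mul] at h3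
    have h4 : t⁻¹ * f t < 0 := by
      simp only [f]; linarith
    by_contra hc
    have : 0 ≤ t⁻¹ * f t := mul_nonneg (inv_pos.mpr h2.1).le (not_lt.mp hc)
    linarith
  obtain ⟨t₀, ht₀, hft₀⟩ := hnear
  have hall : ∀ t ∈ Ioi (0 : ℝ), f t < 0 := by
    intro t ht
    by_contra hc
    obtain ⟨c, hc1, hc2⟩ := isPreconnected_Ioi.intermediate_value ht₀ ht hfc
      ⟨hft₀.le, not_lt.mp hc⟩
    exact hf0 c hc1 hc2
  have := hall (x + L) (show 0 < x + L by linarith)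
  simp only [f, γ] at this
  rwa [add_sub_cancel_right, max_eq_left hx, min_eq_right (by linarith)] at this

/-- On the edge arg N + y = επ/2 the number v = -εα₀√(N/2) has positive real part for x ≥ 0, so
|erfc v| ≤ |e^{-v²}| = |P| → 0. For ε = 1 the reflection erfc(-v) = 2 - erfc(v) yields the limit 2.
-/
theorem tendsto_approxFun {N : ℂ} (hN : 0 < N.re) {ε : ℝ} (hε : ε = 1 ∨ ε = -1) :
    Tendsto (fun x : ℝ => approxFun N (x + ((ε * (Real.pi / 2 - ε * arg N) : ℝ) : ℂ) * I)) atTop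
      (𝓝 (Real.pi * I * (1 + ε))) := by
  have hpi := Real.pi_gt_three
  obtain ⟨harg1, harg2⟩ := abs_lt.mp (abs_arg_lt_pi_div_two_iff.mpr (Or.inl hN))
  set y := ε * (Real.pi / 2 - ε * arg N) with hy
  have hyb : |y| ≤ 2 * Real.pi - 1 := by
    rw [abs_le]
    rcases hε with h | h <;> rw [hy, h] <;> constructor <;> linarith
  have hη : |arg N + y| = Real.pi / 2 := by
    rcases hε with h | h
    · rw [hy, h, show arg N + 1 * (Real.pi / 2 - 1 * arg N) = Real.pi / 2 by ring,
        abs_of_pos (by linarith)]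
    · rw [hy, h, show arg N + -1 * (Real.pi / 2 - -1 * arg N) = -(Real.pi / 2) by ring, abs_neg,
        abs_of_pos (by linarith)]
  have hmem : ∀ x : ℝ, |((x : ℂ) + y * I).im| ≤ 2 * Real.pi - 1 := fun x => by simpa using hyb
  have hs : ∀ x : ℝ, (x : ℂ) + y * I ∈ strip := fun x => mem_strip_of_le one_pos (hmem x)
  have tp := tendsto_phase hN (y := y) (by linarith) hη.ge (by linarith)
  obtain ⟨C, -, hC⟩ := exists_bounds one_pos le_rfl
  have te : Tendsto (fun x : ℝ => erfc (-ε * (alpha (x + y * I) * rootHalf N))) atTop (𝓝 0) := by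
    rw [tendsto_zero_iff_norm_tendsto_zero]
    refine squeeze_zero' (Eventually.of_forall fun _ => norm_nonneg _) ?_
      (tendsto_zero_iff_norm_tendsto_zero.mp tp)
    filter_upwards [eventually_ge_atTop 0] with x hx
    have hr := re_alpha_mul_rootHalf hN hε hx
    have hre : 0 ≤ (-(ε : ℂ) * (alpha (x + y * I) * rootHalf N)).re := by
      rw [neg_mul, neg_re, re_ofReal_mul]; linarith
    refine (norm_erfc_le hre).trans_eq ?_
    have hεε : (ε : ℂ) ^ 2 = 1 := by rcases hε with h | h <;> rw [h] <;> norm_num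
    rw [← exp_neg_alpha_sq (hs x) N, mul_pow, mul_pow, neg_sq, hεε, rootHalf_sq hN]
    congr 2
    ring
  have t1 : Tendsto (fun x : ℝ => erfc (alpha (x + y * I) * rootHalf N)) atTop
      (𝓝 (1 + ε)) := by
    rcases hε with h | h
    · rw [h] at te
      have := te.const_sub 2
      rw [h, show (1 + ((1 : ℝ) : ℂ)) = 2 - 0 by push_cast; norm_num]
      refine this.congr fun x => ?_
      have h3 := erfc_add_erfc_neg (alpha (x + y * I) * rootHalf N)
      rw [ofReal_one, neg_one_mul]
      linear_combination -h3
    · rw [h] at te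
      rw [h, show (1 + ((-1 : ℝ) : ℂ)) = 0 by push_cast; norm_num]
      refine te.congr fun x => ?_
      rw [ofReal_neg, ofReal_one, neg_neg, one_mul]
  have t2 : Tendsto (fun x : ℝ => I * rootInv N * gFun (x + y * I) * phase N (x + y * I)) atTop
      (𝓝 0) := by
    rw [tendsto_zero_iff_norm_tendsto_zero]
    have := (tendsto_zero_iff_norm_tendsto_zero.mp tp).const_mul (‖I * rootInv N‖ * C)
    rw [mul_zero] at this
    refine squeeze_zero (fun _ => norm_nonneg _) (fun x => ?_) this
    rw [norm_mul, norm_mul]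
    gcongr
    exact (hC _ (hmem x)).1
  have := (t1.const_mul (Real.pi * I : ℂ)).add t2
  rw [add_zero] at this
  exact this

/-- The bound on the derivative of `diffFun`. -/
theorem exists_deriv_diffFun_bound {δ : ℝ} (hδ : 0 < δ) (hδ1 : δ ≤ 1) :
    ∃ C, 0 < C ∧ ∀ N : ℂ, 3 ≤ N.re → ∀ ω : ℂ, |ω.im| ≤ 2 * Real.pi - δ → ‖qFun ω‖ ≤ C ∧
      ‖rootInv N / N * phase N ω * (N * (12 * stirlingCoeff N - 1) * (I * deriv gFun ω) +
        12 * stirlingCoeff N * deriv qFun ω)‖ ≤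
        C * ‖rootInv N / N‖ * ‖phase N ω‖ * weight ω.re := by
  obtain ⟨C, hC0, hC⟩ := exists_bounds hδ hδ1
  refine ⟨129 * C, by positivity, fun N hN ω hω => ?_⟩
  obtain ⟨-, h2, h3, h4⟩ := hC ω hω
  obtain ⟨s1, s2⟩ := norm_stirlingCoeff_le hN
  have hw := weight_pos ω.re
  refine ⟨by linarith, ?_⟩
  rw [norm_mul, norm_mul]
  have hsum : ‖N * (12 * stirlingCoeff N - 1) * (I * deriv gFun ω) +
      12 * stirlingCoeff N * deriv qFun ω‖ ≤ 129 * C * weight ω.re := by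
    refine (norm_add_le _ _).trans ?_
    rw [norm_mul _ (I * _), norm_mul I, norm_I, one_mul, norm_mul _ (deriv qFun ω)]
    calc _ ≤ 96 * (C * weight ω.re) + 33 * (C * weight ω.re) := by gcongr
      _ = _ := by ring
  calc _ ≤ ‖rootInv N / N‖ * ‖phase N ω‖ * (129 * C * weight ω.re) := by gcongr
    _ = _ := by ring

/-- The limits of the hyperterminant and of its approximation agree on the edge of each valley, and
the correction vanishes there with `phase`. The derivative bound carries the limit to the other
lines of the valley in the substrip. -/
theorem tendsto_diffFun {N : ℂ} (hN : 3 ≤ N.re) {δ : ℝ} (hδ : 0 < δ) (hδ1 : δ ≤ 1) {y : ℝ}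
    (hy : |y| ≤ 2 * Real.pi - δ) (h1 : Real.pi / 2 ≤ |arg N + y|)
    (h2 : |arg N + y| ≤ 3 * Real.pi / 2) :
    Tendsto (fun x : ℝ => diffFun N (x + y * I)) atTop (𝓝 0) := by
  have hN' : 0 < N.re := by linarith
  have hpi := Real.pi_gt_three
  obtain ⟨harg1, harg2⟩ := abs_lt.mp (abs_arg_lt_pi_div_two_iff.mpr (Or.inl hN'))
  obtain ⟨ε, hε, hεy⟩ : ∃ ε : ℝ, (ε = 1 ∨ ε = -1) ∧ |arg N + y| = ε * (arg N + y) := by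
    rcases le_total 0 (arg N + y) with h | h
    · exact ⟨1, Or.inl rfl, by rw [abs_of_nonneg h, one_mul]⟩
    · exact ⟨-1, Or.inr rfl, by rw [abs_of_nonpos h, neg_one_mul]⟩
  have hεabs : |ε| = 1 := by rcases hε with h | h <;> rw [h] <;> norm_num
  have hεε : ε * ε = 1 := by rcases hε with h | h <;> rw [h] <;> norm_num
  obtain ⟨C, hC0, hC⟩ := exists_deriv_diffFun_bound hδ hδ1
  set y₀ := ε * (Real.pi / 2 - ε * arg N) with hy₀
  have hy₀b : |y₀| ≤ 2 * Real.pi - δ := by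
    rw [abs_le]
    rcases hε with h | h <;> rw [hy₀, h] <;> constructor <;> linarith
  have hη : ε * (arg N + y₀) = Real.pi / 2 := by
    rw [hy₀]; linear_combination (Real.pi / 2 - ε * arg N) * hεε
  have hη' : |arg N + y₀| = Real.pi / 2 := by
    rw [← abs_of_pos (show 0 < Real.pi / 2 by linarith), ← hη, abs_mul, hεabs, one_mul]
  have hmem : ε * (arg N + y₀) ∈ Icc (Real.pi / 2) (3 * Real.pi / 2) := by
    rw [hη]; constructor <;> linarith
  have hlim : Tendsto (fun x : ℝ => diffFun N (x + y₀ * I)) atTop (𝓝 0) := by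
    have t1 := tendsto_hyperFun hN' hε (y := y₀) (by linarith) hmem
    have t2 := tendsto_approxFun hN' hε
    have tp := tendsto_phase hN' (y := y₀) (by linarith) hη'.ge (by linarith)
    have t3 : Tendsto (fun x : ℝ => 12 * stirlingCoeff N * (rootInv N / N) *
        (qFun (x + y₀ * I) * phase N (x + y₀ * I))) atTop (𝓝 0) := by
      rw [tendsto_zero_iff_norm_tendsto_zero]
      have := (tendsto_zero_iff_norm_tendsto_zero.mp tp).const_mul
        (‖12 * stirlingCoeff N * (rootInv N / N)‖ * C)
      rw [mul_zero] at this
      refine squeeze_zero (fun _ => norm_nonneg _) (fun x => ?_) this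
      rw [norm_mul, norm_mul (qFun _), ← mul_assoc]
      gcongr
      exact (hC N hN _ (by simpa using hy₀b)).1
    have := (t1.sub t2).add t3
    rw [sub_self, add_zero] at this
    exact this
  refine tendsto_valley_transfer hN' hεabs (b := 2 * Real.pi - δ) (by linarith)
    (fun ω hω => hasDerivAt_diffFun hN' (mem_strip_of_le hδ hω))
    (B := C * ‖rootInv N / N‖) (fun ω hω => ?_) hy₀b hy hmem (by rw [← hεy]; exact ⟨h1, h2⟩) hlim
  refine (hC N hN ω hω).2.trans (mul_le_of_le_one_right (by positivity) (weight_le_one _))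

/-- Integration along the path of `exists_descent`, on which |P| is at most its value at ω. The two
horizontal legs cost the integral of the weight each, the vertical leg its length, which is at most
4π. -/
theorem exists_diffFun_bound {δ : ℝ} (hδ : 0 < δ) (hδ1 : δ ≤ 1) :
    ∃ C, 0 < C ∧ ∀ N : ℂ, 3 ≤ N.re → ∀ ω : ℂ, |ω.im| ≤ 2 * Real.pi - δ →
      ‖diffFun N ω‖ ≤ C * ‖rootInv N / N‖ * ‖phase N ω‖ ∧ ‖qFun ω‖ ≤ C := by
  obtain ⟨C, hC0, hC⟩ := exists_deriv_diffFun_bound hδ hδ1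
  have hpi := Real.pi_pos
  have hI : 0 ≤ ∫ t, weight t := integral_nonneg fun t => (weight_pos t).le
  refine ⟨C * (1 + 2 * (∫ t, weight t) + 4 * Real.pi), by positivity, fun N hN ω hω => ⟨?_, ?_⟩⟩
  swap
  · refine (hC N hN ω hω).1.trans ?_
    nlinarith [mul_nonneg hC0.le hI, mul_nonneg hC0.le hpi.le]
  have hN' : 0 < N.re := by linarith
  have hθ : |arg N| < Real.pi / 2 := abs_arg_lt_pi_div_two_iff.mpr (Or.inl hN')
  obtain ⟨x₁, y₂, p1, p2, p3, p4, p5, p6⟩ := exists_descent (x := ω.re) hθ hδ hδ1 hω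
  set m := C * ‖rootInv N / N‖ * ‖phase N ω‖ with hm
  have hm0 : 0 ≤ m := by positivity
  obtain ⟨W, hW⟩ : ∃ W : ℂ → ℂ, W = fun ω => rootInv N / N * phase N ω *
      (N * (12 * stirlingCoeff N - 1) * (I * deriv gFun ω) +
        12 * stirlingCoeff N * deriv qFun ω) := ⟨_, rfl⟩
  have hder : ∀ x y : ℝ, |y| ≤ 2 * Real.pi - δ →
      HasDerivAt (diffFun N) (W (x + y * I)) (x + y * I) := fun x y hy => by
    rw [hW]
    exact hasDerivAt_diffFun hN' (mem_strip_of_le hδ (by simpa using hy))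
  have hbd : ∀ x y : ℝ, |y| ≤ 2 * Real.pi - δ →
      height (arg N) ω.re ω.im ≤ height (arg N) x y →
      ‖W (x + y * I)‖ ≤ m * weight x := by
    intro x y hy hh
    rw [hW]
    have h1 := (hC N hN (x + y * I) (by simpa using hy)).2
    have hre : ((x : ℂ) + y * I).re = x := by simp
    rw [hre] at h1
    refine h1.trans ?_
    have hw := weight_pos x
    have hph : ‖phase N (x + y * I)‖ ≤ ‖phase N ω‖ := by
      conv_rhs => rw [← re_add_im ω]
      rw [norm_phase, norm_phase]
      gcongr
    rw [hm]
    gcongr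
  have hω0 : (ω.re : ℂ) + ω.im * I = ω := re_add_im ω
  have s1 := norm_sub_le_horizontal hm0 (a := ω.re) (b := x₁) (y := ω.im)
    (fun t _ => hder t ω.im hω) fun t ht => hbd t ω.im hω (p4 t ht)
  have hvy : ∀ t ∈ uIcc ω.im y₂, |t| ≤ 2 * Real.pi - δ := fun t ht =>
    abs_le.mpr (uIcc_subset_Icc (abs_le.mp hω) (abs_le.mp p1) ht)
  have s2 := norm_sub_le_vertical (x := x₁) (y := ω.im) (y' := y₂) (m := m)
    (fun t ht => hder x₁ t (hvy t ht)) fun t ht =>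
      (hbd x₁ t (hvy t ht) (p5 t ht)).trans (mul_le_of_le_one_right hm0 (weight_le_one _))
  have s3 : ‖diffFun N (x₁ + y₂ * I)‖ ≤ m * ∫ t, weight t := by
    have hl := ((tendsto_diffFun hN hδ hδ1 p1 p2 p3).sub_const (diffFun N (x₁ + y₂ * I))).norm
    rw [zero_sub, norm_neg] at hl
    refine le_of_tendsto hl ?_
    filter_upwards [eventually_ge_atTop x₁] with X hX
    refine norm_sub_le_horizontal hm0 (fun t _ => hder t y₂ p1) fun t ht => ?_
    rw [uIcc_of_le hX] at ht
    exact hbd t y₂ p1 (p6 t ht.1)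
  rw [hω0] at s1
  have hy4 : |y₂ - ω.im| ≤ 4 * Real.pi := by
    have := abs_sub y₂ ω.im
    linarith
  have s2' : m * |y₂ - ω.im| ≤ m * (4 * Real.pi) := by gcongr
  have tri : ‖diffFun N ω‖ ≤ ‖diffFun N (x₁ + ω.im * I) - diffFun N ω‖ +
      ‖diffFun N (x₁ + y₂ * I) - diffFun N (x₁ + ω.im * I)‖ + ‖diffFun N (x₁ + y₂ * I)‖ := by
    have e : diffFun N ω = diffFun N (x₁ + y₂ * I) -
        (diffFun N (x₁ + y₂ * I) - diffFun N (x₁ + ω.im * I)) -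
        (diffFun N (x₁ + ω.im * I) - diffFun N ω) := by ring
    have h1 := norm_sub_le (diffFun N (x₁ + y₂ * I) -
      (diffFun N (x₁ + y₂ * I) - diffFun N (x₁ + ω.im * I)))
      (diffFun N (x₁ + ω.im * I) - diffFun N ω)
    have h2 := norm_sub_le (diffFun N (x₁ + y₂ * I))
      (diffFun N (x₁ + y₂ * I) - diffFun N (x₁ + ω.im * I))
    rw [← e] at h1
    linarith
  have hfin : C * (1 + 2 * (∫ t, weight t) + 4 * Real.pi) * ‖rootInv N / N‖ * ‖phase N ω‖ =
      m * (1 + 2 * (∫ t, weight t) + 4 * Real.pi) := by rw [hm]; ring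
  rw [hfin]
  nlinarith

/-- The correction term is itself within the claimed error, because q is bounded on the substrip and
|√(2π/N)/N| is a multiple of |N|^{-3/2}; hence it can be removed again. -/
theorem exists_hyperFun_sub_approxFun_bound {δ : ℝ} (hδ : 0 < δ) (hδ1 : δ ≤ 1) :
    ∃ C, 0 < C ∧ ∀ N : ℂ, 3 ≤ N.re → ∀ ω : ℂ, |ω.im| ≤ 2 * Real.pi - δ →
      ‖hyperFun N ω - approxFun N ω‖ ≤ C * (‖phase N ω‖ * ‖N‖ ^ (-(3 / 2) : ℝ)) := by
  obtain ⟨C, hC0, hC⟩ := exists_diffFun_bound hδ hδ1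
  have hpi := Real.pi_pos
  refine ⟨34 * C * Real.sqrt (2 * Real.pi), by positivity, fun N hN ω hω => ?_⟩
  obtain ⟨h1, h2⟩ := hC N hN ω hω
  have e : hyperFun N ω - approxFun N ω = diffFun N ω -
      12 * stirlingCoeff N * (rootInv N / N) * (qFun ω * phase N ω) := by
    rw [diffFun]; ring
  have h3 : ‖12 * stirlingCoeff N * (rootInv N / N) * (qFun ω * phase N ω)‖ ≤
      33 * ‖rootInv N / N‖ * (C * ‖phase N ω‖) := by
    rw [norm_mul, norm_mul _ (rootInv N / N), norm_mul (qFun ω)]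
    have := (norm_stirlingCoeff_le hN).2
    gcongr
  rw [e]
  refine (norm_sub_le _ _).trans ?_
  have h4 : 34 * C * Real.sqrt (2 * Real.pi) * (‖phase N ω‖ * ‖N‖ ^ (-(3 / 2) : ℝ)) =
      34 * (C * ‖rootInv N / N‖ * ‖phase N ω‖) := by
    rw [norm_rootInv (by linarith)]; ring
  rw [h4]
  linarith

end Hyperterminant

theorem mainTheorem7 (K δ : ℝ) (hδ : 0 < δ) :
    ∃ C R : ℝ, 0 < R ∧ ∀ N₀ s ζ : ℂ,
      ‖Complex.exp s‖ ≤ K → ‖(Complex.exp s)⁻¹‖ ≤ K → R ≤ N₀.re →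
      |(Hyperterminant.stokesVariable N₀ s ζ).im| ≤ 2 * Real.pi - δ →
      let ω : ℂ := Hyperterminant.stokesVariable N₀ s ζ
      let α₀ : ℂ := Hyperterminant.alpha ω
      let g₀ : ℂ := Hyperterminant.gFun ω
      ‖Complex.exp (-(Complex.exp s * Complex.exp ζ)) / Complex.exp (N₀ * ζ) *
            Hyperterminant.firstHyperterminant ζ (N₀ + 1) s -
          (Real.pi * Complex.I * Hyperterminant.erfc (α₀ * (N₀ / 2) ^ (1 / 2 : ℂ)) +
            Complex.I * (2 * Real.pi / N₀) ^ (1 / 2 : ℂ) * g₀ *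
              Complex.exp (-(α₀ ^ 2 / 2 * N₀)))‖ ≤
        C * (‖Complex.exp (-(α₀ ^ 2 / 2 * N₀))‖ * ‖N₀‖ ^ (-(3 / 2) : ℝ)) := by
  -- The descent paths need room around the valley edges, so δ is capped at 1; this only enlarges
  -- the sector.
  obtain ⟨C, -, hC⟩ := Hyperterminant.exists_hyperFun_sub_approxFun_bound
    (δ := min δ 1) (lt_min hδ one_pos) (min_le_right _ _)
  refine ⟨C, 3, by norm_num, fun N₀ s ζ _ _ hN hω => ?_⟩
  intro ω α₀ g₀
  have hs : ω ∈ Hyperterminant.strip := Hyperterminant.mem_strip_of_le hδ hω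
  have h := hC N₀ hN ω (hω.trans (by linarith [min_le_left δ 1]))
  have hT : Hyperterminant.hyperFun N₀ ω =
      Complex.exp (-(Complex.exp s * Complex.exp ζ)) / Complex.exp (N₀ * ζ) *
        Hyperterminant.firstHyperterminant ζ (N₀ + 1) s := by
    rw [Hyperterminant.exp_mul_firstHyperterminant (by linarith), Hyperterminant.hyperFun]
    congr 2
    simp only [ω, Hyperterminant.stokesVariable]
    ring
  rw [hT, Hyperterminant.approxFun, ← Hyperterminant.exp_neg_alpha_sq hs] at h
  exact h
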